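/- Let $F=(V,E)$ be a finite simple bipartite graph with $m=|E|$ edges and with a fixed bipartition $(A,B)$ of its vertex set. For a bounded measurable function $W\colon[0,1]^2\to\mathbb{R}$ (not necessarily symmetric) put $$t(F,W)=\int_{[0,1]^{V}}\ \prod_{ab\in E,\ a\in A,\ b\in B} W(x_a,x_b)\ \prod_{v\in V}dx_v ,\qquad \|W\|_\square=\sup_{S,T\subseteq[0,1]}\Bigl|\int_{S\times T}W(x,y)\,dx\,dy\Bigr| ,$$ where $S,T$ range over the measurable subsets of $[0,1]$. Let $W\colon[0,1]^2\to\mathbb{R}$ be a measurable function with $\int_{[0,1]^2}W=1$, $0\le W\le 2$ and $\|W-1\|_\square\le 2^{-8m}$. Then $t(F,W)\ge 1=t(F,1)$. That is, the constant function $1$ minimizes $t(F,\cdot)$ among all such $W$, so Sidorenko's conjecture holds locally around it. -/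

import Mathlib

open MeasureTheory
open scoped unitInterval

noncomputable section

/-- The cut norm of a kernel `U : [0,1]² → ℝ`: the supremum over measurable `S, T ⊆ [0,1]` of
`|∫_{S × T} U|`, with respect to Lebesgue measure. (For bounded measurable `U`, the set of values
is nonempty and bounded.) -/
def cutNorm (U : I → I → ℝ) : ℝ :=
  sSup {r : ℝ | ∃ S T : Set I, MeasurableSet S ∧ MeasurableSet T ∧
    r = |∫ p in S ×ˢ T, U p.1 p.2|}

/-- The density `t(F, W)` of a bipartite graph `F` with bipartition `(A, B)` in a kernel `W`: the
integral over `x ∈ [0,1]^V` of the product, over the edges of `F`, of `W (x a) (x b)`, where `a` is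
the endpoint of the edge in `A` and `b` is its endpoint in `B`. The kernel need not be symmetric, so
the order of the two classes matters. -/
def bigraphDensity {V : Type*} [Fintype V] (F : SimpleGraph V) [DecidableRel F.Adj]
    (A B : Finset V) (W : I → I → ℝ) : ℝ :=
  ∫ x : V → I, ∏ e ∈ (A ×ˢ B).filter (fun e => F.Adj e.1 e.2), W (x e.1) (x e.2)

end

/-! Write W = 1 + U, where U has mean zero, |U| ≤ 1 and small cut norm, and expand the product over
the edges: t(F, W) is the sum of t(E', U) over all edge sets E' ⊆ E, the empty set contributing 1.
Some terms add up to a nonnegative main part P, and each of the others is at most c · 2P in absolute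
value, where c bounds the operator norm of U. There are at most 2^m of these and 2^(m+1) c ≤ 1, so
they cannot outweigh P.

The bound c comes from the four-cycle: ‖U‖⁴ is at most the four-cycle density, which is at most four
times the cut norm (`opBound_of_cut`).

The main part consists of complete bipartite graphs with at least two edges and of even cycles. An
even cycle is a trace of an even power of a symmetric matrix. A single biclique may have negative
density, but for a fixed class A the sum over all B with |B| ≥ 2 among the n common neighbours is
the mean of (1 + x)^n - 1 - n x, where x ≥ -1 is the normalized codegree of A. This is nonnegative
by Bernoulli, and at least the mean of x² if n ≥ 2 (`bicSum_nonneg`, `nrm_codeg_sq_le`). A single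
edge has density zero.

For the other terms, suppose that after some vertices are integrated out an edge ab remains whose
cofactors are P, independent of the value at a, and Q, independent of the value at b. Then the
density is at most c ‖P‖ ‖Q‖ (`abs_expect_wprod_mul_le`). Suitable P and Q come from a leaf, which
leaves a degree function controlled by stars, or from half of a shortest cycle, whose L² norm is
controlled by the whole cycle through a reflection inequality (`nrm_innerAvg_sq_le`).
`MainBound.abs_dens_le` shows that a graph that is neither a biclique nor a cycle has two such
pieces and a free edge, unless it has an isolated edge and so density zero.

All this is done for kernels on a finite set. The passage to [0,1] replaces W - 1 by its averages
over a fine grid (`exists_cellAvg_approx`), which keeps the mean, does not increase the cut norm and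
changes the densities arbitrarily little. -/

namespace LocalSidorenko

open Finset Function
open scoped BigOperators

set_option linter.unusedSectionVars false

/-! ### Partial averages on a finite power, and the gain from a kernel of small operator norm. -/

section Averaging

variable {V ι : Type*} [Fintype V] [DecidableEq V] [Fintype ι] [Nonempty ι]

/-- The average of `G` over the coordinates in `T`, the other coordinates being kept. -/
noncomputable def avgOn (T : Finset V) (G : (V → ι) → ℝ) (z : V → ι) : ℝ :=
  𝔼 w : V → ι, G (T.piecewise w z)

/-- The normalized `L²` norm of a function on a finite type. -/
noncomputable def nrm {X : Type*} [Fintype X] (f : X → ℝ) : ℝ := √(𝔼 x, f x ^ 2)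

lemma nrm_nonneg {X : Type*} [Fintype X] (f : X → ℝ) : 0 ≤ nrm f := Real.sqrt_nonneg _

lemma sq_nrm {X : Type*} [Fintype X] (f : X → ℝ) : nrm f ^ 2 = 𝔼 x, f x ^ 2 :=
  Real.sq_sqrt (expect_nonneg fun _ _ => sq_nonneg _)

lemma nrm_le_of_abs_le {X : Type*} [Fintype X] {f g : X → ℝ} (h : ∀ x, |f x| ≤ |g x|) :
    nrm f ≤ nrm g :=
  Real.sqrt_le_sqrt (expect_le_expect fun x _ => sq_le_sq.mpr (h x))

lemma abs_expect_mul_le {X : Type*} [Fintype X] (f g : X → ℝ) :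
    |𝔼 x, f x * g x| ≤ nrm f * nrm g := by
  rw [← abs_of_nonneg (mul_nonneg (nrm_nonneg f) (nrm_nonneg g))]
  apply sq_le_sq.mp
  rw [mul_pow, sq_nrm, sq_nrm]
  exact expect_mul_sq_le_sq_mul_sq _ _ _

/-- Exchanging the coordinates in `T` between `z` and `w` is an involution on pairs. -/
lemma expect_piecewise (T : Finset V) (G : (V → ι) → ℝ) :
    𝔼 z : V → ι, 𝔼 w : V → ι, G (T.piecewise w z) = 𝔼 z, G z := by
  classical
  have h : 𝔼 z : V → ι, 𝔼 w : V → ι, G (T.piecewise w z)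
      = 𝔼 z : V → ι, 𝔼 _w : V → ι, G z := by
    rw [← expect_product' univ univ (fun z w => G (T.piecewise w z)),
      ← expect_product' univ univ (fun z _ => G z)]
    refine expect_nbij' (fun p => (T.piecewise p.2 p.1, T.piecewise p.1 p.2))
      (fun p => (T.piecewise p.2 p.1, T.piecewise p.1 p.2)) ?_ ?_ ?_ ?_ ?_
    · simp
    · simp
    · rintro ⟨z, w⟩ -
      refine Prod.ext ?_ ?_ <;> ext v <;> by_cases hv : v ∈ T <;> simp [hv]
    · rintro ⟨z, w⟩ -
      refine Prod.ext ?_ ?_ <;> ext v <;> by_cases hv : v ∈ T <;> simp [hv]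
    · simp
  rw [h]
  simp

lemma expect_avgOn (T : Finset V) (G : (V → ι) → ℝ) : 𝔼 z, avgOn T G z = 𝔼 z, G z :=
  expect_piecewise T G

lemma avgOn_mul_left {T : Finset V} {R : (V → ι) → ℝ} (hR : DependsOn R ((T : Set V)ᶜ))
    (G : (V → ι) → ℝ) (z : V → ι) :
    avgOn T (fun z => R z * G z) z = R z * avgOn T G z := by
  unfold avgOn
  rw [mul_expect]
  refine expect_congr rfl fun w _ => ?_
  show R (T.piecewise w z) * _ = _
  rw [hR (x := T.piecewise w z) (y := z) fun i hi => piecewise_eq_of_notMem _ _ _ (by simpa using hi)]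

lemma expect_mul_avgOn {T : Finset V} {R : (V → ι) → ℝ} (hR : DependsOn R ((T : Set V)ᶜ))
    (G : (V → ι) → ℝ) :
    𝔼 z, R z * avgOn T G z = 𝔼 z, R z * G z := by
  rw [← expect_avgOn T fun z => R z * G z]
  exact expect_congr rfl fun z _ => (avgOn_mul_left hR G z).symm

lemma dependsOn_avgOn {G : (V → ι) → ℝ} {s : Set V} (hG : DependsOn G s) (T : Finset V) :
    DependsOn (avgOn T G) (s \ T) := by
  intro x y h
  refine expect_congr rfl fun w _ => hG fun i hi => ?_
  by_cases hT : i ∈ T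
  · simp [hT]
  · simp [hT, h i ⟨hi, by simpa using hT⟩]

lemma avgOn_avgOn (T T' : Finset V) (G : (V → ι) → ℝ) (z : V → ι) :
    avgOn T (avgOn T' G) z = avgOn (T ∪ T') G z := by
  unfold avgOn
  rw [← expect_piecewise T' fun w => G ((T ∪ T').piecewise w z)]
  refine expect_congr rfl fun w _ => expect_congr rfl fun w' _ => ?_
  congr 1
  ext v
  by_cases h1 : v ∈ T' <;> by_cases h2 : v ∈ T <;> simp [h1, h2]

lemma expect_eval (f : ι → ℝ) (v : V) : 𝔼 w : V → ι, f (w v) = 𝔼 s, f s := by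
  rw [Fintype.expect_equiv (Equiv.funSplitAt v ι) (fun w => f (w v))
    (fun p : ι × ({j // j ≠ v} → ι) => f p.1) (fun w => rfl)]
  rw [← univ_product_univ, expect_product]
  simp

lemma avgOn_singleton (v : V) (G : (V → ι) → ℝ) (z : V → ι) :
    avgOn {v} G z = 𝔼 s, G (update z v s) := by
  unfold avgOn
  rw [← expect_eval (fun s => G (update z v s)) v]
  simp [piecewise_singleton]

lemma expect_update (v : V) (G : (V → ι) → ℝ) :
    𝔼 z : V → ι, 𝔼 s, G (update z v s) = 𝔼 z, G z := by
  simp_rw [← avgOn_singleton]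
  exact expect_avgOn {v} G

/-- If a kernel has small operator norm, then a factor `k (z a) (z b)` makes an average small,
provided the other factors split into one not depending on `z a` and one not depending on
`z b`. -/
lemma abs_expect_kernel_mul_le {k : ι → ι → ℝ} {c : ℝ} (hc : 0 ≤ c)
    (hk : ∀ φ ψ : ι → ℝ, |𝔼 s, 𝔼 t, k s t * (φ s * ψ t)| ≤ c * (nrm φ * nrm ψ))
    {a b : V} (hab : a ≠ b) {P Q : (V → ι) → ℝ}
    (hP : DependsOn P {a}ᶜ) (hQ : DependsOn Q {b}ᶜ) :
    |𝔼 z : V → ι, k (z a) (z b) * (P z * Q z)| ≤ c * (nrm P * nrm Q) := by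
  -- The coordinates a and b are resampled as `s` and `t`. Since `P` ignores `s` and `Q` ignores
  -- `t`, for fixed `z` the inner average is the bilinear form of `k`; Cauchy–Schwarz over `z` then
  -- finishes.
  have h1 : 𝔼 z : V → ι, k (z a) (z b) * (P z * Q z)
      = 𝔼 z : V → ι, 𝔼 s, 𝔼 t, k s t * (Q (update z a s) * P (update z b t)) := by
    rw [← expect_update b, ← expect_update a]
    refine expect_congr rfl fun z _ => expect_congr rfl fun s _ => expect_congr rfl fun t _ => ?_
    have e1 : P (update (update z a s) b t) = P (update z b t) := hP fun i hi => by
      have : i ≠ a := by simpa using hi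
      by_cases hb : i = b
      · subst hb; simp
      · simp [hb, this]
    have e2 : Q (update (update z a s) b t) = Q (update z a s) := hQ fun i hi => by
      have : i ≠ b := by simpa using hi
      simp [this]
    rw [e1, e2, update_self, update_of_ne hab, update_self]
    ring
  rw [h1]
  calc |𝔼 z : V → ι, 𝔼 s, 𝔼 t, k s t * (Q (update z a s) * P (update z b t))|
      ≤ 𝔼 z : V → ι, |𝔼 s, 𝔼 t, k s t * (Q (update z a s) * P (update z b t))| :=
        abs_expect_le _ _
    _ ≤ 𝔼 z : V → ι, c * (nrm (fun s => Q (update z a s)) * nrm (fun t => P (update z b t))) :=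
        expect_le_expect fun z _ => hk _ _
    _ = c * 𝔼 z : V → ι, (nrm (fun s => Q (update z a s)) * nrm (fun t => P (update z b t))) := by
        rw [mul_expect]
    _ ≤ c * (nrm (fun z : V → ι => nrm (fun s => Q (update z a s))) *
          nrm (fun z : V → ι => nrm (fun t => P (update z b t)))) := by
        gcongr
        exact (le_abs_self _).trans (abs_expect_mul_le _ _)
    _ = c * (nrm P * nrm Q) := by
        have hn : ∀ (v : V) (R : (V → ι) → ℝ),
            nrm (fun z : V → ι => nrm (fun s => R (update z v s))) = nrm R := by
          intro v R
          unfold nrm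
          congr 1
          simp_rw [fun z : V → ι => Real.sq_sqrt (expect_nonneg (s := univ)
            fun s _ => sq_nonneg (R (update z v s)))]
          exact expect_update v fun z => R z ^ 2
        rw [hn, hn]
        ring

end Averaging

end LocalSidorenko

namespace LocalSidorenko

open Finset Function
open scoped BigOperators

/-! ### The reflection inequality for closed walks with weights on the vertices. -/

section Reflection

open Matrix

variable {Z : Type*} [Fintype Z] [DecidableEq Z]

/-- The matrix `S D₁ S D₂ ⋯ D_k S`, where `D_i` is the diagonal matrix of the `i`-th weight. -/
def pathMat (S : Matrix Z Z ℝ) : List (Z → ℝ) → Matrix Z Z ℝ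
  | [] => S
  | m :: l => S * diagonal m * pathMat S l

/-- The closed walk density `tr (D₁ S D₂ S ⋯ D_k S)`. -/
def cyc (S : Matrix Z Z ℝ) (L : List (Z → ℝ)) : ℝ :=
  trace (L.map fun m => diagonal m * S).prod

lemma pathMat_append (S : Matrix Z Z ℝ) (l : List (Z → ℝ)) (m : Z → ℝ) (l' : List (Z → ℝ)) :
    pathMat S (l ++ m :: l') = pathMat S l * diagonal m * pathMat S l' := by
  induction l with
  | nil => rfl
  | cons a l ih => simp [pathMat, ih, Matrix.mul_assoc]

lemma transpose_pathMat {S : Matrix Z Z ℝ} (hS : Sᵀ = S) (l : List (Z → ℝ)) :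
    (pathMat S l)ᵀ = pathMat S l.reverse := by
  induction l with
  | nil => simpa [pathMat]
  | cons a l ih =>
    rw [List.reverse_cons, pathMat_append, ← ih, pathMat]
    simp [pathMat, hS, Matrix.mul_assoc]

lemma prod_map_cons (S : Matrix Z Z ℝ) (m : Z → ℝ) (l : List (Z → ℝ)) :
    ((m :: l).map fun m => diagonal m * S).prod = diagonal m * pathMat S l := by
  induction l generalizing m with
  | nil => simp [pathMat]
  | cons a l ih => rw [List.map_cons, List.prod_cons, ih, pathMat]; simp [Matrix.mul_assoc]

lemma pathMat_replicate_one (S : Matrix Z Z ℝ) (k : ℕ) :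
    pathMat S (List.replicate k 1) = S ^ (k + 1) := by
  induction k with
  | zero => simp [pathMat]
  | succ k ih =>
    rw [List.replicate_succ, pathMat, ih, show (1 : Z → ℝ) = fun _ => 1 from rfl, diagonal_one,
      Matrix.mul_one, ← pow_succ']

lemma cyc_replicate_one (S : Matrix Z Z ℝ) (n : ℕ) :
    cyc S (List.replicate n 1) = trace (S ^ n) := by
  have : diagonal (1 : Z → ℝ) = 1 := diagonal_one
  simp [cyc, this]

lemma cyc_append_comm (S : Matrix Z Z ℝ) (L L' : List (Z → ℝ)) :
    cyc S (L ++ L') = cyc S (L' ++ L) := by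
  simp only [cyc, List.map_append, List.prod_append]
  exact trace_mul_comm _ _

lemma cyc_split (S : Matrix Z Z ℝ) (u v : Z → ℝ) (l l' : List (Z → ℝ)) :
    cyc S (u :: l ++ v :: l')
      = ∑ x, ∑ y, (u x * v y) * (pathMat S l x y * pathMat S l' y x) := by
  rw [cyc, List.map_append, List.prod_append, prod_map_cons, prod_map_cons]
  rw [trace]
  refine sum_congr rfl fun x _ => ?_
  rw [Matrix.diag_apply, Matrix.mul_apply]
  refine sum_congr rfl fun y _ => ?_
  rw [diagonal_mul, diagonal_mul]
  ring

/-- The second half of the walk is the transpose of the first. -/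
lemma cyc_reflect {S : Matrix Z Z ℝ} (hS : Sᵀ = S) (l : List (Z → ℝ)) :
    cyc S (1 :: l ++ 1 :: l.reverse) = ∑ x, ∑ y, pathMat S l x y ^ 2 := by
  rw [cyc_split, ← transpose_pathMat hS]
  simp [sq]

/-- Cauchy–Schwarz after cutting the cycle at the vertices weighted by `u` and `v`: each half is
glued to its mirror image, and the cut vertices get weight 1. -/
lemma sq_cyc_le {S : Matrix Z Z ℝ} (hS : Sᵀ = S) {u v : Z → ℝ} (hu : ∀ x, |u x| ≤ 1)
    (hv : ∀ x, |v x| ≤ 1) (l l' : List (Z → ℝ)) :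
    cyc S (u :: l ++ v :: l') ^ 2
      ≤ cyc S (1 :: l ++ 1 :: l.reverse) * cyc S (1 :: l' ++ 1 :: l'.reverse) := by
  rw [cyc_reflect hS, cyc_reflect hS, cyc_split, sum_comm (f := fun x y => pathMat S l' x y ^ 2),
    ← sum_product', ← sum_product', ← sum_product']
  have h : ∀ p : Z × Z, (u p.1 * v p.2) * (pathMat S l p.1 p.2 * pathMat S l' p.2 p.1)
      = (u p.1 * v p.2 * pathMat S l p.1 p.2) * pathMat S l' p.2 p.1 := fun p => by ring
  simp only [h]
  refine (sum_mul_sq_le_sq_mul_sq _ _ _).trans ?_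
  refine mul_le_mul_of_nonneg_right (sum_le_sum fun p _ => ?_) (sum_nonneg fun p _ => sq_nonneg _)
  rw [mul_pow]
  refine mul_le_of_le_one_left (sq_nonneg _) ?_
  rw [sq_le_one_iff_abs_le_one, abs_mul]
  exact mul_le_one₀ (hu _) (abs_nonneg _) (hv _)

lemma finite_lists {α : Type*} (s : Finset α) (n : ℕ) :
    {l : List α | l.length = n ∧ ∀ a ∈ l, a ∈ s}.Finite := by
  refine ((List.finite_length_eq s n).image (List.map Subtype.val)).subset ?_
  rintro l ⟨hl, hs⟩
  refine ⟨l.attach.map fun a => ⟨a.1, hs _ a.2⟩, by simpa using hl, ?_⟩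
  simp [List.map_map, Function.comp_def]

/-- An extremal argument. Among the weight lists drawn from a finite pool, take one maximizing |cyc|
and then the number of weights equal to 1. If a weight `u` other than 1 were left, cutting at it and
at the opposite vertex would produce two further maximizers, one of them with more ones. -/
lemma abs_cyc_le {S : Matrix Z Z ℝ} (hS : Sᵀ = S) {r : ℕ} {L : List (Z → ℝ)}
    (hL : L.length = 2 * (r + 1)) (hb : ∀ m ∈ L, ∀ x, |m x| ≤ 1) :
    |cyc S L| ≤ trace (S ^ (2 * (r + 1))) := by
  classical
  set 𝓕 : Finset (Z → ℝ) := insert 1 L.toFinset with h𝓕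
  set 𝓛 : Set (List (Z → ℝ)) := {l | l.length = 2 * (r + 1) ∧ ∀ a ∈ l, a ∈ 𝓕} with h𝓛
  have hbF : ∀ m ∈ 𝓕, ∀ x, |m x| ≤ 1 := by
    intro m hm x
    rcases mem_insert.mp hm with rfl | h
    · simp
    · exact hb m (by simpa using h) x
  have hfin : 𝓛.Finite := finite_lists _ _
  have hmem : L ∈ 𝓛 := ⟨hL, fun a ha => by simp [h𝓕, ha]⟩
  obtain ⟨L1, hL1, hmax⟩ := Set.exists_max_image 𝓛 (fun l => |cyc S l|) hfin ⟨L, hmem⟩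
  obtain ⟨L2, ⟨hL2, hL2eq⟩, hcount⟩ := Set.exists_max_image
    {l | l ∈ 𝓛 ∧ |cyc S l| = |cyc S L1|} (fun l => l.count 1)
    (hfin.subset fun l hl => hl.1) ⟨L1, hL1, rfl⟩
  have hnonneg : 0 ≤ trace (S ^ (2 * (r + 1))) := by
    have := cyc_reflect hS (List.replicate r 1)
    rw [List.reverse_replicate, ← List.replicate_succ, ← List.replicate_add, cyc_replicate_one,
      show r + 1 + (r + 1) = 2 * (r + 1) by ring] at this
    rw [this]
    positivity
  refine (hmax L hmem).trans ?_
  rcases (abs_nonneg (cyc S L1)).eq_or_lt with h0 | hpos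
  · rwa [← h0]
  by_cases hall : ∀ u ∈ L2, u = 1
  · rw [← hL2eq, List.eq_replicate_of_mem hall, hL2.1, cyc_replicate_one, abs_of_nonneg hnonneg]
  exfalso
  push Not at hall
  obtain ⟨u, hu, hu1⟩ := hall
  obtain ⟨s, t, rfl⟩ := List.append_of_mem hu
  have hlen : (t ++ s).length = 2 * r + 1 := by
    have := hL2.1
    simp at this ⊢
    omega
  obtain ⟨l, v, l', hsplit, hl, hl'⟩ : ∃ l v l', t ++ s = l ++ v :: l' ∧ l.length = r ∧
      l'.length = r := by
    have hr : r < (t ++ s).length := by omega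
    refine ⟨(t ++ s).take r, (t ++ s)[r], (t ++ s).drop (r + 1), ?_, ?_, ?_⟩
    · rw [← List.drop_eq_getElem_cons, List.take_append_drop]
    · rw [List.length_take]; omega
    · rw [List.length_drop]; omega
  have hrot : cyc S (s ++ u :: t) = cyc S (u :: l ++ v :: l') := by
    rw [cyc_append_comm, List.cons_append, hsplit, List.cons_append]
  have hperm : (s ++ u :: t).Perm (u :: l ++ v :: l') := by
    rw [List.cons_append, ← hsplit, ← List.cons_append]
    exact List.perm_append_comm
  have hF : ∀ a ∈ u :: l ++ v :: l', a ∈ 𝓕 := fun a ha => hL2.2 a (hperm.mem_iff.mpr ha)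
  have hone : (1 : Z → ℝ) ∈ 𝓕 := by simp [h𝓕]
  have key := sq_cyc_le hS (hbF u (hF u (by simp))) (hbF v (hF v (by simp))) l l'
  have hmem1 : ∀ k : List (Z → ℝ), k.length = r → (∀ a ∈ k, a ∈ 𝓕) →
      1 :: k ++ 1 :: k.reverse ∈ 𝓛 := by
    intro k hk hkF
    refine ⟨by simp [hk]; ring, ?_⟩
    intro a ha
    simp only [List.cons_append, List.mem_cons, List.mem_append, List.mem_reverse] at ha
    rcases ha with rfl | h | rfl | h
    · exact hone
    · exact hkF a h
    · exact hone
    · exact hkF a h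
  have m1 := hmem1 l hl fun a ha => hF a (by simp [ha])
  have m2 := hmem1 l' hl' fun a ha => hF a (by simp [ha])
  have p1 : 0 ≤ cyc S (1 :: l ++ 1 :: l.reverse) := by rw [cyc_reflect hS]; positivity
  have p2 : 0 ≤ cyc S (1 :: l' ++ 1 :: l'.reverse) := by rw [cyc_reflect hS]; positivity
  have b1 := hmax _ m1
  have b2 := hmax _ m2
  rw [abs_of_nonneg p1] at b1
  rw [abs_of_nonneg p2] at b2
  rw [← hrot, ← sq_abs, hL2eq] at key
  -- `key` bounds the square of the positive maximum by a product of two values not exceeding it, so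
  -- both attain it.
  have e1 : cyc S (1 :: l ++ 1 :: l.reverse) = |cyc S L1| := by
    refine le_antisymm b1 ?_
    nlinarith
  have e2 : cyc S (1 :: l' ++ 1 :: l'.reverse) = |cyc S L1| := by
    refine le_antisymm b2 ?_
    nlinarith
  have c1 := hcount _ ⟨m1, by rw [abs_of_nonneg p1, e1]⟩
  have c2 := hcount _ ⟨m2, by rw [abs_of_nonneg p2, e2]⟩
  -- If `l` and `l'` contain i and j ones, the reflected lists contain 2i + 2 and 2j + 2, the
  -- original at most i + j + 1.
  have hc := hperm.count_eq 1
  rw [hc] at c1 c2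
  simp only [List.count_append, List.count_cons, List.count_reverse, beq_iff_eq, hu1,
    if_true, if_false] at c1 c2
  split_ifs at c1 c2 <;> omega

/-- Weights bounded by `1` on the inner vertices do not increase the Hilbert–Schmidt norm of a
path kernel beyond the density of the even cycle. -/
lemma sum_sq_pathMat_le {S : Matrix Z Z ℝ} (hS : Sᵀ = S) {l : List (Z → ℝ)}
    (hb : ∀ m ∈ l, ∀ x, |m x| ≤ 1) :
    ∑ x, ∑ y, pathMat S l x y ^ 2 ≤ trace (S ^ (2 * (l.length + 1))) := by
  rw [← cyc_reflect hS]
  refine (le_abs_self _).trans (abs_cyc_le hS (by simp; ring) ?_)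
  intro m hm x
  simp only [List.cons_append, List.mem_cons, List.mem_append, List.mem_reverse] at hm
  rcases hm with rfl | h | rfl | h
  · simp
  · exact hb m h x
  · simp
  · exact hb m h x

end Reflection

/-! ### The kernel as a symmetric bipartite matrix. -/

section Kernel

open Matrix

variable {ι : Type*} [Fintype ι] [Nonempty ι] [DecidableEq ι]

/-- The symmetric kernel on two disjoint copies of `ι` given by `U` between the copies. -/
def symK (U : ι → ι → ℝ) : Matrix (Bool × ι) (Bool × ι) ℝ :=
  Matrix.of fun p q => if p.1 = q.1 then 0 else if p.1 then U p.2 q.2 else U q.2 p.2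

lemma symK_apply (U : ι → ι → ℝ) (p q : Bool × ι) :
    symK U p q = if p.1 = q.1 then 0 else if p.1 then U p.2 q.2 else U q.2 p.2 := rfl

lemma symK_comm (U : ι → ι → ℝ) (p q : Bool × ι) : symK U p q = symK U q p := by
  obtain ⟨b, s⟩ := p
  obtain ⟨c, t⟩ := q
  cases b <;> cases c <;> simp [symK_apply]

lemma transpose_symK (U : ι → ι → ℝ) : (symK U)ᵀ = symK U := by
  ext p q
  exact symK_comm U q p

lemma abs_symK_le {U : ι → ι → ℝ} (hU : ∀ s t, |U s t| ≤ 1) (p q : Bool × ι) :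
    |symK U p q| ≤ 1 := by
  rw [symK_apply]
  split_ifs <;> simp [hU]

/-- Twice the density of the cycle of length `2 * r`. -/
noncomputable def evenCycle (U : ι → ι → ℝ) (r : ℕ) : ℝ :=
  trace (symK U ^ (2 * r)) / (Fintype.card ι : ℝ) ^ (2 * r)

/-- `c` bounds the operator norm of `U`. -/
def OpBound (U : ι → ι → ℝ) (c : ℝ) : Prop :=
  ∀ φ ψ : ι → ℝ, |𝔼 s, 𝔼 t, U s t * (φ s * ψ t)| ≤ c * (nrm φ * nrm ψ)

lemma OpBound.symK {U : ι → ι → ℝ} {c : ℝ} (h : OpBound U c) {b b' : Bool} (hb : b ≠ b') :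
    OpBound (fun s t => LocalSidorenko.symK U (b, s) (b', t)) c := by
  intro φ ψ
  cases b <;> cases b' <;> simp only [symK_apply, ne_eq, not_true_eq_false] at hb ⊢
  · rw [expect_comm, mul_comm (nrm φ)]
    refine le_trans (le_of_eq ?_) (h ψ φ)
    simp [mul_comm]
  · simpa using h φ ψ

end Kernel

/-! ### Densities of edge sets, and integrating out a set of vertices. -/

section Densities

variable {V ι : Type*} [Fintype V] [DecidableEq V] [Fintype ι] [Nonempty ι] [DecidableEq ι]

/-- The value of the kernel on the edge `e` under the assignment `z`. -/
def wt (side : V → Bool) (U : ι → ι → ℝ) (z : V → ι) (e : Sym2 V) : ℝ :=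
  Sym2.lift ⟨fun u v => symK U (side u, z u) (side v, z v), fun _ _ => symK_comm _ _ _⟩ e

lemma wt_mk (side : V → Bool) (U : ι → ι → ℝ) (z : V → ι) (u v : V) :
    wt side U z s(u, v) = symK U (side u, z u) (side v, z v) := rfl

/-- The product of the kernel over the edges in `E`. -/
def wprod (side : V → Bool) (U : ι → ι → ℝ) (E : Finset (Sym2 V)) (z : V → ι) : ℝ :=
  ∏ e ∈ E, wt side U z e

/-- The density in `U` of the graph with edge set `E`. -/
noncomputable def dens (side : V → Bool) (U : ι → ι → ℝ) (E : Finset (Sym2 V)) : ℝ :=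
  𝔼 z : V → ι, wprod side U E z

/-- All edges in `E` join the two sides. -/
def Bip (side : V → Bool) (E : Finset (Sym2 V)) : Prop :=
  ∀ u v, s(u, v) ∈ E → side u ≠ side v

lemma Bip.mono {side : V → Bool} {E E' : Finset (Sym2 V)} (h : Bip side E) (hE : E' ⊆ E) :
    Bip side E' := fun u v huv => h u v (hE huv)

/-- The edges of `E` having an endpoint in `T`. -/
def touch (E : Finset (Sym2 V)) (T : Finset V) : Finset (Sym2 V) :=
  E.filter fun e => ∃ v ∈ T, v ∈ e

lemma mem_touch {E : Finset (Sym2 V)} {T : Finset V} {e : Sym2 V} :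
    e ∈ touch E T ↔ e ∈ E ∧ ∃ v ∈ T, v ∈ e := mem_filter

variable {side : V → Bool} {U : ι → ι → ℝ}

lemma dependsOn_wt (e : Sym2 V) : DependsOn (fun z => wt side U z e) {v | v ∈ e} := by
  induction e using Sym2.inductionOn with
  | hf u v =>
    intro x y h
    simp only [wt_mk]
    rw [h u (by simp), h v (by simp)]

lemma dependsOn_wprod {E : Finset (Sym2 V)} {s : Set V} (h : ∀ e ∈ E, ∀ v ∈ e, v ∈ s) :
    DependsOn (wprod side U E) s := by
  intro x y hxy
  exact prod_congr rfl fun e he => dependsOn_wt e fun i hi => hxy i (h e he i hi)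

lemma dependsOn_mul {P Q : (V → ι) → ℝ} {s : Set V} (hP : DependsOn P s) (hQ : DependsOn Q s) :
    DependsOn (fun z => P z * Q z) s := fun x y h => by
  show P x * Q x = P y * Q y
  rw [hP h, hQ h]

lemma wprod_union {E E' : Finset (Sym2 V)} (h : Disjoint E E') (z : V → ι) :
    wprod side U (E ∪ E') z = wprod side U E z * wprod side U E' z := prod_union h

lemma wprod_sdiff_mul {E E' : Finset (Sym2 V)} (h : E' ⊆ E) (z : V → ι) :
    wprod side U (E \ E') z * wprod side U E' z = wprod side U E z := prod_sdiff h

lemma abs_wt_le (hU : ∀ s t, |U s t| ≤ 1) (z : V → ι) (e : Sym2 V) : |wt side U z e| ≤ 1 := by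
  induction e using Sym2.inductionOn with
  | hf u v => exact abs_symK_le hU _ _

lemma abs_wprod_le (hU : ∀ s t, |U s t| ≤ 1) (E : Finset (Sym2 V)) (z : V → ι) :
    |wprod side U E z| ≤ 1 := by
  rw [wprod, abs_prod]
  exact prod_le_one (fun _ _ => abs_nonneg _) fun e _ => abs_wt_le hU z e

lemma nrm_wprod_mul_le (hU : ∀ s t, |U s t| ≤ 1) (E : Finset (Sym2 V)) (P : (V → ι) → ℝ) :
    nrm (fun z => wprod side U E z * P z) ≤ nrm P := by
  refine nrm_le_of_abs_le fun z => ?_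
  rw [abs_mul]
  exact mul_le_of_le_one_left (abs_nonneg _) (abs_wprod_le hU E z)

/-- The basic gain: an edge `ab` such that the remaining factors split into one independent of
the value at `a` and one independent of the value at `b`. -/
lemma abs_expect_wprod_mul_le {c : ℝ} (hc : 0 ≤ c) (hop : OpBound U c)
    (hU : ∀ s t, |U s t| ≤ 1) {D : Finset (Sym2 V)} {a b : V} (hab : side a ≠ side b)
    (hD : s(a, b) ∈ D) {P Q : (V → ι) → ℝ}
    (hP : DependsOn P {a}ᶜ) (hQ : DependsOn Q {b}ᶜ) :
    |𝔼 z : V → ι, wprod side U D z * (P z * Q z)| ≤ c * (nrm P * nrm Q) := by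
  have hne : a ≠ b := fun h => hab (by rw [h])
  -- Apart from ab itself, the edges at a avoid b and join `Q`; the edges missing a join `P`.
  set D1 := (D.erase s(a, b)).filter fun e => a ∈ e with hD1
  set D2 := (D.erase s(a, b)).filter fun e => a ∉ e with hD2
  have hsplit : ∀ z : V → ι, wprod side U D z
      = symK U (side a, z a) (side b, z b) * (wprod side U D2 z * wprod side U D1 z) := by
    intro z
    rw [wprod, ← mul_prod_erase _ _ hD, wt_mk, wprod, wprod, hD1, hD2, mul_comm (∏ _ ∈ _, _),
      prod_filter_mul_prod_filter_not]
  have h2 : DependsOn (wprod side U D2) {a}ᶜ := dependsOn_wprod fun e he v hv => by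
    rintro rfl
    exact (mem_filter.mp he).2 hv
  have h1 : DependsOn (wprod side U D1) {b}ᶜ := dependsOn_wprod fun e he v hv => by
    rintro rfl
    obtain ⟨h, ha⟩ := mem_filter.mp he
    exact (mem_erase.mp h).1 ((Sym2.mem_and_mem_iff hne).mp ⟨ha, hv⟩)
  have := abs_expect_kernel_mul_le hc (hop.symK hab) hne (dependsOn_mul h2 hP)
    (dependsOn_mul h1 hQ)
  refine le_trans (le_of_eq ?_) (this.trans ?_)
  · congr 1
    refine expect_congr rfl fun z _ => ?_
    rw [hsplit]
    ring
  · exact mul_le_mul_of_nonneg_left (mul_le_mul (nrm_wprod_mul_le hU _ _)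
      (nrm_wprod_mul_le hU _ _) (nrm_nonneg _) (nrm_nonneg _)) hc

/-- The average, over the coordinates in `T`, of the product over the edges that meet `T`. -/
noncomputable def innerAvg (side : V → Bool) (U : ι → ι → ℝ) (E : Finset (Sym2 V))
    (T : Finset V) : (V → ι) → ℝ :=
  avgOn T (wprod side U (touch E T))

/-- The only variables left are those at neighbours of `T` outside `T`. -/
lemma dependsOn_innerAvg (E : Finset (Sym2 V)) (T : Finset V) {v : V}
    (hv : v ∈ T ∨ ∀ u ∈ T, s(u, v) ∉ E) : DependsOn (innerAvg side U E T) {v}ᶜ := by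
  have h : DependsOn (wprod side U (touch E T)) {w | ∃ e ∈ touch E T, w ∈ e} :=
    dependsOn_wprod fun e he w hw => ⟨e, he, hw⟩
  refine (dependsOn_avgOn h T).mono ?_
  rintro w ⟨⟨e, he, hw⟩, hwT⟩ rfl
  have hwT' : w ∉ T := by simpa using hwT
  obtain ⟨heE, u, hu, hue⟩ := mem_touch.mp he
  rcases hv with hv | hv
  · exact hwT' hv
  · have hne : u ≠ w := fun h => hwT' (h ▸ hu)
    rw [(Sym2.mem_and_mem_iff hne).mp ⟨hue, hw⟩] at heE
    exact hv u hu heE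

lemma dependsOn_compl_of_forall {P : (V → ι) → ℝ} {T : Finset V}
    (h : ∀ v ∈ T, DependsOn P {v}ᶜ) : DependsOn P ((T : Set V)ᶜ) := by
  induction T using Finset.induction_on with
  | empty => simpa using dependsOn_univ P
  | insert a T ha ih =>
    intro x y hxy
    have h1 : P x = P (update x a (y a)) := h a (by simp) fun i hi => by
      have : i ≠ a := by simpa using hi
      simp [this]
    rw [h1]
    refine ih (fun v hv => h v (by simp [hv])) fun i hi => ?_
    have hi' : i ∉ T := by simpa using hi
    by_cases hia : i = a
    · subst hia; simp
    · simp only [update_of_ne hia]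
      exact hxy i (by simp [hia, hi'])

/-- Integrating out the coordinates in `T` replaces the edges that meet `T` by `innerAvg`. -/
lemma expect_mul_wprod_eq {D E : Finset (Sym2 V)} {T : Finset V} (hT : touch E T ⊆ D)
    (hrest : ∀ e ∈ D, e ∉ touch E T → ∀ v ∈ T, v ∉ e)
    {P : (V → ι) → ℝ} (hP : ∀ v ∈ T, DependsOn P {v}ᶜ) :
    𝔼 z : V → ι, wprod side U D z * P z
      = 𝔼 z : V → ι, wprod side U (D \ touch E T) z * (P z * innerAvg side U E T z) := by
  have h1 : DependsOn (wprod side U (D \ touch E T)) ((T : Set V)ᶜ) :=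
    dependsOn_wprod fun e he v hv hvT =>
      hrest e (mem_sdiff.mp he).1 (mem_sdiff.mp he).2 v (by simpa using hvT) hv
  have h2 := dependsOn_mul h1 (dependsOn_compl_of_forall hP)
  have := expect_mul_avgOn h2 (wprod side U (touch E T))
  simp only [innerAvg]
  simp_rw [← mul_assoc]
  rw [this]
  refine expect_congr rfl fun z _ => ?_
  rw [← wprod_sdiff_mul hT]
  ring

/-- `p 0, …, p r` is a path in the graph `E` with no chords, except possibly between its ends. -/
structure IsChordless (E : Finset (Sym2 V)) (p : ℕ → V) (r : ℕ) : Prop where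
  inj : Set.InjOn p (Set.Iic r)
  adj : ∀ i < r, s(p i, p (i + 1)) ∈ E
  chord : ∀ i j, i < j → j ≤ r → s(p i, p j) ∈ E → j = i + 1 ∨ (i = 0 ∧ j = r)

/-- The first `k` vertices of a path after the starting vertex. -/
def inner (p : ℕ → V) (k : ℕ) : Finset V := (Icc 1 k).image p

lemma mem_inner {p : ℕ → V} {k : ℕ} {v : V} : v ∈ inner p k ↔ ∃ i, 1 ≤ i ∧ i ≤ k ∧ p i = v := by
  simp [inner, and_assoc]

lemma inner_succ (p : ℕ → V) (k : ℕ) : inner p (k + 1) = insert (p (k + 1)) (inner p k) := by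
  rw [inner, inner, ← Finset.insert_Icc_right_eq_Icc_add_one (by omega), image_insert]

end Densities

/-! ### Integrating out the inner vertices of a chordless path. -/

section Paths

open Matrix

variable {V ι : Type*} [Fintype V] [DecidableEq V] [Fintype ι] [Nonempty ι] [DecidableEq ι]
  {side : V → Bool} {U : ι → ι → ℝ}

/-- The weights on the path kernel: the edges at the inner vertices leaving the path become
multipliers. -/
lemma exists_pathMat_eq (hU : ∀ s t, |U s t| ≤ 1) {E : Finset (Sym2 V)} (hE : Bip side E)
    {p : ℕ → V} {r : ℕ} (hp : IsChordless E p r) (z : V → ι) (k : ℕ) (hk : k < r) :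
    ∃ l : List (Bool × ι → ℝ), l.length = k ∧ (∀ m ∈ l, ∀ x, |m x| ≤ 1) ∧
      ((∀ e ∈ E, e = s(p 0, p r) ∨ ∃ i < r, e = s(p i, p (i + 1))) → ∀ m ∈ l, m = 1) ∧
      ∀ z' : V → ι, (∀ v, (∀ i ≤ r, p i ≠ v) → z' v = z v) →
        (Fintype.card ι : ℝ) ^ k *
          avgOn (inner p k) (wprod side U (insert s(p k, p (k + 1)) (touch E (inner p k)))) z'
        = pathMat (symK U) l (side (p 0), z' (p 0)) (side (p (k + 1)), z' (p (k + 1))) := by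
  induction k with
  | zero =>
    refine ⟨[], rfl, by simp, by simp, fun z' _ => ?_⟩
    have h1 : inner p 0 = ∅ := by simp [inner]
    have h2 : touch E ∅ = ∅ := by simp [touch]
    simp [h1, h2, avgOn, wprod, wt_mk, pathMat]
  | succ k ih =>
    obtain ⟨l, hl, hlb, hl1, hform⟩ := ih (by omega)
    set D := insert s(p k, p (k + 1)) (touch E (inner p k)) with hD
    -- `N` holds the edges at the next vertex that are not yet absorbed; among them is the next path
    -- edge `f`.
    set N := E.filter (fun e => p (k + 1) ∈ e ∧ e ∉ D) with hN
    set f := s(p (k + 1), p (k + 2)) with hf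
    have hfE : f ∈ E := hp.adj (k + 1) hk
    have hinj : ∀ i j, i ≤ r → j ≤ r → p i = p j → i = j := fun i j hi hj h => hp.inj hi hj h
    have hfD : f ∉ D := by
      intro h
      rcases mem_insert.mp h with h | h
      · rcases Sym2.eq_iff.mp h with ⟨h1, _⟩ | ⟨_, h2⟩
        · have := hinj _ _ (by omega) (by omega) h1; omega
        · have := hinj _ _ (by omega) (by omega) h2; omega
      · obtain ⟨_, v, hv, hvf⟩ := mem_touch.mp h
        obtain ⟨i, hi1, hik, rfl⟩ := mem_inner.mp hv
        rcases Sym2.mem_iff.mp hvf with h | h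
        · have := hinj _ _ (by omega) (by omega) h; omega
        · have := hinj _ _ (by omega) (by omega) h; omega
    have hfN : f ∈ N := mem_filter.mpr ⟨hfE, by simp [hf], hfD⟩
    have hDN : insert f (touch E (inner p (k + 1))) = D ∪ N := by
      ext e
      simp only [mem_insert, mem_union, mem_touch, inner_succ, hN, mem_filter, hD]
      constructor
      · rintro (rfl | ⟨he, v, rfl | hv, hve⟩)
        · exact Or.inr (mem_filter.mp hfN).2 |>.imp id fun h => ⟨hfE, h.1, by simpa [hD, mem_touch] using h.2⟩
        · by_cases h : e ∈ D
          · left; simpa [hD, mem_touch] using h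
          · right; exact ⟨he, hve, by simpa [hD, mem_touch] using h⟩
        · exact Or.inl (Or.inr ⟨he, v, hv, hve⟩)
      · rintro ((rfl | ⟨he, v, hv, hve⟩) | ⟨he, hve, _⟩)
        · exact Or.inr ⟨hp.adj k (by omega), p (k + 1), Or.inl rfl, by simp⟩
        · exact Or.inr ⟨he, v, Or.inr hv, hve⟩
        · exact Or.inr ⟨he, _, Or.inl rfl, hve⟩
    have hdisj : Disjoint D N := by
      rw [disjoint_left]
      exact fun e he heN => (mem_filter.mp heN).2.2 he
    -- Chordlessness: as 0 < k + 1 < r, the exceptional chord between the ends cannot occur at this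
    -- vertex, so every other new edge leaves the path.
    have hN0 : ∀ e ∈ N.erase f, ∃ w, e = s(p (k + 1), w) ∧ ∀ i ≤ r, p i ≠ w := by
      intro e he
      obtain ⟨hef, heN⟩ := mem_erase.mp he
      obtain ⟨heE, hpe, heD⟩ := mem_filter.mp heN
      obtain ⟨w, rfl⟩ := Sym2.mem_iff_exists.mp hpe
      refine ⟨w, rfl, ?_⟩
      rintro i hi rfl
      rcases lt_trichotomy i (k + 1) with h | h | h
      · rw [Sym2.eq_swap] at heE heD
        rcases hp.chord i (k + 1) h (by omega) heE with h' | h'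
        · obtain rfl : i = k := by omega
          exact heD (mem_insert_self _ _)
        · omega
      · subst h
        exact hE _ _ heE rfl
      · rcases hp.chord (k + 1) i h hi heE with h' | h'
        · subst h'; exact hef rfl
        · omega
    -- The far ends of these edges are frozen at `z`, so they amount to a multiplier in one
    -- variable, bounded by 1.
    set m : Bool × ι → ℝ := fun ζ => wprod side U (N.erase f) (update z (p (k + 1)) ζ.2) with hm
    refine ⟨l ++ [m], by simp [hl], ?_, ?_, ?_⟩
    · intro m' hm' x
      rcases List.mem_append.mp hm' with h | h
      · exact hlb m' h x
      · rw [List.mem_singleton.mp h]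
        exact abs_wprod_le hU _ _
    · intro hall m' hm'
      rcases List.mem_append.mp hm' with h | h
      · exact hl1 hall m' h
      · rw [List.mem_singleton.mp h]
        have hempty : N.erase f = ∅ := by
          rw [eq_empty_iff_forall_notMem]
          intro e he
          obtain ⟨w, rfl, hw⟩ := hN0 e he
          have heE := (mem_filter.mp (mem_erase.mp he).2).1
          rcases hall _ heE with h | ⟨i, hi, h⟩
          · rcases Sym2.eq_iff.mp h with ⟨_, h2⟩ | ⟨_, h2⟩
            · exact hw r le_rfl h2.symm
            · exact hw 0 (by omega) h2.symm
          · rcases Sym2.eq_iff.mp h with ⟨_, h2⟩ | ⟨_, h2⟩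
            · exact hw (i + 1) (by omega) h2.symm
            · exact hw i (by omega) h2.symm
        ext ζ
        simp [hm, hempty, wprod]
    · intro z' hz'
      have hNdep : DependsOn (wprod side U N) ((inner p k : Set V)ᶜ) :=
        dependsOn_wprod fun e he v hv hvk => by
          refine (mem_filter.mp he).2.2 (mem_insert_of_mem (mem_touch.mpr
            ⟨(mem_filter.mp he).1, v, by simpa using hvk, hv⟩))
      have hinner : avgOn (inner p k) (wprod side U (D ∪ N))
          = fun z => wprod side U N z * avgOn (inner p k) (wprod side U D) z := by
        ext y
        rw [← avgOn_mul_left hNdep]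
        congr 1
        ext y'
        rw [wprod_union hdisj, mul_comm]
      have hne : side (p (k + 1)) ≠ side (p (k + 2)) := hE _ _ hfE
      have hne' : p (k + 2) ≠ p (k + 1) := fun h => hne (by rw [h])
      have hp0 : p 0 ≠ p (k + 1) := fun h => by
        have := hinj _ _ (by omega) (by omega) h; omega
      rw [hDN, inner_succ, insert_eq, ← avgOn_avgOn, hinner, avgOn_singleton, pathMat_append,
        Matrix.mul_apply, Fintype.sum_prod_type, Fintype.sum_eq_single (side (p (k + 1)))]
      · rw [pow_succ, mul_assoc, Fintype.card_mul_expect, mul_sum]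
        refine sum_congr rfl fun s _ => ?_
        -- The induction hypothesis is needed at assignments with a changed value on the path, which
        -- is why the formula is stated for all `z'` agreeing with `z` off the path.
        have hagree : ∀ v, (∀ i ≤ r, p i ≠ v) → update z' (p (k + 1)) s v = z v := by
          intro v hv
          rw [update_of_ne (hv (k + 1) (by omega)).symm]
          exact hz' v hv
        have h1 := hform _ hagree
        rw [update_of_ne hp0, update_self] at h1
        have h2 : wprod side U N (update z' (p (k + 1)) s)
            = m (side (p (k + 1)), s)
              * symK U (side (p (k + 1)), s) (side (p (k + 2)), z' (p (k + 2))) := by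
          rw [wprod, ← prod_erase_mul _ _ hfN, hf, wt_mk, update_self, update_of_ne hne', ← hf]
          congr 1
          refine dependsOn_wprod (s := {v | v = p (k + 1) ∨ ∀ i ≤ r, p i ≠ v}) ?_ ?_
          · intro e he v hv
            obtain ⟨w, rfl, hw⟩ := hN0 e he
            rcases Sym2.mem_iff.mp hv with rfl | rfl
            · exact Or.inl rfl
            · exact Or.inr hw
          · rintro v (rfl | hv)
            · simp
            · rw [hagree v hv, update_of_ne (hv (k + 1) (by omega)).symm]
        rw [h2, mul_left_comm, h1, mul_diagonal, pathMat]
        ring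
      -- The wrong class contributes nothing, because `symK` vanishes inside a class.
      · intro b hb
        refine sum_eq_zero fun s _ => ?_
        have : b = side (p (k + 2)) := by
          revert hb hne
          cases b <;> cases side (p (k + 1)) <;> cases side (p (k + 2)) <;> simp
        rw [pathMat, symK_apply, if_pos this, mul_zero]

end Paths

/-! ### L² bounds for the integrated pieces, and density bounds from one free edge. -/

section Paths

open Matrix

variable {V ι : Type*} [Fintype V] [DecidableEq V] [Fintype ι] [Nonempty ι] [DecidableEq ι]
  {side : V → Bool} {U : ι → ι → ℝ}

/-- With all coordinates except the two ends frozen, the average is a path kernel with weights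
bounded by 1. The reflection inequality bounds its Hilbert–Schmidt norm uniformly in the frozen
coordinates. -/
lemma nrm_innerAvg_sq_le (hU : ∀ s t, |U s t| ≤ 1) {E : Finset (Sym2 V)} (hE : Bip side E)
    {p : ℕ → V} {r : ℕ} (hp : IsChordless E p r) (hr : 2 ≤ r) :
    nrm (innerAvg side U E (inner p (r - 1))) ^ 2 ≤ evenCycle U r := by
  have hins : insert s(p (r - 1), p (r - 1 + 1)) (touch E (inner p (r - 1)))
      = touch E (inner p (r - 1)) := by
    refine insert_eq_of_mem (mem_touch.mpr ⟨hp.adj _ (by omega), p (r - 1), ?_, by simp⟩)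
    exact mem_inner.mpr ⟨r - 1, by omega, le_rfl, rfl⟩
  have hp0r : p 0 ≠ p r := fun h => by
    have := hp.inj (by simp) (by simp) h; omega
  set N : ℝ := (Fintype.card ι : ℝ) with hN
  have hNpos : 0 < N := by simp [hN, Fintype.card_pos]
  rw [sq_nrm, ← expect_update (p 0), ← Fintype.expect_const (ι := V → ι) (evenCycle U r)]
  have hz : ∀ z : V → ι, 𝔼 s, 𝔼 t,
      innerAvg side U E (inner p (r - 1)) (update (update z (p 0) s) (p r) t) ^ 2
        ≤ evenCycle U r := by
    intro z
    obtain ⟨l, hl, hlb, -, hform⟩ := exists_pathMat_eq (U := U) hU hE hp z (r - 1) (by omega)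
    rw [hins, Nat.sub_add_cancel (by omega : 1 ≤ r)] at hform
    have hval : ∀ s t, innerAvg side U E (inner p (r - 1)) (update (update z (p 0) s) (p r) t) ^ 2
        = pathMat (symK U) l (side (p 0), s) (side (p r), t) ^ 2 / N ^ (2 * (r - 1)) := by
      intro s t
      have := hform (update (update z (p 0) s) (p r) t) fun v hv => by
        rw [update_of_ne (hv r le_rfl).symm, update_of_ne (hv 0 (by omega)).symm]
      rw [update_of_ne hp0r, update_self, update_self] at this
      rw [← this, innerAvg, ← hN, mul_pow, ← pow_mul, mul_comm (r - 1),
        mul_div_cancel_left₀ _ (by positivity)]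
    simp_rw [hval, Fintype.expect_eq_sum_div_card, ← hN, ← sum_div]
    -- The classes of the two ends select one of four blocks of squares; the other three are
    -- dropped.
    have hsum : ∑ s, ∑ t, pathMat (symK U) l (side (p 0), s) (side (p r), t) ^ 2
        ≤ trace (symK U ^ (2 * r)) := by
      have h := sum_sq_pathMat_le (transpose_symK U) hlb
      rw [hl, Nat.sub_add_cancel (by omega : 1 ≤ r), Fintype.sum_prod_type] at h
      refine le_trans ?_ h
      refine le_trans ?_ (single_le_sum (f := fun b => ∑ s, ∑ y,
        pathMat (symK U) l (b, s) y ^ 2) (fun b _ => by positivity) (mem_univ (side (p 0))))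
      refine sum_le_sum fun s _ => ?_
      rw [Fintype.sum_prod_type]
      exact single_le_sum (f := fun b => ∑ t, pathMat (symK U) l (side (p 0), s) (b, t) ^ 2)
        (fun b _ => by positivity) (mem_univ (side (p r)))
    rw [evenCycle, ← hN, div_div, div_div]
    have : N ^ (2 * r) = N ^ (2 * (r - 1)) * (N * N) := by
      rw [← sq, ← pow_add]; congr 1; omega
    rw [this]
    gcongr
  calc _ = 𝔼 z : V → ι, 𝔼 s, 𝔼 t,
        innerAvg side U E (inner p (r - 1)) (update (update z (p 0) s) (p r) t) ^ 2 := by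
        rw [expect_update (p 0) (fun z => innerAvg side U E (inner p (r - 1)) z ^ 2),
          expect_update (p 0) (fun z => 𝔼 t, innerAvg side U E (inner p (r - 1))
            (update z (p r) t) ^ 2),
          expect_update (p r) (fun z => innerAvg side U E (inner p (r - 1)) z ^ 2)]
    _ ≤ _ := expect_le_expect fun z _ => hz z

/-- Splitting off the first step on one side and the last step on the other gives the same double
sum. Hence the factor 2 between the trace and the cycle density. -/
lemma sum_diag_pow_symK (U : ι → ι → ℝ) (n : ℕ) :
    ∑ s, (symK U ^ (n + 1)) (true, s) (true, s) = ∑ s, (symK U ^ (n + 1)) (false, s) (false, s) := by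
  have h1 : ∀ s, (symK U ^ (n + 1)) (true, s) (true, s)
      = ∑ t, symK U (true, s) (false, t) * (symK U ^ n) (false, t) (true, s) := by
    intro s
    rw [pow_succ', Matrix.mul_apply, Fintype.sum_prod_type, Fintype.sum_bool]
    simp [symK_apply]
  have h2 : ∀ t, (symK U ^ (n + 1)) (false, t) (false, t)
      = ∑ s, symK U (true, s) (false, t) * (symK U ^ n) (false, t) (true, s) := by
    intro t
    rw [pow_succ, Matrix.mul_apply, Fintype.sum_prod_type, Fintype.sum_bool]
    simp [symK_apply, mul_comm]
  simp_rw [h1, h2]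
  exact sum_comm

lemma trace_pow_symK (U : ι → ι → ℝ) (n : ℕ) (b : Bool) :
    trace (symK U ^ (n + 1)) = 2 * ∑ s, (symK U ^ (n + 1)) (b, s) (b, s) := by
  rw [trace, Fintype.sum_prod_type, Fintype.sum_bool]
  simp only [Matrix.diag_apply]
  cases b
  · rw [sum_diag_pow_symK]; ring
  · rw [← sum_diag_pow_symK]; ring

/-- The density of an even cycle. -/
lemma dens_cycle (hU : ∀ s t, |U s t| ≤ 1) {E : Finset (Sym2 V)} (hE : Bip side E)
    {p : ℕ → V} {n r : ℕ} (hp : IsChordless E p n) (hn : 2 ≤ n) (hnr : n + 1 = 2 * r)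
    (hclose : s(p 0, p n) ∈ E)
    (hall : ∀ e ∈ E, e = s(p 0, p n) ∨ ∃ i < n, e = s(p i, p (i + 1))) :
    dens side U E = evenCycle U r / 2 := by
  have hinj : ∀ i j, i ≤ n → j ≤ n → p i = p j → i = j := fun i j hi hj h => hp.inj hi hj h
  have hp0n : p 0 ≠ p n := fun h => by
    have := hinj _ _ (by omega) le_rfl h; omega
  set N : ℝ := (Fintype.card ι : ℝ) with hN
  have hNpos : 0 < N := by simp [hN, Fintype.card_pos]
  have hins : insert s(p (n - 1), p (n - 1 + 1)) (touch E (inner p (n - 1)))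
      = touch E (inner p (n - 1)) := by
    refine insert_eq_of_mem (mem_touch.mpr ⟨hp.adj _ (by omega), p (n - 1), ?_, by simp⟩)
    exact mem_inner.mpr ⟨n - 1, by omega, le_rfl, rfl⟩
  have hnot : s(p 0, p n) ∉ touch E (inner p (n - 1)) := by
    intro h
    obtain ⟨_, v, hv, hvf⟩ := mem_touch.mp h
    obtain ⟨i, hi1, hik, rfl⟩ := mem_inner.mp hv
    rcases Sym2.mem_iff.mp hvf with h | h
    · have := hinj _ _ (by omega) (by omega) h; omega
    · have := hinj _ _ (by omega) (by omega) h; omega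
  -- Once all vertices but `p 0` and `p n` are integrated out, only the closing edge remains,
  -- multiplied by an entry of the n-th power.
  have hsd : E \ touch E (inner p (n - 1)) = {s(p 0, p n)} := by
    ext e
    simp only [mem_sdiff, mem_singleton]
    constructor
    · rintro ⟨he, hne⟩
      rcases hall e he with h | ⟨i, hi, rfl⟩
      · exact h
      · exfalso
        refine hne (mem_touch.mpr ⟨he, ?_⟩)
        by_cases h0 : i = 0
        · exact ⟨p (i + 1), mem_inner.mpr ⟨i + 1, by omega, by omega, rfl⟩, by simp⟩
        · exact ⟨p i, mem_inner.mpr ⟨i, by omega, by omega, rfl⟩, by simp⟩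
    · rintro rfl
      exact ⟨hclose, hnot⟩
  have hinner : ∀ z : V → ι, innerAvg side U E (inner p (n - 1)) z
      = (symK U ^ n) (side (p 0), z (p 0)) (side (p n), z (p n)) / N ^ (n - 1) := by
    intro z
    obtain ⟨l, hl, -, hl1, hform⟩ := exists_pathMat_eq (U := U) hU hE hp z (n - 1) (by omega)
    have := hform z fun _ _ => rfl
    rw [hins, Nat.sub_add_cancel (by omega : 1 ≤ n), List.eq_replicate_of_mem (hl1 hall), hl,
      pathMat_replicate_one, Nat.sub_add_cancel (by omega : 1 ≤ n)] at this
    rw [← this, innerAvg, ← hN, mul_div_cancel_left₀ _ (by positivity)]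
  have hd : dens side U E = 𝔼 z : V → ι, symK U (side (p 0), z (p 0)) (side (p n), z (p n)) *
      ((symK U ^ n) (side (p 0), z (p 0)) (side (p n), z (p n)) / N ^ (n - 1)) := by
    have := expect_mul_wprod_eq (side := side) (U := U) (D := E) (E := E) (T := inner p (n - 1))
      (filter_subset _ _) (fun e he het v hv hve => het (mem_touch.mpr ⟨he, v, hv, hve⟩))
      (P := fun _ => 1) (fun v _ => fun _ _ _ => rfl)
    simp only [mul_one, one_mul] at this
    rw [dens, this, hsd]
    refine expect_congr rfl fun z _ => ?_
    rw [hinner, wprod, prod_singleton, wt_mk]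
  have hd2 : dens side U E = 𝔼 s, 𝔼 t, symK U (side (p 0), s) (side (p n), t) *
      ((symK U ^ n) (side (p 0), s) (side (p n), t) / N ^ (n - 1)) := by
    rw [hd, ← expect_update (p n), ← expect_update (p 0)]
    simp only [update_self, update_of_ne hp0n]
    simp
  have hside : side (p 0) ≠ side (p n) := hE _ _ hclose
  have hpow : ∀ s, (symK U ^ (n + 1)) (side (p 0), s) (side (p 0), s)
      = ∑ t, symK U (side (p 0), s) (side (p n), t) *
        (symK U ^ n) (side (p 0), s) (side (p n), t) := by
    intro s
    rw [pow_succ, Matrix.mul_apply, Fintype.sum_prod_type,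
      Fintype.sum_eq_single (side (p n))]
    · exact sum_congr rfl fun t _ => by rw [mul_comm, symK_comm]
    · intro b hb
      refine sum_eq_zero fun t _ => ?_
      have : b = side (p 0) := by
        revert hb hside
        cases b <;> cases side (p 0) <;> cases side (p n) <;> simp
      rw [symK_apply, if_pos this, mul_zero]
  rw [hd2, evenCycle, ← hnr, trace_pow_symK U n (side (p 0))]
  simp_rw [hpow, Fintype.expect_eq_sum_div_card, ← hN, ← mul_div_assoc, ← sum_div]
  have : N ^ (n + 1) = N ^ (n - 1) * (N * N) := by
    rw [← sq, ← pow_add]; congr 1; omega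
  rw [this]
  field_simp

/-- The normalized degree of a vertex of the kernel. -/
noncomputable def kdeg (U : ι → ι → ℝ) (b : Bool) (s : ι) : ℝ := 𝔼 t, symK U (b, s) (!b, t)

lemma nrm_eval (f : ι → ℝ) (v : V) : nrm (fun z : V → ι => f (z v)) = nrm f := by
  rw [nrm, nrm, expect_eval (fun s => f s ^ 2)]

lemma dependsOn_eval (f : ι → ℝ) {u v : V} (h : u ≠ v) :
    DependsOn (fun z : V → ι => f (z u)) {v}ᶜ := fun x y hxy => by
  show f (x u) = f (y u)
  rw [hxy u (by simpa using h)]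

lemma touch_leaf {E : Finset (Sym2 V)} {l x : V} (hlx : s(l, x) ∈ E)
    (hleaf : ∀ e ∈ E, l ∈ e → e = s(l, x)) : touch E {l} = {s(l, x)} := by
  ext e
  simp only [mem_touch, mem_singleton, exists_eq_left]
  exact ⟨fun h => hleaf e h.1 h.2, by rintro rfl; exact ⟨hlx, by simp⟩⟩

lemma innerAvg_leaf {E : Finset (Sym2 V)} (hE : Bip side E) {l x : V} (hlx : s(l, x) ∈ E)
    (hleaf : ∀ e ∈ E, l ∈ e → e = s(l, x)) :
    innerAvg side U E {l} = fun z => kdeg U (side x) (z x) := by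
  ext z
  have hs := hE _ _ hlx
  have hne : x ≠ l := fun h => hs (by rw [h])
  have hside : side l = !side x := by
    revert hs; cases side l <;> cases side x <;> simp
  rw [innerAvg, touch_leaf hlx hleaf, avgOn_singleton, kdeg]
  refine expect_congr rfl fun s _ => ?_
  rw [wprod, prod_singleton, wt_mk, update_self, update_of_ne hne, symK_comm, hside]

/-- Integrating out a leaf. -/
lemma expect_leaf {D : Finset (Sym2 V)} (hD : Bip side D) {l x : V} (hlx : s(l, x) ∈ D)
    (hleaf : ∀ e ∈ D, l ∈ e → e = s(l, x)) {P : (V → ι) → ℝ} (hP : DependsOn P {l}ᶜ) :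
    𝔼 z : V → ι, wprod side U D z * P z
      = 𝔼 z : V → ι, wprod side U (D.erase s(l, x)) z * (P z * kdeg U (side x) (z x)) := by
  rw [expect_mul_wprod_eq (D := D) (E := D) (T := {l}) (filter_subset _ _)
    (fun e he het v hv hve => het (mem_touch.mpr ⟨he, v, hv, hve⟩)) (by simpa using hP),
    touch_leaf hlx hleaf, innerAvg_leaf hD hlx hleaf, sdiff_singleton_eq_erase]

lemma dens_eq_expect_leaf {E : Finset (Sym2 V)} (hE : Bip side E) {l x : V} (hlx : s(l, x) ∈ E)
    (hleaf : ∀ e ∈ E, l ∈ e → e = s(l, x)) :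
    dens side U E
      = 𝔼 z : V → ι, wprod side U (E.erase s(l, x)) z * kdeg U (side x) (z x) := by
  have := expect_leaf (U := U) hE hlx hleaf (P := fun _ => 1) (fun _ _ _ => rfl)
  simpa [dens] using this

lemma expect_kdeg (h0 : 𝔼 s, 𝔼 t, U s t = 0) (b : Bool) : 𝔼 s, kdeg U b s = 0 := by
  cases b
  · rw [← h0, expect_comm]
    simp [kdeg, symK_apply]
  · rw [← h0]
    simp [kdeg, symK_apply]

/-- The isolated edge is independent of all the others, and its average is the mean of `U`. -/
lemma dens_eq_zero_of_isolated_edge (h0 : 𝔼 s, 𝔼 t, U s t = 0) {E : Finset (Sym2 V)}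
    (hE : Bip side E) {u v : V} (huv : s(u, v) ∈ E) (hu : ∀ e ∈ E, u ∈ e → e = s(u, v))
    (hv : ∀ e ∈ E, v ∈ e → e = s(u, v)) : dens side U E = 0 := by
  have hdep : DependsOn (wprod side U (E.erase s(u, v))) ((({v} : Finset V) : Set V)ᶜ) :=
    dependsOn_wprod fun e he w hw hwv => by
      obtain rfl : w = v := by simpa using hwv
      exact (mem_erase.mp he).1 (hv e (mem_erase.mp he).2 hw)
  rw [dens_eq_expect_leaf hE huv hu, ← expect_mul_avgOn hdep]
  refine expect_eq_zero fun z _ => ?_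
  rw [avgOn_singleton]
  simp [expect_kdeg h0]

/-- Two leaves and an edge. -/
lemma abs_dens_le_of_two_leaves {c : ℝ} (hc : 0 ≤ c) (hop : OpBound U c)
    (hU : ∀ s t, |U s t| ≤ 1) {E : Finset (Sym2 V)} (hE : Bip side E) {l x l' x' a b : V}
    (hlx : s(l, x) ∈ E) (hleaf : ∀ e ∈ E, l ∈ e → e = s(l, x))
    (hlx' : s(l', x') ∈ E) (hleaf' : ∀ e ∈ E, l' ∈ e → e = s(l', x'))
    (hne : s(l, x) ≠ s(l', x')) (hxl' : x ≠ l') (hab : s(a, b) ∈ E)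
    (h1 : s(a, b) ≠ s(l, x)) (h2 : s(a, b) ≠ s(l', x')) (ha : x' ≠ a) (hb : x ≠ b) :
    |dens side U E| ≤ c * (nrm (kdeg U (side x')) * nrm (kdeg U (side x))) := by
  rw [dens_eq_expect_leaf hE hlx hleaf,
    expect_leaf (hE.mono (erase_subset _ _)) (mem_erase.mpr ⟨hne.symm, hlx'⟩)
      (fun e he h => hleaf' e (mem_erase.mp he).2 h) (dependsOn_eval (kdeg U (side x)) hxl')]
  have := abs_expect_wprod_mul_le hc hop hU (D := (E.erase s(l, x)).erase s(l', x')) (hE _ _ hab)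
    (by simp [hab, h1, h2]) (dependsOn_eval (kdeg U (side x')) ha)
    (dependsOn_eval (kdeg U (side x)) hb)
  rw [nrm_eval, nrm_eval] at this
  refine le_trans (le_of_eq ?_) this
  congr 1
  exact expect_congr rfl fun z _ => by ring

/-- A leaf at `x`, an integrated set `T` and an edge. -/
lemma abs_dens_le_of_leaf {c : ℝ} (hc : 0 ≤ c) (hop : OpBound U c)
    (hU : ∀ s t, |U s t| ≤ 1) {E : Finset (Sym2 V)} (hE : Bip side E) {l x a b : V} {T : Finset V}
    (hlx : s(l, x) ∈ E) (hleaf : ∀ e ∈ E, l ∈ e → e = s(l, x)) (hlT : l ∉ T) (hxT : x ∉ T)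
    (hab : s(a, b) ∈ E) (h1 : s(a, b) ≠ s(l, x)) (haT : a ∉ T) (hbT : b ∉ T)
    (ha : ∀ v ∈ T, s(v, a) ∉ E) (hb : x ≠ b) :
    |dens side U E| ≤ c * (nrm (innerAvg side U E T) * nrm (kdeg U (side x))) := by
  have hsub : touch E T ⊆ E.erase s(l, x) := by
    intro e he
    obtain ⟨heE, v, hv, hve⟩ := mem_touch.mp he
    refine mem_erase.mpr ⟨?_, heE⟩
    rintro rfl
    rcases Sym2.mem_iff.mp hve with rfl | rfl
    · exact hlT hv
    · exact hxT hv
  rw [dens_eq_expect_leaf hE hlx hleaf, expect_mul_wprod_eq hsub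
    (fun e he het v hv hve => het (mem_touch.mpr ⟨(mem_erase.mp he).2, v, hv, hve⟩))
    (fun v hv => dependsOn_eval (kdeg U (side x)) (by rintro rfl; exact hxT hv))]
  have hmem : s(a, b) ∈ E.erase s(l, x) \ touch E T := by
    refine mem_sdiff.mpr ⟨mem_erase.mpr ⟨h1, hab⟩, fun h => ?_⟩
    obtain ⟨_, v, hv, hve⟩ := mem_touch.mp h
    rcases Sym2.mem_iff.mp hve with rfl | rfl
    · exact haT hv
    · exact hbT hv
  have := abs_expect_wprod_mul_le hc hop hU (hE _ _ hab) hmem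
    (dependsOn_innerAvg (U := U) (side := side) E T (Or.inr ha))
    (dependsOn_eval (kdeg U (side x)) hb)
  rw [nrm_eval] at this
  refine le_trans (le_of_eq ?_) this
  congr 1
  exact expect_congr rfl fun z _ => by ring

/-- Two integrated sets and an edge. -/
lemma abs_dens_le_of_edge {c : ℝ} (hc : 0 ≤ c) (hop : OpBound U c)
    (hU : ∀ s t, |U s t| ≤ 1) {E : Finset (Sym2 V)} (hE : Bip side E) {a b : V} {T T' : Finset V}
    (hTT' : Disjoint T T') (hno : ∀ u ∈ T, ∀ v ∈ T', s(u, v) ∉ E)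
    (hab : s(a, b) ∈ E) (haT : a ∉ T ∪ T') (hbT : b ∉ T ∪ T')
    (ha : ∀ v ∈ T, s(v, a) ∉ E) (hb : ∀ v ∈ T', s(v, b) ∉ E) :
    |dens side U E| ≤ c * (nrm (innerAvg side U E T) * nrm (innerAvg side U E T')) := by
  have hsub : touch E T' ⊆ E \ touch E T := by
    intro e he
    obtain ⟨heE, v, hv, hve⟩ := mem_touch.mp he
    refine mem_sdiff.mpr ⟨heE, fun h => ?_⟩
    obtain ⟨_, u, hu, hue⟩ := mem_touch.mp h
    have hne : u ≠ v := fun h => disjoint_left.mp hTT' hu (h ▸ hv)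
    rw [(Sym2.mem_and_mem_iff hne).mp ⟨hue, hve⟩] at heE
    exact hno u hu v hv heE
  have e1 := expect_mul_wprod_eq (side := side) (U := U) (D := E) (E := E) (T := T)
    (filter_subset _ _) (fun e he het v hv hve => het (mem_touch.mpr ⟨he, v, hv, hve⟩))
    (P := fun _ => 1) (fun v _ => fun _ _ _ => rfl)
  simp only [mul_one, one_mul] at e1
  rw [dens, e1, expect_mul_wprod_eq hsub
    (fun e he het v hv hve => het (mem_touch.mpr ⟨(mem_sdiff.mp he).1, v, hv, hve⟩))
    (fun v hv => dependsOn_innerAvg E T (Or.inr fun u hu => hno u hu v hv))]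
  have hmem : s(a, b) ∈ (E \ touch E T) \ touch E T' := by
    simp only [mem_union, not_or] at haT hbT
    refine mem_sdiff.mpr ⟨mem_sdiff.mpr ⟨hab, fun h => ?_⟩, fun h => ?_⟩
    · obtain ⟨_, v, hv, hve⟩ := mem_touch.mp h
      rcases Sym2.mem_iff.mp hve with rfl | rfl
      · exact haT.1 hv
      · exact hbT.1 hv
    · obtain ⟨_, v, hv, hve⟩ := mem_touch.mp h
      rcases Sym2.mem_iff.mp hve with rfl | rfl
      · exact haT.2 hv
      · exact hbT.2 hv
  exact abs_expect_wprod_mul_le hc hop hU (hE _ _ hab) hmem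
    (dependsOn_innerAvg (U := U) (side := side) E T (Or.inr ha))
    (dependsOn_innerAvg (U := U) (side := side) E T' (Or.inr hb))

end Paths

/-! ### Shortest cycles in a bipartite graph. -/

section Cycles

variable {V : Type*} [Fintype V] [DecidableEq V] {side : V → Bool} {E : Finset (Sym2 V)}

/-- The `n`-periodic sequence `p` runs around a cycle of length `n` in the graph `E`. -/
structure IsCyc (E : Finset (Sym2 V)) (p : ℕ → V) (n : ℕ) : Prop where
  three : 3 ≤ n
  per : ∀ i, p (i + n) = p i
  inj : ∀ i j, p i = p j → i ≡ j [MOD n]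
  adj : ∀ i, s(p i, p (i + 1)) ∈ E

lemma IsCyc.rotate {p : ℕ → V} {n : ℕ} (h : IsCyc E p n) (k : ℕ) :
    IsCyc E (fun i => p (i + k)) n where
  three := h.three
  per i := by rw [add_right_comm, h.per]
  inj i j hij := Nat.ModEq.add_right_cancel' k (h.inj _ _ hij)
  adj i := by simpa [add_right_comm] using h.adj (i + k)

lemma IsCyc.eq_of_lt {p : ℕ → V} {n : ℕ} (h : IsCyc E p n) {i j : ℕ} (hij : p i = p j)
    (h1 : i ≤ j) (h2 : j < i + n) : i = j := by
  have := (Nat.modEq_iff_dvd' h1).mp (h.inj i j hij)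
  rcases Nat.eq_zero_or_pos (j - i) with h0 | h0
  · omega
  · have := Nat.le_of_dvd h0 this; omega

lemma IsCyc.exists_lt {p : ℕ → V} {n : ℕ} (h : IsCyc E p n) (i : ℕ) : ∃ j < n, p j = p i := by
  have hn : 0 < n := by have := h.three; omega
  refine ⟨i % n, Nat.mod_lt _ hn, ?_⟩
  have hk : ∀ k j, p (j + n * k) = p j := by
    intro k j
    induction k with
    | zero => simp
    | succ k ih => rw [Nat.mul_succ, ← add_assoc, h.per, ih]
  conv_rhs => rw [← Nat.mod_add_div i n]
  rw [hk]

/-- A path whose ends are joined closes up to a cycle. -/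
lemma IsCyc.of_path {q : ℕ → V} {k : ℕ} (hk : 2 ≤ k) (hinj : Set.InjOn q (Set.Iic k))
    (hadj : ∀ i < k, s(q i, q (i + 1)) ∈ E) (hclose : s(q k, q 0) ∈ E) :
    IsCyc E (fun i => q (i % (k + 1))) (k + 1) where
  three := by omega
  per i := by simp
  inj i j hij := hinj (Nat.lt_succ_iff.mp (Nat.mod_lt _ (by omega)))
    (Nat.lt_succ_iff.mp (Nat.mod_lt _ (by omega))) hij
  adj i := by
    have hlt : i % (k + 1) < k + 1 := Nat.mod_lt _ (by omega)
    rcases Nat.lt_or_ge (i % (k + 1)) k with h | h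
    · have : (i + 1) % (k + 1) = i % (k + 1) + 1 := by
        rw [Nat.add_mod, Nat.mod_eq_of_lt (show 1 < k + 1 by omega), Nat.mod_eq_of_lt (by omega)]
      simp only [this]
      exact hadj _ h
    · have h1 : i % (k + 1) = k := by omega
      have : (i + 1) % (k + 1) = 0 := by
        rw [Nat.add_mod, h1, Nat.mod_eq_of_lt (show 1 < k + 1 by omega), Nat.mod_self]
      simp only [this, h1]
      exact hclose

lemma IsCyc.side_add {p : ℕ → V} {n : ℕ} (h : IsCyc E p n) (hE : Bip side E) (i k : ℕ) :
    side (p (i + 2 * k)) = side (p i) ∧ side (p (i + 2 * k + 1)) = !side (p i) := by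
  have hstep : ∀ i, side (p (i + 1)) = !side (p i) := by
    intro i
    have := hE _ _ (h.adj i)
    revert this
    cases side (p i) <;> cases side (p (i + 1)) <;> simp
  induction k with
  | zero => exact ⟨rfl, hstep i⟩
  | succ k ih =>
    have h1 : side (p (i + 2 * (k + 1))) = side (p i) := by
      rw [show i + 2 * (k + 1) = i + 2 * k + 1 + 1 by ring, hstep, ih.2, Bool.not_not]
    exact ⟨h1, by rw [hstep, h1]⟩

lemma IsCyc.exists_even {p : ℕ → V} {n : ℕ} (h : IsCyc E p n) (hE : Bip side E) :
    ∃ r, 2 ≤ r ∧ n = 2 * r := by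
  have h3 := h.three
  rcases Nat.even_or_odd' n with ⟨r, hr | hr⟩
  · exact ⟨r, by omega, hr⟩
  · exfalso
    have := (h.side_add hE 0 r).2
    rw [show 0 + 2 * r + 1 = 0 + n by omega, h.per] at this
    revert this
    cases side (p 0) <;> simp

/-- The cycle is of minimal length. -/
def IsShortest (E : Finset (Sym2 V)) (n : ℕ) : Prop := ∀ p m, IsCyc E p m → n ≤ m

/-- A genuine chord closes the arc from i to j to a cycle of length j - i + 1 < n. -/
lemma IsCyc.chord {p : ℕ → V} {n : ℕ} (h : IsCyc E p n) (hmin : IsShortest E n) {i j : ℕ}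
    (hij : i < j) (hj : j < i + n) (hE : s(p i, p j) ∈ E) : j = i + 1 ∨ j + 1 = i + n := by
  by_contra! hc
  have hinj : Set.InjOn (fun m => p (m + i)) (Set.Iic (j - i)) := by
    intro a ha b hb hab
    have ha' : a ≤ j - i := ha
    have hb' : b ≤ j - i := hb
    rcases le_total a b with hle | hle
    · have := h.eq_of_lt hab (by omega) (by omega); omega
    · have := h.eq_of_lt hab.symm (by omega) (by omega); omega
  have := hmin _ _ (IsCyc.of_path (E := E) (q := fun m => p (m + i)) (k := j - i) (by omega) hinj
    (fun m _ => (h.rotate i).adj m) (by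
      simp only [zero_add]
      rw [Nat.sub_add_cancel hij.le, Sym2.eq_swap]
      exact hE))
  omega

lemma IsCyc.isChordless {p : ℕ → V} {n r : ℕ} (h : IsCyc E p n) (hmin : IsShortest E n)
    (hr : r < n) : IsChordless E p r where
  inj := by
    intro a ha b hb hab
    have ha' : a ≤ r := ha
    have hb' : b ≤ r := hb
    rcases le_total a b with hle | hle
    · exact h.eq_of_lt hab hle (by omega)
    · exact (h.eq_of_lt hab.symm hle (by omega)).symm
  adj i _ := h.adj i
  chord i j hij hj hE := by
    rcases h.chord hmin hij (by omega) hE with h | h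
    · exact Or.inl h
    · exact Or.inr (by omega)

/-- The arc from `p i` to `p j` closes through `v` to a cycle of length j - i + 2. -/
lemma IsCyc.length_le_of_two_neighbours_aux {p : ℕ → V} {n : ℕ} (h : IsCyc E p n)
    (hmin : IsShortest E n) {v : V} (hv : ∀ i, p i ≠ v) {i j : ℕ} (hij : i < j) (hj : j < i + n)
    (h1 : s(v, p i) ∈ E) (h2 : s(v, p j) ∈ E) : n ≤ j - i + 2 := by
  set q : ℕ → V := fun m => if m ≤ j - i then p (m + i) else v with hq
  have hinj : Set.InjOn q (Set.Iic (j - i + 1)) := by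
    intro a ha b hb hab
    have ha' : a ≤ j - i + 1 := ha
    have hb' : b ≤ j - i + 1 := hb
    simp only [hq] at hab
    split_ifs at hab with c1 c2 c2
    · rcases le_total a b with hle | hle
      · have := h.eq_of_lt hab (by omega) (by omega); omega
      · have := h.eq_of_lt hab.symm (by omega) (by omega); omega
    · exact absurd hab (hv _)
    · exact absurd hab.symm (hv _)
    · omega
  have := hmin _ _ (IsCyc.of_path (E := E) (q := q) (k := j - i + 1) (by omega) hinj
    (fun m hm => by
      simp only [hq]
      rw [if_pos (by omega)]
      split_ifs with c
      · exact (h.rotate i).adj m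
      · rw [show m + i = j by omega, Sym2.eq_swap]
        exact h2)
    (by simp only [hq]; rw [if_neg (by omega)]; simpa using h1))
  omega

/-- A vertex off a shortest cycle of length at least five has at most one neighbour on it. -/
lemma IsCyc.neighbour_unique {p : ℕ → V} {n : ℕ} (h : IsCyc E p n)
    (hmin : IsShortest E n) (hn : 5 ≤ n) {v : V} (hv : ∀ i, p i ≠ v) {i j : ℕ}
    (h1 : s(v, p i) ∈ E) (h2 : s(v, p j) ∈ E) : p i = p j := by
  obtain ⟨i', hi', hi⟩ := h.exists_lt i
  obtain ⟨j', hj', hj⟩ := h.exists_lt j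
  rw [← hi] at h1 ⊢
  rw [← hj] at h2 ⊢
  -- The bound for both arcs between the two neighbours adds up to 2n ≤ n + 4, against n ≥ 5.
  have key : ∀ i j, i < j → j < n → s(v, p i) ∈ E → s(v, p j) ∈ E → False := by
    intro i j hij hj h1 h2
    have a := h.length_le_of_two_neighbours_aux hmin hv hij (by omega) h1 h2
    have b := h.length_le_of_two_neighbours_aux hmin hv (i := j) (j := i + n) (by omega) (by omega)
      h2 (by rwa [h.per])
    omega
  rcases lt_trichotomy i' j' with hlt | heq | hlt
  · exact (key _ _ hlt hj' h1 h2).elim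
  · rw [heq]
  · exact (key _ _ hlt hi' h2 h1).elim

/-- `l` is a leaf with neighbour `x`. -/
def IsLeafAt (E : Finset (Sym2 V)) (l x : V) : Prop := s(l, x) ∈ E ∧ ∀ e ∈ E, l ∈ e → e = s(l, x)

lemma exists_other_edge {l x : V} (hx : s(l, x) ∈ E) (h : ¬ IsLeafAt E l x) :
    ∃ y, s(l, y) ∈ E ∧ y ≠ x := by
  simp only [IsLeafAt, not_and, not_forall] at h
  obtain ⟨e, he, hle, hne⟩ := h hx
  obtain ⟨y, rfl⟩ := Sym2.mem_iff_exists.mp hle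
  exact ⟨y, he, fun h => hne (by rw [h])⟩

/-- A nonempty graph with at most one leaf has a cycle. -/
lemma exists_isCyc (hE : Bip side E) (hne : E.Nonempty)
    (hleaf : ∀ l x l' x', IsLeafAt E l x → IsLeafAt E l' x' → l = l') :
    ∃ p n, IsCyc E p n ∧ IsShortest E n := by
  suffices h : ∃ n, ∃ p, IsCyc E p n by
    classical
    obtain ⟨p, hp⟩ := Nat.find_spec h
    exact ⟨p, Nat.find h, hp, fun q m hq => Nat.find_min' h ⟨q, hq⟩⟩
  set IsP : (ℕ → V) → ℕ → Prop := fun q k => Set.InjOn q (Set.Iic k) ∧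
    ∀ i < k, s(q i, q (i + 1)) ∈ E with hIsP
  have hbound : ∀ k, (∃ q, IsP q k) → k < Fintype.card V + 1 := by
    rintro k ⟨q, hq, -⟩
    have : (Iic k).card ≤ (univ : Finset V).card :=
      card_le_card_of_injOn q (by simp) (by simpa using hq)
    simp at this
    omega
  have hfin : {k | ∃ q, IsP q k}.Finite :=
    (Set.finite_Iio (Fintype.card V + 1)).subset fun k hk => hbound k hk
  have h1 : ∃ q, IsP q 1 := by
    obtain ⟨e, he⟩ := hne
    induction e using Sym2.inductionOn with
    | hf u v =>
      have huv : u ≠ v := fun h => hE _ _ he (by rw [h])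
      refine ⟨fun i => if i = 0 then u else v, ?_, ?_⟩
      · intro a ha b hb hab
        have ha' : a ≤ 1 := ha
        have hb' : b ≤ 1 := hb
        simp only at hab
        split_ifs at hab with c1 c2 c2
        · omega
        · exact absurd hab huv
        · exact absurd hab.symm huv
        · omega
      · intro i hi
        obtain rfl : i = 0 := by omega
        simpa using he
  obtain ⟨k, ⟨q, hq⟩, hmax⟩ := Set.exists_max_image _ id hfin ⟨1, h1⟩
  have hk1 : 1 ≤ k := hmax 1 h1
  -- A longest path, reversed if its last vertex is a leaf; its two ends cannot both be leaves.
  obtain ⟨q, ⟨hinj, hadj⟩, hend⟩ : ∃ q, IsP q k ∧ ∀ x, ¬ IsLeafAt E (q k) x := by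
    by_cases hl : ∀ x, ¬ IsLeafAt E (q k) x
    · exact ⟨q, hq, hl⟩
    push Not at hl
    obtain ⟨x, hx⟩ := hl
    refine ⟨fun i => q (k - i), ⟨?_, ?_⟩, ?_⟩
    · intro a ha b hb hab
      have ha' : a ≤ k := ha
      have hb' : b ≤ k := hb
      have := hq.1 (show k - a ≤ k by omega) (show k - b ≤ k by omega) hab
      omega
    · intro i hi
      have := hq.2 (k - (i + 1)) (by omega)
      rw [show k - (i + 1) + 1 = k - i by omega, Sym2.eq_swap] at this
      exact this
    · intro y hy
      simp only [Nat.sub_self] at hy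
      have := hq.1 (show 0 ≤ k by omega) (show k ≤ k from le_rfl) (hleaf _ _ _ _ hy hx)
      omega
  have hlast : s(q k, q (k - 1)) ∈ E := by
    have := hadj (k - 1) (by omega)
    rwa [Nat.sub_add_cancel hk1, Sym2.eq_swap] at this
  obtain ⟨w, hw, hwne⟩ := exists_other_edge hlast (hend _)
  -- Otherwise `w` would prolong the longest path; being on it, `w` closes a cycle.
  have hon : ∃ i ≤ k, q i = w := by
    by_contra! hoff
    have hP : IsP (fun i => if i ≤ k then q i else w) (k + 1) := by
      refine ⟨?_, ?_⟩
      · intro a ha b hb hab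
        have ha' : a ≤ k + 1 := ha
        have hb' : b ≤ k + 1 := hb
        simp only at hab
        split_ifs at hab with c1 c2 c2
        · exact hinj c1 c2 hab
        · exact absurd hab (hoff _ c1)
        · exact absurd hab.symm (hoff _ c2)
        · omega
      · intro i hi
        simp only
        rw [if_pos (by omega)]
        split_ifs with c
        · exact hadj i (by omega)
        · obtain rfl : i = k := by omega
          exact hw
    have := hmax (k + 1) ⟨_, hP⟩
    simp at this
  obtain ⟨i, hik, rfl⟩ := hon
  have hi1 : i ≠ k := fun h => hE _ _ hw (by rw [h])
  have hi2 : i ≠ k - 1 := fun h => hwne (by rw [h])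
  refine ⟨_, _, IsCyc.of_path (E := E) (q := fun m => q (m + i)) (k := k - i) (by omega) ?_ ?_ ?_⟩
  · intro a ha b hb hab
    have ha' : a ≤ k - i := ha
    have hb' : b ≤ k - i := hb
    have := hinj (show a + i ≤ k by omega) (show b + i ≤ k by omega) hab
    omega
  · intro m hm
    have := hadj (m + i) (by omega)
    rwa [add_right_comm] at this
  · simpa [Nat.sub_add_cancel hik] using hw

/-- A four-cycle as a periodic sequence. -/
lemma isCyc_four {a b a' b' : V} (haa : a ≠ a') (hbb : b ≠ b') (hE : Bip side E)
    (h1 : s(a, b) ∈ E) (h2 : s(b, a') ∈ E) (h3 : s(a', b') ∈ E) (h4 : s(b', a) ∈ E) :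
    ∃ p, IsCyc E p 4 ∧ p 0 = a ∧ p 1 = b ∧ p 2 = a' ∧ p 3 = b' := by
  have n1 : a ≠ b := fun h => hE _ _ h1 (by rw [h])
  have n2 : b ≠ a' := fun h => hE _ _ h2 (by rw [h])
  have n3 : a' ≠ b' := fun h => hE _ _ h3 (by rw [h])
  have n4 : b' ≠ a := fun h => hE _ _ h4 (by rw [h])
  set q : ℕ → V := fun i => if i = 0 then a else if i = 1 then b else if i = 2 then a' else b'
    with hq
  refine ⟨_, IsCyc.of_path (E := E) (q := q) (k := 3) (by omega) ?_ ?_ ?_, ?_, ?_, ?_, ?_⟩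
  · intro x hx y hy hxy
    have hx' : x ≤ 3 := hx
    have hy' : y ≤ 3 := hy
    interval_cases x <;> interval_cases y <;> simp_all [eq_comm]
  · intro i hi
    interval_cases i <;> simpa [hq]
  · simpa [hq] using h4
  all_goals simp [hq]

end Cycles

/-! ### Every graph that is neither a biclique nor a cycle has small density. -/

section Classification

variable {V ι : Type*} [Fintype V] [DecidableEq V] [Fintype ι] [Nonempty ι] [DecidableEq ι]
  {side : V → Bool} {U : ι → ι → ℝ} {E : Finset (Sym2 V)}

/-- The edge set of the complete bipartite graph with classes `A` and `B`. -/
def bic (A B : Finset V) : Finset (Sym2 V) := (A ×ˢ B).image fun p => s(p.1, p.2)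

lemma mem_bic {A B : Finset V} {e : Sym2 V} : e ∈ bic A B ↔ ∃ a ∈ A, ∃ b ∈ B, s(a, b) = e := by
  simp [bic, and_assoc]

lemma bic_comm (A B : Finset V) : bic A B = bic B A := by
  ext e
  rw [mem_bic, mem_bic]
  constructor <;> rintro ⟨a, ha, b, hb, rfl⟩ <;> exact ⟨b, hb, a, ha, Sym2.eq_swap⟩

/-- The assumptions on the kernel, together with a bound `M` for the main terms available
in `E`. -/
structure MainBound (side : V → Bool) (U : ι → ι → ℝ) (E : Finset (Sym2 V)) (c M : ℝ) : Prop where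
  c_nonneg : 0 ≤ c
  M_nonneg : 0 ≤ M
  op : OpBound U c
  le_one : ∀ s t, |U s t| ≤ 1
  mean : 𝔼 s, 𝔼 t, U s t = 0
  bip : Bip side E
  cherry : ∀ x y y', s(x, y) ∈ E → s(x, y') ∈ E → y ≠ y' → nrm (kdeg U (side x)) ^ 2 ≤ M
  cycle : ∀ p r, 2 ≤ r → IsCyc E p (2 * r) → evenCycle U r ≤ M

variable {c M : ℝ}

/-- The product of two norms is at most the mean of their squares. -/
lemma MainBound.le (h : MainBound side U E c M) {d x y : ℝ} (hd : d ≤ c * (x * y))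
    (hx : x ^ 2 ≤ M) (hy : y ^ 2 ≤ M) : d ≤ c * M :=
  hd.trans (mul_le_mul_of_nonneg_left (by nlinarith [sq_nonneg (x - y)]) h.c_nonneg)

lemma MainBound.nrm_innerAvg (h : MainBound side U E c M) {p : ℕ → V} {r : ℕ} (hr : 2 ≤ r)
    (hp : IsCyc E p (2 * r)) (hmin : IsShortest E (2 * r)) :
    nrm (innerAvg side U E (inner p (r - 1))) ^ 2 ≤ M :=
  (nrm_innerAvg_sq_le h.le_one h.bip (hp.isChordless hmin (by omega)) hr).trans (h.cycle p r hr hp)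

lemma IsCyc.notMem_of_leaf {p : ℕ → V} {n : ℕ} (hp : IsCyc E p n) {l x : V} (hl : IsLeafAt E l x)
    (i : ℕ) : p i ≠ l := by
  rintro rfl
  have h3 := hp.three
  have h1 := hl.2 _ (hp.adj i) (by simp)
  have h2 := hl.2 _ (hp.adj (i + n - 1)) (by
    rw [show i + n - 1 + 1 = i + n by omega, hp.per]; simp)
  rw [← h2, show i + n - 1 + 1 = i + n by omega, hp.per] at h1
  rcases Sym2.eq_iff.mp h1 with ⟨_, h⟩ | ⟨_, h⟩
  · have := hp.eq_of_lt (i := i) (j := i + 1) h.symm (by omega) (by omega); omega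
  · have := hp.eq_of_lt h (by omega) (by omega); omega

/-- With the leaf at `p 0`, the pieces are the degree function there and the half `p 1`, …, `p (r -
1)`. The free edge joins `p (r + 1)`, not adjacent to that half because there are no chords, to `p
r`, which differs from `p 0`. -/
lemma MainBound.of_leaf_at_cycle (h : MainBound side U E c M) {p : ℕ → V} {r : ℕ} (hr : 2 ≤ r)
    (hp : IsCyc E p (2 * r)) (hmin : IsShortest E (2 * r)) {l : V} {i : ℕ}
    (hl : IsLeafAt E l (p i)) : |dens side U E| ≤ c * M := by
  wlog hi : i = 0 generalizing p i
  · exact this (hp.rotate i) (i := 0) (by simpa using hl) rfl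
  subst hi
  have hoff := hp.notMem_of_leaf hl
  have hne : ∀ i j, i < j → j < i + 2 * r → p i ≠ p j := fun i j h1 h2 h => by
    have := hp.eq_of_lt h (by omega) h2; omega
  refine h.le (abs_dens_le_of_leaf h.c_nonneg h.op h.le_one h.bip hl.1 hl.2
    (T := inner p (r - 1)) (a := p (r + 1)) (b := p r) ?_ ?_ ?_ ?_ ?_ ?_ ?_ ?_)
    (h.nrm_innerAvg hr hp hmin) (h.cherry (p 0) (p 1) l ?_ ?_ (hoff 1))
  · rw [mem_inner]; rintro ⟨i, _, _, hi⟩; exact hoff i hi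
  · rw [mem_inner]; rintro ⟨i, _, _, hi⟩; exact hne 0 i (by omega) (by omega) hi.symm
  · rw [Sym2.eq_swap]; exact hp.adj r
  · intro h
    have : l ∈ s(p (r + 1), p r) := by rw [h]; simp
    rcases Sym2.mem_iff.mp this with h | h <;> exact hoff _ h.symm
  · rw [mem_inner]; rintro ⟨i, _, _, hi⟩; exact hne i (r + 1) (by omega) (by omega) hi
  · rw [mem_inner]; rintro ⟨i, _, _, hi⟩; exact hne i r (by omega) (by omega) hi
  · intro v hv hE
    obtain ⟨i, h1, h2, rfl⟩ := mem_inner.mp hv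
    rcases hp.chord hmin (by omega) (by omega) hE with h | h <;> omega
  · exact hne 0 r (by omega) (by omega)
  · exact hp.adj 0
  · rw [Sym2.eq_swap]; exact hl.1

/-- The pieces are the two open halves of the cycle between `p 0` and `p r`. They are not joined to
each other, since there are no chords, and uv is the free edge. -/
lemma MainBound.of_edge_off_cycle (h : MainBound side U E c M) {p : ℕ → V} {r : ℕ} (hr : 2 ≤ r)
    (hp : IsCyc E p (2 * r)) (hmin : IsShortest E (2 * r)) {u v : V} (huv : s(u, v) ∈ E)
    (hu : ∀ i, p i ≠ u) (hv : ∀ i, p i ≠ v) (hu' : ∀ i, 1 ≤ i → i < r → s(p i, u) ∉ E)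
    (hv' : ∀ i, r < i → i < 2 * r → s(p i, v) ∉ E) : |dens side U E| ≤ c * M := by
  have hq := hp.rotate r
  have hT' : ∀ w, w ∈ inner (fun i => p (i + r)) (r - 1) ↔ ∃ i, r < i ∧ i < 2 * r ∧ p i = w := by
    intro w
    rw [mem_inner]
    constructor
    · rintro ⟨i, h1, h2, rfl⟩
      exact ⟨i + r, by omega, by omega, rfl⟩
    · rintro ⟨i, h1, h2, rfl⟩
      exact ⟨i - r, by omega, by omega, by rw [Nat.sub_add_cancel h1.le]⟩
  refine h.le (abs_dens_le_of_edge h.c_nonneg h.op h.le_one h.bip (a := u) (b := v)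
    (T := inner p (r - 1)) (T' := inner (fun i => p (i + r)) (r - 1)) ?_ ?_ huv ?_ ?_ ?_ ?_)
    (h.nrm_innerAvg hr hp hmin) (h.nrm_innerAvg hr hq hmin)
  · rw [disjoint_left]
    intro w hw hw'
    obtain ⟨i, h1, h2, rfl⟩ := mem_inner.mp hw
    obtain ⟨j, h3, h4, h5⟩ := (hT' _).mp hw'
    have := hp.eq_of_lt h5.symm (by omega) (by omega); omega
  · intro w hw w' hw' hE
    obtain ⟨i, h1, h2, rfl⟩ := mem_inner.mp hw
    obtain ⟨j, h3, h4, rfl⟩ := (hT' _).mp hw'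
    rcases hp.chord hmin (by omega) (by omega) hE with h | h <;> omega
  · rw [mem_union, mem_inner, hT']
    rintro (⟨i, _, _, hi⟩ | ⟨i, _, _, hi⟩) <;> exact hu i hi
  · rw [mem_union, mem_inner, hT']
    rintro (⟨i, _, _, hi⟩ | ⟨i, _, _, hi⟩) <;> exact hv i hi
  · intro w hw
    obtain ⟨i, h1, h2, rfl⟩ := mem_inner.mp hw
    exact hu' i h1 (by omega)
  · intro w hw
    obtain ⟨i, h1, h2, rfl⟩ := (hT' _).mp hw
    exact hv' i h1 h2

/-- An edge off a shortest cycle of length at least six. -/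
lemma MainBound.of_edge_off_long_cycle (h : MainBound side U E c M) {p : ℕ → V} {r : ℕ}
    (hr : 3 ≤ r) (hp : IsCyc E p (2 * r)) (hmin : IsShortest E (2 * r)) {u v : V}
    (huv : s(u, v) ∈ E) (hu : ∀ i, p i ≠ u) (hv : ∀ i, p i ≠ v) : |dens side U E| ≤ c * M := by
  -- The only possible neighbour of `u` on the cycle is rotated to `p 0`, which lies in neither
  -- half.
  wlog hu0 : ∀ i, s(p i, u) ∈ E → p i = p 0 generalizing p
  · push Not at hu0
    obtain ⟨k, hk, -⟩ := hu0
    refine this (hp.rotate k) (fun i => hu _) (fun i => hv _) fun i hi => ?_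
    rw [Sym2.eq_swap] at hi hk
    simpa using hp.neighbour_unique hmin (by omega) hu hi hk
  have hu1 : ∀ i, 1 ≤ i → i < 2 * r → s(p i, u) ∉ E := by
    intro i h1 h2 hE
    have := hp.eq_of_lt (hu0 i hE).symm (by omega) (by omega); omega
  -- If `v` has its one neighbour in the second half, it has none in the first, and the roles of `u`
  -- and `v` are exchanged.
  by_cases hv1 : ∀ i, r < i → i < 2 * r → s(p i, v) ∉ E
  · exact h.of_edge_off_cycle (by omega) hp hmin huv hu hv (fun i h1 h2 => hu1 i h1 (by omega)) hv1
  push Not at hv1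
  obtain ⟨j, h1, h2, hj⟩ := hv1
  refine h.of_edge_off_cycle (u := v) (v := u) (by omega) hp hmin (by rwa [Sym2.eq_swap]) hv hu ?_
    (fun i h1 h2 => hu1 i (by omega) h2)
  intro i h3 h4 hi
  rw [Sym2.eq_swap] at hi hj
  have := hp.eq_of_lt (hp.neighbour_unique hmin (by omega) hv hi hj) (by omega) (by omega)
  omega

/-- An edge off a four-cycle, one end of which is not joined to the whole cycle. -/
lemma MainBound.of_edge_off_four_cycle (h : MainBound side U E c M) {p : ℕ → V}
    (hp : IsCyc E p 4) (hmin : IsShortest E 4) {u v : V}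
    (huv : s(u, v) ∈ E) (hu : ∀ i, p i ≠ u) (hv : ∀ i, p i ≠ v) (hu3 : s(p 3, u) ∉ E)
    (hv1 : side v = side (p 1)) : |dens side U E| ≤ c * M := by
  refine h.of_edge_off_cycle (r := 2) (u := v) (v := u) le_rfl hp hmin (by rwa [Sym2.eq_swap])
    hv hu ?_ ?_
  · intro i h1 h2 hE
    obtain rfl : i = 1 := by omega
    exact h.bip _ _ hE hv1.symm
  · intro i h1 h2 hE
    obtain rfl : i = 3 := by omega
    exact hu3 hE

lemma Bip.side_eq (hE : Bip side E) {x y z : V} (h1 : s(x, y) ∈ E) (h2 : s(x, z) ∈ E) :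
    side y = side z := by
  have a := hE _ _ h1
  have b := hE _ _ h2
  revert a b
  cases side x <;> cases side y <;> cases side z <;> simp

/-- A vertex joined to part of a maximal complete bipartite subgraph. -/
lemma MainBound.of_biclique_step (h : MainBound side U E c M) (hmin : IsShortest E 4)
    (hleaf : ∀ l x, ¬ IsLeafAt E l x) {A B : Finset V} (hA : 1 < A.card)
    (hAB : ∀ a ∈ A, ∀ b ∈ B, s(a, b) ∈ E) {a b : V} (ha : a ∉ A) (hb : b ∈ B) (hab : s(a, b) ∈ E)
    (hmax : ∃ b' ∈ B, s(a, b') ∉ E) : |dens side U E| ≤ c * M := by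
  obtain ⟨b', hb', hab'⟩ := hmax
  obtain ⟨a1, h1, a2, h2, h12⟩ := one_lt_card.mp hA
  -- Since `a` is not a leaf it has a second neighbour `v`. The edge av avoids the four-cycle a1, b,
  -- a2, b', as `a` is not joined to b'.
  obtain ⟨v, hav, hvb⟩ := exists_other_edge hab (hleaf _ _)
  have hbb' : b ≠ b' := by rintro rfl; exact hab' hab
  obtain ⟨p, hp, p0, p1, p2, p3⟩ := isCyc_four h12 hbb' h.bip (hAB _ h1 _ hb)
    (by rw [Sym2.eq_swap]; exact hAB _ h2 _ hb) (hAB _ h2 _ hb')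
    (by rw [Sym2.eq_swap]; exact hAB _ h1 _ hb')
  have hcov : ∀ w, w ≠ a1 → w ≠ b → w ≠ a2 → w ≠ b' → ∀ i, p i ≠ w := by
    intro w w1 w2 w3 w4 i hi
    obtain ⟨j, hj, hji⟩ := hp.exists_lt i
    rw [← hji] at hi
    interval_cases j <;> simp_all
  have sb : side b ≠ side a := (h.bip _ _ hab).symm
  have sbb' : side b = side b' := h.bip.side_eq (hAB _ h1 _ hb) (hAB _ h1 _ hb')
  have sv : side v = side b := h.bip.side_eq hav hab
  have sa1 : side a1 ≠ side b := h.bip _ _ (hAB _ h1 _ hb)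
  have sa2 : side a2 ≠ side b := h.bip _ _ (hAB _ h2 _ hb)
  refine h.of_edge_off_four_cycle hp hmin hav (hcov a ?_ ?_ ?_ ?_) (hcov v ?_ ?_ ?_ ?_) ?_ ?_
  · rintro rfl; exact ha h1
  · rintro rfl; exact sb rfl
  · rintro rfl; exact ha h2
  · rintro rfl; exact sb sbb'
  · rintro rfl; exact sa1 sv
  · exact hvb
  · rintro rfl; exact sa2 sv
  · rintro rfl; exact hab' hav
  · rw [p3, Sym2.eq_swap]; exact hab'
  · rw [p1]; exact sv

/-- A graph without leaves that has a four-cycle but is not complete bipartite. -/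
lemma MainBound.of_four_cycle (h : MainBound side U E c M) {p : ℕ → V} (hp : IsCyc E p 4)
    (hmin : IsShortest E 4) (hleaf : ∀ l x, ¬ IsLeafAt E l x) (hbic : ∀ A B, E ≠ bic A B) :
    |dens side U E| ≤ c * M := by
  set 𝓟 : Finset (Finset V × Finset V) := univ.filter fun P => 1 < P.1.card ∧ 1 < P.2.card ∧
    ∀ a ∈ P.1, ∀ b ∈ P.2, s(a, b) ∈ E with h𝓟
  have hne : ∀ i j, i < j → j < i + 4 → p i ≠ p j := fun i j h1 h2 h => by
    have := hp.eq_of_lt h (by omega) h2; omega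
  have hstart : ({p 0, p 2}, {p 1, p 3}) ∈ 𝓟 := by
    simp only [h𝓟, mem_filter, mem_univ, true_and]
    rw [card_pair (hne 0 2 (by omega) (by omega)), card_pair (hne 1 3 (by omega) (by omega))]
    refine ⟨by omega, by omega, ?_⟩
    have e30 : s(p 0, p 3) ∈ E := by
      have := hp.adj 3
      rwa [show 3 + 1 = 0 + 4 from rfl, hp.per, Sym2.eq_swap] at this
    have e21 : s(p 2, p 1) ∈ E := by rw [Sym2.eq_swap]; exact hp.adj 1
    simp only [mem_insert, mem_singleton]
    rintro a (rfl | rfl) b (rfl | rfl)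
    · exact hp.adj 0
    · exact e30
    · exact e21
    · exact hp.adj 2
  -- By maximality of this biclique, a vertex outside a class misses some vertex of the opposite
  -- class. An edge outside the biclique then either meets it partially or not at all.
  obtain ⟨⟨A, B⟩, hAB, hmax⟩ := exists_max_image 𝓟 (fun P => P.1.card + P.2.card) ⟨_, hstart⟩
  simp only [h𝓟, mem_filter, mem_univ, true_and] at hAB hmax
  obtain ⟨hA, hB, hAB⟩ := hAB
  have hBA : ∀ b ∈ B, ∀ a ∈ A, s(b, a) ∈ E := fun b hb a ha => by
    rw [Sym2.eq_swap]; exact hAB a ha b hb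
  have maxA : ∀ a ∉ A, ∃ b' ∈ B, s(a, b') ∉ E := by
    intro a ha
    by_contra! hc
    have := hmax (insert a A, B) ⟨by rw [card_insert_of_notMem ha]; omega, hB, by
      intro a' ha' b hb
      rcases mem_insert.mp ha' with rfl | ha'
      · exact hc b hb
      · exact hAB a' ha' b hb⟩
    simp only [card_insert_of_notMem ha] at this
    omega
  have maxB : ∀ b ∉ B, ∃ a' ∈ A, s(b, a') ∉ E := by
    intro b hb
    by_contra! hc
    have := hmax (A, insert b B) ⟨hA, by rw [card_insert_of_notMem hb]; omega, by
      intro a ha b' hb'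
      rcases mem_insert.mp hb' with rfl | hb'
      · rw [Sym2.eq_swap]; exact hc a ha
      · exact hAB a ha b' hb'⟩
    simp only [card_insert_of_notMem hb] at this
    omega
  obtain ⟨a1, h1, a2, h2, h12⟩ := one_lt_card.mp hA
  obtain ⟨b1, g1, b2, g2, g12⟩ := one_lt_card.mp hB
  have hex : ∃ a b, s(a, b) ∈ E ∧ side a = side a1 ∧ ¬ (a ∈ A ∧ b ∈ B) := by
    by_contra! hc
    refine hbic A B (Subset.antisymm ?_ ?_)
    · intro e he
      induction e using Sym2.inductionOn with
      | hf u v =>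
        rw [mem_bic]
        by_cases hs : side u = side a1
        · obtain ⟨hu, hv⟩ := hc u v he hs
          exact ⟨u, hu, v, hv, rfl⟩
        · have hs' : side v = side a1 := by
            have := h.bip _ _ he
            revert hs this
            cases side u <;> cases side v <;> cases side a1 <;> simp
          obtain ⟨hv, hu⟩ := hc v u (by rwa [Sym2.eq_swap]) hs'
          exact ⟨v, hv, u, hu, Sym2.eq_swap⟩
    · intro e he
      obtain ⟨a, ha, b, hb, rfl⟩ := mem_bic.mp he
      exact hAB a ha b hb
  obtain ⟨a, b, hab, hs, hnot⟩ := hex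
  by_cases ha : a ∈ A
  · have hb : b ∉ B := fun hb => hnot ⟨ha, hb⟩
    exact h.of_biclique_step hmin hleaf hB hBA hb ha (by rwa [Sym2.eq_swap]) (maxB b hb)
  by_cases hnb : ∃ b' ∈ B, s(a, b') ∈ E
  · obtain ⟨b', hb', hab'⟩ := hnb
    exact h.of_biclique_step hmin hleaf hA hAB ha hb' hab' (maxA a ha)
  push Not at hnb
  have hb : b ∉ B := fun hb => hnb b hb hab
  -- Here `a` has no neighbour in `B`, so ab is off any four-cycle inside the biclique.
  obtain ⟨q, hq, q0, q1, q2, q3⟩ := isCyc_four h12 g12 h.bip (hAB _ h1 _ g1)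
    (hBA _ g1 _ h2) (hAB _ h2 _ g2) (hBA _ g2 _ h1)
  have hcov : ∀ w, w ≠ a1 → w ≠ b1 → w ≠ a2 → w ≠ b2 → ∀ i, q i ≠ w := by
    intro w w1 w2 w3 w4 i hi
    obtain ⟨j, hj, hji⟩ := hq.exists_lt i
    rw [← hji] at hi
    interval_cases j <;> simp_all
  have s12 : side a1 = side a2 := h.bip.side_eq (hBA _ g1 _ h1) (hBA _ g1 _ h2)
  have t1 : side a1 ≠ side b1 := h.bip _ _ (hAB _ h1 _ g1)
  have t2 : side a1 ≠ side b2 := h.bip _ _ (hAB _ h1 _ g2)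
  have t3 : side a ≠ side b := h.bip _ _ hab
  refine h.of_edge_off_four_cycle hq hmin hab (hcov a ?_ ?_ ?_ ?_) (hcov b ?_ ?_ ?_ ?_) ?_ ?_
  · rintro rfl; exact ha h1
  · rintro rfl; exact t1 hs.symm
  · rintro rfl; exact ha h2
  · rintro rfl; exact t2 hs.symm
  · rintro rfl; exact t3 hs
  · rintro rfl; exact hb g1
  · rintro rfl; exact t3 (hs.trans s12)
  · rintro rfl; exact hb g2
  · rw [q3, Sym2.eq_swap]; exact hnb _ g2
  · rw [q1]
    rw [hs] at t3
    revert t1 t3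
    cases side a1 <;> cases side b1 <;> cases side b <;> simp

/-- The pieces are the degree functions at the two supports. If these coincide, the free edge is one
avoiding the support, which exists because the graph is not a star; otherwise it is another edge at
`x`. -/
lemma MainBound.of_two_leaves (h : MainBound side U E c M) (hbic : ∀ A B, E ≠ bic A B)
    {l x l' x' : V} (hl : IsLeafAt E l x) (hl' : IsLeafAt E l' x') (hne : l ≠ l')
    (hx : ¬ IsLeafAt E x l) (hx' : ¬ IsLeafAt E x' l') : |dens side U E| ≤ c * M := by
  have hxl : s(x, l) ∈ E := by rw [Sym2.eq_swap]; exact hl.1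
  have hxl' : s(x', l') ∈ E := by rw [Sym2.eq_swap]; exact hl'.1
  obtain ⟨y, hy, hyl⟩ := exists_other_edge hxl hx
  obtain ⟨y', hy', hyl'⟩ := exists_other_edge hxl' hx'
  have cx := h.cherry x y l hy hxl hyl
  have cx' := h.cherry x' y' l' hy' hxl' hyl'
  have n1 : x ≠ l' := by
    rintro rfl
    have a := hl'.2 _ hy (by simp)
    have b := hl'.2 _ hxl (by simp)
    rw [← b] at a
    exact hyl (Sym2.congr_right.mp a)
  have n2 : s(l, x) ≠ s(l', x') := by
    intro he
    rcases Sym2.eq_iff.mp he with ⟨h1, _⟩ | ⟨_, h2⟩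
    · exact hne h1
    · exact n1 h2
  by_cases hxx : x = x'
  · subst hxx
    by_cases hex : ∃ e ∈ E, x ∉ e
    · obtain ⟨e, he, hxe⟩ := hex
      induction e using Sym2.inductionOn with
      | hf a b =>
        simp only [Sym2.mem_iff, not_or] at hxe
        have hm : ∀ w, s(a, b) ≠ s(w, x) := fun w hw => by
          have : x ∈ s(a, b) := by rw [hw]; simp
          rcases Sym2.mem_iff.mp this with h | h
          · exact hxe.1 h
          · exact hxe.2 h
        exact h.le (abs_dens_le_of_two_leaves h.c_nonneg h.op h.le_one h.bip hl.1 hl.2 hl'.1 hl'.2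
          n2 n1 he (hm _) (hm _) hxe.1 hxe.2) cx' cx
    · push Not at hex
      exfalso
      refine hbic {x} (univ.filter fun y => s(x, y) ∈ E) ?_
      ext e
      rw [mem_bic]
      constructor
      · intro he
        obtain ⟨y, rfl⟩ := Sym2.mem_iff_exists.mp (hex e he)
        exact ⟨x, by simp, y, by simpa using he, rfl⟩
      · rintro ⟨a, ha, b, hb, rfl⟩
        rw [mem_singleton.mp ha]
        simpa using hb
  · refine h.le (abs_dens_le_of_two_leaves h.c_nonneg h.op h.le_one h.bip hl.1 hl.2 hl'.1 hl'.2
      n2 n1 hy ?_ ?_ (Ne.symm hxx) ?_) cx' cx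
    · intro he
      rw [Sym2.eq_swap (a := l)] at he
      exact hyl (Sym2.congr_right.mp he)
    · intro he
      rcases Sym2.eq_iff.mp he with ⟨h1, _⟩ | ⟨h1, _⟩
      · exact n1 h1
      · exact hxx h1
    · rintro rfl
      exact h.bip _ _ hy rfl

/-- A graph that is neither complete bipartite nor a cycle has small density compared with the
main terms. -/
theorem MainBound.abs_dens_le (h : MainBound side U E c M) (hbic : ∀ A B, E ≠ bic A B)
    (hcyc : ∀ p n, IsCyc E p n → ∃ e ∈ E, ∀ i, e ≠ s(p i, p (i + 1))) :
    |dens side U E| ≤ c * M := by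
  by_cases hiso : ∃ u v, IsLeafAt E u v ∧ IsLeafAt E v u
  · obtain ⟨u, v, hu, hv⟩ := hiso
    rw [dens_eq_zero_of_isolated_edge h.mean h.bip hu.1 hu.2
      (by rw [Sym2.eq_swap]; exact hv.2), abs_zero]
    exact mul_nonneg h.c_nonneg h.M_nonneg
  push Not at hiso
  by_cases hone : ∀ l x l' x', IsLeafAt E l x → IsLeafAt E l' x' → l = l'
  swap
  · push Not at hone
    obtain ⟨l, x, l', x', hl, hl', hne⟩ := hone
    exact h.of_two_leaves hbic hl hl' hne (hiso _ _ hl) (hiso _ _ hl')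
  have hnon : E.Nonempty := by
    rw [nonempty_iff_ne_empty]
    intro he
    exact hbic ∅ ∅ (by simp [he, bic])
  obtain ⟨p, n, hp, hmin⟩ := exists_isCyc h.bip hnon hone
  obtain ⟨r, hr, rfl⟩ := hp.exists_even h.bip
  by_cases hleafC : ∃ l i, IsLeafAt E l (p i)
  · obtain ⟨l, i, hl⟩ := hleafC
    exact h.of_leaf_at_cycle hr hp hmin hl
  push Not at hleafC
  rcases hr.eq_or_lt with rfl | hr3
  · by_cases hleaf : ∃ l x, IsLeafAt E l x
    · obtain ⟨l, x, hl⟩ := hleaf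
      have hxoff : ∀ i, p i ≠ x := by
        rintro i rfl
        exact hleafC l i hl
      have hloff := hp.notMem_of_leaf hl
      have hladj : ∀ i, s(p i, l) ∉ E := by
        intro i hi
        have := hl.2 _ hi (by simp)
        rw [Sym2.eq_swap (a := l)] at this
        exact hxoff i (Sym2.congr_left.mp this)
      have h1 := (hp.side_add h.bip 0 0).2
      simp only [mul_zero, add_zero, zero_add] at h1
      -- The four-cycle lemma wants the second end of the edge in the class of `p 1`; rotating by
      -- one step handles the other class.
      by_cases hs : side x = side (p 1)
      · exact h.of_edge_off_four_cycle hp hmin hl.1 hloff hxoff (hladj 3) hs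
      · have h2 : side x = side (p 2) := by
          have h3 := (hp.side_add h.bip 0 1).1
          simp only [mul_one, zero_add] at h3
          rw [h3]
          revert hs
          rw [h1]
          cases side x <;> cases side (p 0) <;> simp
        exact h.of_edge_off_four_cycle (hp.rotate 1) hmin hl.1 (fun i => hloff _)
          (fun i => hxoff _) (hladj 4) h2
    · push Not at hleaf
      exact h.of_four_cycle hp hmin hleaf hbic
  · obtain ⟨e, he, hne⟩ := hcyc p _ hp
    -- An edge with both ends on a shortest cycle belongs to the cycle.
    have hoff : ∃ v ∈ e, ∀ i, p i ≠ v := by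
      by_contra! hc
      induction e using Sym2.inductionOn with
      | hf u v =>
        obtain ⟨i, rfl⟩ := hc u (by simp)
        obtain ⟨j, rfl⟩ := hc v (by simp)
        obtain ⟨i', hi', hi⟩ := hp.exists_lt i
        obtain ⟨j', hj', hj⟩ := hp.exists_lt j
        rw [← hi, ← hj] at he hne
        have key : ∀ i j, i < j → j < 2 * r → s(p i, p j) ∈ E →
            ∃ k, s(p i, p j) = s(p k, p (k + 1)) := by
          intro i j hij hj hE
          rcases hp.chord hmin hij (by omega) hE with h | h
          · exact ⟨i, by rw [h]⟩
          · exact ⟨j, by rw [h, hp.per, Sym2.eq_swap]⟩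
        rcases lt_trichotomy i' j' with hlt | heq | hlt
        · obtain ⟨k, hk⟩ := key _ _ hlt hj' he
          exact hne k hk
        · exact h.bip _ _ he (by rw [heq])
        · obtain ⟨k, hk⟩ := key _ _ hlt hi' (by rwa [Sym2.eq_swap])
          exact hne k (by rw [Sym2.eq_swap, hk])
    obtain ⟨v, hve, hv⟩ := hoff
    obtain ⟨y, rfl⟩ := Sym2.mem_iff_exists.mp hve
    by_cases hy : ∀ i, p i ≠ y
    · exact h.of_edge_off_long_cycle hr3 hp hmin he hv hy
    push Not at hy
    obtain ⟨i, rfl⟩ := hy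
    -- `v` is not a leaf attached to the cycle and has only one neighbour on it, so its other edge
    -- is entirely off the cycle.
    obtain ⟨y', hy', hyne⟩ := exists_other_edge he (hleafC v i)
    refine h.of_edge_off_long_cycle hr3 hp hmin hy' hv ?_
    rintro j rfl
    exact hyne (hp.neighbour_unique hmin (by omega) hv hy' he)

end Classification

/-! ### From the cut norm to the operator norm. -/

section Operator

variable {ι : Type*} [Fintype ι] [Nonempty ι] [DecidableEq ι] {U : ι → ι → ℝ} {ε : ℝ}

lemma abs_expect_mul_le_sign {G φ : ι → ℝ} (hφ : ∀ s, |φ s| ≤ 1) :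
    |𝔼 s, φ s * G s| ≤ 𝔼 s, (if 0 ≤ G s then 1 else -1) * G s := by
  refine (abs_expect_le _ _).trans (expect_le_expect fun s _ => ?_)
  rw [abs_mul]
  refine (mul_le_of_le_one_left (abs_nonneg _) (hφ s)).trans (le_of_eq ?_)
  split_ifs with h
  · rw [abs_of_nonneg h, one_mul]
  · rw [abs_of_neg (not_le.mp h), neg_one_mul]

lemma sign_eq_indicator (G : ι → ℝ) (s : ι) : (if 0 ≤ G s then (1 : ℝ) else -1)
    = (if s ∈ univ.filter (fun s => 0 ≤ G s) then 1 else 0)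
      - (if s ∈ univ.filter (fun s => ¬ 0 ≤ G s) then 1 else 0) := by
  by_cases h : 0 ≤ G s
  · simp [h, not_lt.mpr h]
  · simp [h, not_le.mp h]

/-- The cut norm controls the bilinear form on functions bounded by one. -/
lemma abs_expect_le_of_cut (hcut : ∀ S T : Finset ι, |𝔼 s, 𝔼 t, U s t *
      ((if s ∈ S then 1 else 0) * (if t ∈ T then 1 else 0))| ≤ ε) {φ ψ : ι → ℝ}
    (hφ : ∀ s, |φ s| ≤ 1) (hψ : ∀ s, |ψ s| ≤ 1) :
    |𝔼 s, 𝔼 t, U s t * (φ s * ψ t)| ≤ 4 * ε := by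
  set G : ι → ℝ := fun s => 𝔼 t, U s t * ψ t with hG
  -- Replacing first φ and then ψ by signs only increases the form. Each sign function is a
  -- difference of two indicators, whence four cut terms.
  set σ₁ : ι → ℝ := fun s => if 0 ≤ G s then 1 else -1 with h1
  set H : ι → ℝ := fun t => 𝔼 s, U s t * σ₁ s with hH
  set σ₂ : ι → ℝ := fun t => if 0 ≤ H t then 1 else -1 with h2
  have e1 : 𝔼 s, 𝔼 t, U s t * (φ s * ψ t) = 𝔼 s, φ s * G s :=
    expect_congr rfl fun s _ => by
      rw [hG, mul_expect]; exact expect_congr rfl fun t _ => by ring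
  have e2 : 𝔼 s, σ₁ s * G s = 𝔼 t, ψ t * H t := by
    simp only [hG, hH, mul_expect]
    rw [expect_comm]
    exact expect_congr rfl fun t _ => expect_congr rfl fun s _ => by ring
  have e3 : 𝔼 t, σ₂ t * H t = 𝔼 s, 𝔼 t, U s t * (σ₁ s * σ₂ t) := by
    simp only [hH, mul_expect]
    rw [expect_comm]
    exact expect_congr rfl fun t _ => expect_congr rfl fun s _ => by ring
  rw [e1]
  refine (abs_expect_mul_le_sign hφ).trans ?_
  change 𝔼 s, σ₁ s * G s ≤ _
  rw [e2]
  refine (le_abs_self _).trans ((abs_expect_mul_le_sign hψ).trans ?_)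
  change 𝔼 s, σ₂ s * H s ≤ _
  rw [e3]
  simp only [h1, h2]
  simp_rw [sign_eq_indicator G, sign_eq_indicator H]
  set S := univ.filter fun s => 0 ≤ G s
  set S' := univ.filter fun s => ¬ 0 ≤ G s
  set T := univ.filter fun s => 0 ≤ H s
  set T' := univ.filter fun s => ¬ 0 ≤ H s
  have a1 := (abs_le.mp (hcut S T)).2
  have a2 := (abs_le.mp (hcut S T')).1
  have a3 := (abs_le.mp (hcut S' T)).1
  have a4 := (abs_le.mp (hcut S' T')).2
  have : ∀ s t, U s t * (((if s ∈ S then (1 : ℝ) else 0) - if s ∈ S' then 1 else 0) *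
      ((if t ∈ T then 1 else 0) - if t ∈ T' then 1 else 0))
      = U s t * ((if s ∈ S then 1 else 0) * (if t ∈ T then 1 else 0))
        - U s t * ((if s ∈ S then 1 else 0) * (if t ∈ T' then 1 else 0))
        - U s t * ((if s ∈ S' then 1 else 0) * (if t ∈ T then 1 else 0))
        + U s t * ((if s ∈ S' then 1 else 0) * (if t ∈ T' then 1 else 0)) := fun s t => by ring
  simp_rw [this, expect_add_distrib, expect_sub_distrib]
  linarith

/-- A kernel of small cut norm has small operator norm. -/
lemma opBound_of_cut (hU : ∀ s t, |U s t| ≤ 1) (hcut : ∀ S T : Finset ι, |𝔼 s, 𝔼 t, U s t *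
      ((if s ∈ S then 1 else 0) * (if t ∈ T then 1 else 0))| ≤ ε) {c : ℝ} (hc : 0 ≤ c)
    (hε : 4 * ε ≤ c ^ 4) : OpBound U c := by
  -- The kernel of UᵀU; its mean square is the density of the four-cycle.
  set D : ι × ι → ℝ := fun p => 𝔼 s, U s p.1 * U s p.2 with hD
  have hD2 : 𝔼 p, D p ^ 2 ≤ 4 * ε := by
    have e : 𝔼 p, D p ^ 2 = 𝔼 t', 𝔼 s', 𝔼 s, 𝔼 t,
        U s t * ((U s t' * U s' t') * U s' t) := by
      rw [← univ_product_univ, expect_product, expect_comm]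
      refine expect_congr rfl fun t' _ => ?_
      simp only [hD, sq, expect_mul_expect]
      rw [expect_comm, expect_congr rfl fun s _ => expect_comm _ _ _, expect_comm]
      refine expect_congr rfl fun s' _ => expect_congr rfl fun s _ => expect_congr rfl fun t _ => ?_
      ring
    rw [e]
    -- With two adjacent vertices of the four-cycle fixed, the other factors form a function of `s`
    -- times a function of `t`, both bounded by 1.
    refine expect_le univ_nonempty fun t' _ => expect_le univ_nonempty fun s' _ => ?_
    refine (le_abs_self _).trans (abs_expect_le_of_cut hcut (fun s => ?_) (fun t => hU _ _))
    rw [abs_mul]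
    exact mul_le_one₀ (hU _ _) (abs_nonneg _) (hU _ _)
  have hDc : nrm D ≤ c ^ 2 := by
    refine Real.sqrt_le_iff.mpr ⟨by positivity, ?_⟩
    rw [← pow_mul]
    exact hD2.trans hε
  intro φ ψ
  set G : ι → ℝ := fun s => 𝔼 t, U s t * ψ t with hG
  have e1 : 𝔼 s, 𝔼 t, U s t * (φ s * ψ t) = 𝔼 s, φ s * G s :=
    expect_congr rfl fun s _ => by
      rw [hG, mul_expect]; exact expect_congr rfl fun t _ => by ring
  have e2 : nrm G ^ 2 ≤ nrm ψ ^ 2 * c ^ 2 := by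
    have e3 : nrm G ^ 2 = 𝔼 p : ι × ι, (ψ p.1 * ψ p.2) * D p := by
      have e6 : ∀ s, G s ^ 2 = 𝔼 t, 𝔼 t', (ψ t * ψ t') * (U s t * U s t') := by
        intro s
        rw [sq, hG, expect_mul_expect]
        exact expect_congr rfl fun t _ => expect_congr rfl fun t' _ => by ring
      rw [sq_nrm, ← univ_product_univ, expect_product, expect_congr rfl fun s _ => e6 s,
        expect_comm]
      refine expect_congr rfl fun t _ => ?_
      rw [expect_comm]
      exact expect_congr rfl fun t' _ => (mul_expect _ _ _).symm
    have e4 : nrm (fun p : ι × ι => ψ p.1 * ψ p.2) = nrm ψ ^ 2 := by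
      rw [sq_nrm, nrm, ← univ_product_univ, expect_product]
      simp only [mul_pow]
      rw [← expect_mul_expect, ← sq]
      exact Real.sqrt_sq (expect_nonneg fun _ _ => sq_nonneg _)
    rw [e3]
    refine (le_abs_self _).trans ((abs_expect_mul_le _ _).trans ?_)
    rw [e4]
    exact mul_le_mul_of_nonneg_left hDc (sq_nonneg _)
  have e5 : nrm G ≤ nrm ψ * c := by
    rw [← mul_pow] at e2
    exact le_of_sq_le_sq e2 (mul_nonneg (nrm_nonneg _) hc)
  rw [e1]
  calc _ ≤ nrm φ * nrm G := abs_expect_mul_le _ _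
    _ ≤ nrm φ * (nrm ψ * c) := mul_le_mul_of_nonneg_left e5 (nrm_nonneg _)
    _ = c * (nrm φ * nrm ψ) := by ring

end Operator

/-! ### Bernoulli's inequality as a sum over subsets of size at least two. -/

section Bernoulli

lemma sum_powerset_two_le {α : Type*} (N : Finset α) (x : ℝ) :
    ∑ B ∈ N.powerset with 2 ≤ B.card, x ^ B.card = (1 + x) ^ N.card - 1 - N.card * x := by
  set f : ℕ → ℝ := fun k => x ^ k - (if k = 0 then 1 else 0) - (if k = 1 then x else 0) with hf
  have h : ∑ B ∈ N.powerset with 2 ≤ B.card, x ^ B.card = ∑ B ∈ N.powerset, f B.card := by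
    rw [sum_filter]
    refine sum_congr rfl fun B _ => ?_
    simp only [hf]
    rcases Nat.lt_or_ge B.card 2 with h | h
    · rw [if_neg (by omega)]
      generalize B.card = k at h
      interval_cases k <;> simp
    · rw [if_pos h, if_neg (by omega), if_neg (by omega)]
      ring
  rw [h, sum_powerset_apply_card f]
  simp only [hf, nsmul_eq_mul, mul_sub, sum_sub_distrib, mul_ite, mul_zero, mul_one, sum_ite_eq',
    mem_range]
  congr 1
  · congr 1
    · rw [add_comm 1 x, add_pow]
      exact sum_congr rfl fun k _ => by rw [one_pow, mul_one, mul_comm]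
    · simp
  · split_ifs with h1
    · simp
    · have : N.card = 0 := by omega
      simp [this]

/-- Equality holds at d = 0, and each step adds x ((1 + x)^(d+2) - 1), whose factors have equal
signs. -/
lemma sq_le_pow_sub {x : ℝ} (hx : -1 ≤ x) (d : ℕ) :
    x ^ 2 ≤ (1 + x) ^ (d + 2) - 1 - ((d + 2 : ℕ) : ℝ) * x := by
  induction d with
  | zero => push_cast; nlinarith
  | succ d ih =>
    have h : 0 ≤ x * ((1 + x) ^ (d + 2) - 1) := by
      rcases le_total 0 x with h0 | h0
      · exact mul_nonneg h0 (sub_nonneg.mpr (one_le_pow₀ (by linarith)))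
      · exact mul_nonneg_of_nonpos_of_nonpos h0
          (sub_nonpos.mpr (pow_le_one₀ (by linarith) (by linarith)))
    push_cast at ih ⊢
    rw [show d + 1 + 2 = d + 2 + 1 by ring, pow_succ (1 + x)]
    nlinarith

lemma sum_powerset_nonneg {α : Type*} (N : Finset α) {x : ℝ} (hx : -1 ≤ x) :
    0 ≤ ∑ B ∈ N.powerset with 2 ≤ B.card, x ^ B.card := by
  rw [sum_powerset_two_le]
  have := one_add_mul_le_pow (by linarith : -2 ≤ x) N.card
  linarith

lemma sq_le_sum_powerset {α : Type*} {N : Finset α} (hN : 2 ≤ N.card) {x : ℝ} (hx : -1 ≤ x) :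
    x ^ 2 ≤ ∑ B ∈ N.powerset with 2 ≤ B.card, x ^ B.card := by
  rw [sum_powerset_two_le]
  obtain ⟨d, hd⟩ := Nat.exists_eq_add_of_le' hN
  rw [hd]
  exact sq_le_pow_sub hx d

end Bernoulli

/-! ### Complete bipartite graphs through powers of the codegree. -/

section Biclique

variable {V ι : Type*} [Fintype V] [DecidableEq V] [Fintype ι] [Nonempty ι] [DecidableEq ι]
  {side : V → Bool} {U : ι → ι → ℝ} {E : Finset (Sym2 V)}

/-- The normalized common degree of the values at `A` into the class `b`. -/
noncomputable def codeg (side : V → Bool) (U : ι → ι → ℝ) (A : Finset V) (b : Bool)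
    (z : V → ι) : ℝ := 𝔼 t, ∏ a ∈ A, symK U (side a, z a) (b, t)

lemma abs_codeg_le (hU : ∀ s t, |U s t| ≤ 1) (A : Finset V) (b : Bool) (z : V → ι) :
    |codeg side U A b z| ≤ 1 := by
  refine (abs_expect_le _ _).trans (expect_le univ_nonempty fun t _ => ?_)
  rw [abs_prod]
  exact prod_le_one (fun _ _ => abs_nonneg _) fun a _ => abs_symK_le hU _ _

lemma expect_prod_eval (g : ι → ℝ) (B : Finset V) :
    𝔼 w : V → ι, ∏ b ∈ B, g (w b) = (𝔼 t, g t) ^ B.card := by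
  induction B using Finset.induction_on with
  | empty => simp
  | insert b B hb ih =>
    have hdep : DependsOn (fun w : V → ι => ∏ b ∈ B, g (w b)) ((({b} : Finset V) : Set V)ᶜ) := by
      intro x y hxy
      refine prod_congr rfl fun v hv => ?_
      rw [hxy v (by simp; rintro rfl; exact hb hv)]
    rw [card_insert_of_notMem hb, pow_succ, ← ih, expect_mul]
    calc 𝔼 w : V → ι, ∏ b ∈ insert b B, g (w b)
        = 𝔼 w : V → ι, (∏ b ∈ B, g (w b)) * g (w b) :=
          expect_congr rfl fun w _ => by rw [prod_insert hb, mul_comm]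
      _ = 𝔼 w : V → ι, (∏ b ∈ B, g (w b)) * avgOn {b} (fun w => g (w b)) w :=
          (expect_mul_avgOn hdep _).symm
      _ = _ := expect_congr rfl fun w _ => by simp [avgOn_singleton]

/-- Once the values at `A` are fixed, the vertices of `B` are independent and contribute one
codegree each. -/
lemma dens_bic {A B : Finset V} {c : Bool} (hA : ∀ a ∈ A, side a ≠ c) (hB : ∀ b ∈ B, side b = c) :
    dens side U (bic A B) = 𝔼 z : V → ι, codeg side U A c z ^ B.card := by
  have hinj : Set.InjOn (fun p : V × V => s(p.1, p.2)) (A ×ˢ B : Finset (V × V)) := by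
    rintro ⟨a, b⟩ h1 ⟨a', b'⟩ h2 h
    simp only [coe_product, Set.mem_prod, mem_coe] at h1 h2
    rcases Sym2.eq_iff.mp h with ⟨rfl, rfl⟩ | ⟨rfl, rfl⟩
    · rfl
    · exact absurd (hB _ h2.2) (hA _ h1.1)
  have hw : ∀ z : V → ι, wprod side U (bic A B) z
      = ∏ b ∈ B, ∏ a ∈ A, symK U (side a, z a) (c, z b) := by
    intro z
    rw [wprod, bic, prod_image hinj, prod_product_right]
    refine prod_congr rfl fun b hb => prod_congr rfl fun a _ => ?_
    rw [wt_mk, hB b hb]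
  rw [dens, ← expect_avgOn B]
  refine expect_congr rfl fun z _ => ?_
  rw [codeg, ← expect_prod_eval, avgOn]
  refine expect_congr rfl fun w _ => ?_
  rw [hw]
  refine prod_congr rfl fun b hb => prod_congr rfl fun a ha => ?_
  have haB : a ∉ B := fun h => hA a ha (hB a h)
  rw [piecewise_eq_of_mem _ _ _ hb, piecewise_eq_of_notMem _ _ _ haB]

/-- The common neighbours of `A` in the class `c`. -/
def comNbr (side : V → Bool) (E : Finset (Sym2 V)) (A : Finset V) (c : Bool) : Finset V :=
  univ.filter fun v => side v = c ∧ ∀ a ∈ A, s(a, v) ∈ E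

/-- The total density of the complete bipartite subgraphs with one class `A` and the other class
of size at least two. -/
noncomputable def bicSum (side : V → Bool) (U : ι → ι → ℝ) (E : Finset (Sym2 V)) (A : Finset V)
    (c : Bool) : ℝ :=
  ∑ B ∈ (comNbr side E A c).powerset with 2 ≤ B.card, dens side U (bic A B)

lemma bicSum_eq {A : Finset V} {c : Bool} (hA : ∀ a ∈ A, side a ≠ c) :
    bicSum side U E A c = 𝔼 z : V → ι,
      ∑ B ∈ (comNbr side E A c).powerset with 2 ≤ B.card, codeg side U A c z ^ B.card := by
  rw [expect_sum_comm]
  refine sum_congr rfl fun B hB => ?_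
  have hB' := mem_powerset.mp (mem_filter.mp hB).1
  exact dens_bic hA fun b hb => (mem_filter.mp (hB' hb)).2.1

lemma bicSum_nonneg (hU : ∀ s t, |U s t| ≤ 1) {A : Finset V} {c : Bool}
    (hA : ∀ a ∈ A, side a ≠ c) : 0 ≤ bicSum side U E A c := by
  rw [bicSum_eq hA]
  exact expect_nonneg fun z _ => sum_powerset_nonneg _ (abs_le.mp (abs_codeg_le hU A c z)).1

lemma nrm_codeg_sq_le (hU : ∀ s t, |U s t| ≤ 1) {A : Finset V} {c : Bool}
    (hA : ∀ a ∈ A, side a ≠ c) (h2 : 2 ≤ (comNbr side E A c).card) :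
    nrm (codeg side U A c) ^ 2 ≤ bicSum side U E A c := by
  rw [bicSum_eq hA, sq_nrm]
  exact expect_le_expect fun z _ => sq_le_sum_powerset h2 (abs_le.mp (abs_codeg_le hU A c z)).1

/-- The codegree is at most 1 in absolute value, so its higher powers are dominated by its square.
-/
lemma dens_bic_le (hU : ∀ s t, |U s t| ≤ 1) {A B : Finset V} {c : Bool}
    (hA : ∀ a ∈ A, side a ≠ c) (hB : B ⊆ comNbr side E A c) (h2 : 2 ≤ B.card) :
    dens side U (bic A B) ≤ bicSum side U E A c := by
  refine le_trans ?_ (nrm_codeg_sq_le hU hA (h2.trans (card_le_card hB)))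
  rw [dens_bic hA fun b hb => (mem_filter.mp (hB hb)).2.1, sq_nrm]
  refine expect_le_expect fun z _ => ?_
  refine (le_abs_self _).trans ?_
  rw [abs_pow, ← sq_abs (codeg side U A c z)]
  exact pow_le_pow_of_le_one (abs_nonneg _) (abs_codeg_le hU A c z) h2

/-- The degree is the codegree of a singleton, so the stars at x control it as soon as x has two
neighbours. -/
lemma nrm_kdeg_sq_le (hU : ∀ s t, |U s t| ≤ 1) (hE : Bip side E) {x y y' : V}
    (h1 : s(x, y) ∈ E) (h2 : s(x, y') ∈ E) (hne : y ≠ y') :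
    nrm (kdeg U (side x)) ^ 2 ≤ bicSum side U E {x} (!side x) := by
  have hs : ∀ y, s(x, y) ∈ E → side y = !side x := fun y h => by
    have := hE _ _ h
    revert this
    cases side x <;> cases side y <;> simp
  have hcard : 2 ≤ (comNbr side E {x} (!side x)).card := by
    rw [← card_pair hne]
    refine card_le_card fun v hv => ?_
    rcases mem_insert.mp hv with rfl | hv
    · simpa [comNbr, h1] using hs _ h1
    · rw [mem_singleton.mp hv]
      simpa [comNbr, h2] using hs _ h2
  have := nrm_codeg_sq_le (U := U) hU (A := {x}) (c := !side x) (by simp) hcard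
  have he : codeg side U {x} (!side x) = fun z => kdeg U (side x) (z x) := by
    ext z
    simp [codeg, kdeg]
  rwa [he, nrm_eval] at this

end Biclique

/-! ### Assembling the expansion for a finite kernel. -/

section FiniteCase

variable {V ι : Type*} [Fintype V] [DecidableEq V] [Fintype ι] [Nonempty ι] [DecidableEq ι]
  {side : V → Bool} {U : ι → ι → ℝ} {E : Finset (Sym2 V)}

/-- The edge set is that of a cycle. -/
def IsCycleSet (E : Finset (Sym2 V)) : Prop :=
  ∃ p n, IsCyc E p n ∧ ∀ e ∈ E, ∃ i, e = s(p i, p (i + 1))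

lemma evenCycle_nonneg (U : ι → ι → ℝ) {r : ℕ} (hr : 2 ≤ r) : 0 ≤ evenCycle U r := by
  obtain ⟨k, rfl⟩ := Nat.exists_eq_add_of_le' hr
  have := cyc_reflect (transpose_symK U) (List.replicate (k + 1) 1)
  rw [List.reverse_replicate, ← List.replicate_succ, ← List.replicate_add, cyc_replicate_one,
    show k + 1 + 1 + (k + 1 + 1) = 2 * (k + 2) by ring] at this
  rw [evenCycle, this]
  positivity

lemma IsCyc.exists_lt_edge {p : ℕ → V} {n : ℕ} (h : IsCyc E p n) (i : ℕ) :
    ∃ j < n, s(p i, p (i + 1)) = s(p j, p (j + 1)) := by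
  obtain ⟨j, hj, hji⟩ := h.exists_lt i
  obtain ⟨k, hk⟩ := (Nat.modEq_iff_dvd.mp (h.inj _ _ hji))
  refine ⟨j, hj, ?_⟩
  have hmod : (i + 1) ≡ (j + 1) [MOD n] := (h.inj _ _ hji.symm).add_right 1
  have hper : ∀ a, p a = p (a % n) := by
    intro a
    have hq : ∀ q b, p (b + n * q) = p b := by
      intro q b
      induction q with
      | zero => simp
      | succ q ih => rw [Nat.mul_succ, ← add_assoc, h.per, ih]
    conv_lhs => rw [← Nat.mod_add_div a n]
    exact hq _ _
  rw [hji, hper (i + 1), hper (j + 1), hmod]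

lemma dens_cycleSet (hU : ∀ s t, |U s t| ≤ 1) (hE : Bip side E) {p : ℕ → V} {r : ℕ}
    (hr : 2 ≤ r) (hp : IsCyc E p (2 * r)) (hall : ∀ e ∈ E, ∃ i, e = s(p i, p (i + 1))) :
    dens side U E = evenCycle U r / 2 := by
  have hlast : p (2 * r - 1 + 1) = p 0 := by
    rw [Nat.sub_add_cancel (by omega)]
    simpa using hp.per 0
  have hall' : ∀ e ∈ E, e = s(p 0, p (2 * r - 1)) ∨ ∃ i < 2 * r - 1, e = s(p i, p (i + 1)) := by
    intro e he
    obtain ⟨i, rfl⟩ := hall e he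
    obtain ⟨j, hj, hij⟩ := hp.exists_lt_edge i
    rw [hij]
    rcases Nat.lt_or_ge j (2 * r - 1) with h | h
    · exact Or.inr ⟨j, h, rfl⟩
    · obtain rfl : j = 2 * r - 1 := by omega
      left
      rw [hlast, Sym2.eq_swap]
  have hinj : ∀ i j, i ≤ 2 * r - 1 → j ≤ 2 * r - 1 → p i = p j → i = j := by
    intro i j hi hj hij
    rcases le_total i j with hle | hle
    · exact hp.eq_of_lt hij hle (by omega)
    · exact (hp.eq_of_lt hij.symm hle (by omega)).symm
  have hch : IsChordless E p (2 * r - 1) := by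
    refine ⟨fun i hi j hj hij => hinj i j hi hj hij, fun i _ => hp.adj i, ?_⟩
    intro i j hij hj he
    rcases hall' _ he with h | ⟨k, hk, h⟩
    · rcases Sym2.eq_iff.mp h with ⟨h1, h2⟩ | ⟨h1, h2⟩
      · exact Or.inr ⟨hinj _ _ (by omega) (by omega) h1, hinj _ _ hj le_rfl h2⟩
      · have := hinj _ _ (by omega) le_rfl h1
        omega
    · rcases Sym2.eq_iff.mp h with ⟨h1, h2⟩ | ⟨h1, h2⟩
      · have a := hinj _ _ (by omega) (by omega) h1
        have b := hinj _ _ hj (by omega) h2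
        omega
      · have a := hinj _ _ (by omega) (by omega) h1
        have b := hinj _ _ hj (by omega) h2
        omega
  refine dens_cycle hU hE hch (by omega) (by omega) ?_ hall'
  have := hp.adj (2 * r - 1)
  rwa [hlast, Sym2.eq_swap] at this

lemma dens_cycleSet_nonneg (hU : ∀ s t, |U s t| ≤ 1) (hE : Bip side E) (h : IsCycleSet E) :
    0 ≤ dens side U E := by
  obtain ⟨p, n, hp, hall⟩ := h
  obtain ⟨r, hr, rfl⟩ := hp.exists_even hE
  rw [dens_cycleSet hU hE hr hp hall]
  exact div_nonneg (evenCycle_nonneg U hr) two_pos.le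

/-- The non-isolated vertices in the class `c`. -/
def classVerts (side : V → Bool) (E : Finset (Sym2 V)) (c : Bool) : Finset V :=
  univ.filter fun v => side v = c ∧ ∃ e ∈ E, v ∈ e

/-- The classes can be read off from the edge set, so no biclique is counted twice. -/
lemma classVerts_bic {A B : Finset V} {c : Bool} (hA : ∀ a ∈ A, side a ≠ c)
    (hB : ∀ b ∈ B, side b = c) (hA0 : A.Nonempty) : classVerts side (bic A B) c = B := by
  obtain ⟨a0, ha0⟩ := hA0
  ext v
  simp only [classVerts, mem_filter, mem_univ, true_and]
  constructor
  · rintro ⟨hv, e, he, hve⟩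
    obtain ⟨a, ha, b, hb, rfl⟩ := mem_bic.mp he
    rcases Sym2.mem_iff.mp hve with rfl | rfl
    · exact absurd hv (hA _ ha)
    · exact hb
  · intro hv
    exact ⟨hB v hv, s(a0, v), mem_bic.mpr ⟨a0, ha0, v, hv, rfl⟩, by simp⟩

lemma classVerts_bic' {A B : Finset V} {c : Bool} (hA : ∀ a ∈ A, side a ≠ c)
    (hB : ∀ b ∈ B, side b = c) (hB0 : B.Nonempty) : classVerts side (bic A B) (!c) = A := by
  rw [bic_comm]
  refine classVerts_bic (fun b hb => by rw [hB b hb]; cases c <;> simp) (fun a ha => ?_) hB0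
  have := hA a ha
  revert this
  cases c <;> cases side a <;> simp

/-- The complete bipartite subgraphs of `E` with one class in `𝓐` and the other class of size at
least two on the side `c`. -/
def bicFamily (side : V → Bool) (E : Finset (Sym2 V)) (𝓐 : Finset (Finset V)) (c : Bool) :
    Finset (Finset (Sym2 V)) :=
  (𝓐.sigma fun A => (comNbr side E A c).powerset.filter fun B => 2 ≤ B.card).image
    fun P => bic P.1 P.2

lemma mem_bicFamily {𝓐 : Finset (Finset V)} {c : Bool} {E' : Finset (Sym2 V)} :
    E' ∈ bicFamily side E 𝓐 c ↔
      ∃ A ∈ 𝓐, ∃ B ⊆ comNbr side E A c, 2 ≤ B.card ∧ bic A B = E' := by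
  simp only [bicFamily, mem_image, mem_sigma, mem_filter, mem_powerset]
  constructor
  · rintro ⟨⟨A, B⟩, ⟨h1, h2, h3⟩, h4⟩
    exact ⟨A, h1, B, h2, h3, h4⟩
  · rintro ⟨A, h1, B, h2, h3, h4⟩
    exact ⟨⟨A, B⟩, ⟨h1, h2, h3⟩, h4⟩

lemma side_of_subset_comNbr {A B : Finset V} {c : Bool} (hB : B ⊆ comNbr side E A c) :
    ∀ b ∈ B, side b = c := fun _ hb => (mem_filter.mp (hB hb)).2.1

lemma bicFamily_subset (𝓐 : Finset (Finset V)) (c : Bool) :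
    bicFamily side E 𝓐 c ⊆ E.powerset := by
  intro E' h
  obtain ⟨A, _, B, hB, _, rfl⟩ := mem_bicFamily.mp h
  rw [mem_powerset]
  intro e he
  obtain ⟨a, ha, b, hb, rfl⟩ := mem_bic.mp he
  exact (mem_filter.mp (hB hb)).2.2 a ha

lemma sum_bicFamily {𝓐 : Finset (Finset V)} {c : Bool}
    (h𝓐 : ∀ A ∈ 𝓐, A.Nonempty ∧ ∀ a ∈ A, side a ≠ c) :
    ∑ E' ∈ bicFamily side E 𝓐 c, dens side U E' = ∑ A ∈ 𝓐, bicSum side U E A c := by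
  rw [bicFamily, sum_image, sum_sigma]
  · rfl
  rintro ⟨A, B⟩ h1 ⟨A', B'⟩ h2 h
  simp only [coe_sigma, Set.mem_sigma_iff, mem_coe, mem_filter, mem_powerset] at h1 h2 h
  obtain ⟨hA, hB, hB2⟩ := h1
  obtain ⟨hA', hB', hB2'⟩ := h2
  have e1 := classVerts_bic (h𝓐 A hA).2 (side_of_subset_comNbr hB) (h𝓐 A hA).1
  have e2 := classVerts_bic' (h𝓐 A hA).2 (side_of_subset_comNbr hB) (card_pos.mp (by omega))
  rw [h, classVerts_bic (h𝓐 A' hA').2 (side_of_subset_comNbr hB') (h𝓐 A' hA').1] at e1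
  rw [h, classVerts_bic' (h𝓐 A' hA').2 (side_of_subset_comNbr hB') (card_pos.mp (by omega))] at e2
  subst e1 e2
  rfl

/-- A complete bipartite graph with at least two edges belongs to one of the two families. -/
lemma bic_cases (hE : Bip side E) {A B : Finset V} (hAB : bic A B ⊆ E) (hne : (bic A B).Nonempty) :
    (∃ u v, bic A B = {s(u, v)}) ∨
    (∃ C D : Finset V, C.Nonempty ∧ (∀ a ∈ C, side a ≠ false) ∧ D ⊆ comNbr side E C false ∧
      2 ≤ D.card ∧ bic C D = bic A B) ∨
    (∃ C D : Finset V, C.card = 1 ∧ (∀ a ∈ C, side a ≠ true) ∧ D ⊆ comNbr side E C true ∧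
      2 ≤ D.card ∧ bic C D = bic A B) := by
  obtain ⟨e, he⟩ := hne
  obtain ⟨a0, ha0, b0, hb0, -⟩ := mem_bic.mp he
  have hmem : ∀ a ∈ A, ∀ b ∈ B, s(a, b) ∈ E := fun a ha b hb =>
    hAB (mem_bic.mpr ⟨a, ha, b, hb, rfl⟩)
  wlog hs : side a0 = true generalizing A B a0 b0
  · rw [bic_comm A B] at hAB he ⊢
    have hs' := hE _ _ (hmem a0 ha0 b0 hb0)
    refine this hAB he b0 hb0 a0 ha0 (fun b hb a ha => by rw [Sym2.eq_swap]; exact hmem a ha b hb) ?_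
    revert hs hs'
    cases side a0 <;> cases side b0 <;> simp
  have hsB : ∀ b ∈ B, side b = false := fun b hb => by
    have := hE _ _ (hmem a0 ha0 b hb)
    rw [hs] at this
    revert this
    cases side b <;> simp
  have hsA : ∀ a ∈ A, side a = true := fun a ha => by
    have := hE _ _ (hmem a ha b0 hb0)
    rw [hsB b0 hb0] at this
    revert this
    cases side a <;> simp
  have hB0 : 0 < B.card := card_pos.mpr ⟨b0, hb0⟩
  have hA0 : 0 < A.card := card_pos.mpr ⟨a0, ha0⟩
  rcases Nat.lt_or_ge 1 B.card with hB | hB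
  · refine Or.inr (Or.inl ⟨A, B, ⟨a0, ha0⟩, fun a ha => by simp [hsA a ha], ?_, hB, rfl⟩)
    exact fun b hb => mem_filter.mpr ⟨mem_univ _, hsB b hb, fun a ha => hmem a ha b hb⟩
  have hB1 : B.card = 1 := by omega
  rcases Nat.lt_or_ge 1 A.card with hA | hA
  · refine Or.inr (Or.inr ⟨B, A, hB1, fun a ha => by simp [hsB a ha], ?_, hA, bic_comm _ _⟩)
    refine fun a ha => mem_filter.mpr ⟨mem_univ _, hsA a ha, fun b hb => ?_⟩
    rw [Sym2.eq_swap]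
    exact hmem a ha b hb
  · obtain ⟨a, rfl⟩ := card_eq_one.mp (show A.card = 1 by omega)
    obtain ⟨b, rfl⟩ := card_eq_one.mp hB1
    exact Or.inl ⟨a, b, by simp [bic]⟩

set_option maxHeartbeats 1000000 in
/-- The finite case: a kernel of small operator norm and mean zero, added to the constant
kernel, does not decrease the density of a bipartite graph. -/
theorem one_le_expect_prod {c : ℝ} (hc : 0 ≤ c) (hop : OpBound U c) (hU : ∀ s t, |U s t| ≤ 1)
    (h0 : 𝔼 s, 𝔼 t, U s t = 0) (hE : Bip side E) (hcE : 2 ^ (E.card + 1) * c ≤ 1) :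
    1 ≤ 𝔼 z : V → ι, ∏ e ∈ E, (1 + wt side U z e) := by
  classical
  have hexp : 𝔼 z : V → ι, ∏ e ∈ E, (1 + wt side U z e) = ∑ E' ∈ E.powerset, dens side U E' := by
    simp_rw [prod_one_add]
    rw [expect_sum_comm]
    rfl
  rw [hexp]
  -- The bicliques with at least two edges are split by their class on side `false`: at least two
  -- vertices there (𝓑₁), or one vertex there and at least two opposite it (𝓑₂).
  set 𝓐₁ : Finset (Finset V) := univ.filter fun A => A.Nonempty ∧ ∀ a ∈ A, side a ≠ false with h𝓐₁
  set 𝓐₂ : Finset (Finset V) := univ.filter fun A => A.card = 1 ∧ ∀ a ∈ A, side a ≠ true with h𝓐₂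
  have p𝓐₁ : ∀ A ∈ 𝓐₁, A.Nonempty ∧ ∀ a ∈ A, side a ≠ false := fun A hA => (mem_filter.mp hA).2
  have p𝓐₂ : ∀ A ∈ 𝓐₂, A.Nonempty ∧ ∀ a ∈ A, side a ≠ true := fun A hA =>
    ⟨card_pos.mp (by rw [(mem_filter.mp hA).2.1]; exact one_pos), (mem_filter.mp hA).2.2⟩
  set 𝓑₁ := bicFamily side E 𝓐₁ false with h𝓑₁
  set 𝓑₂ := bicFamily side E 𝓐₂ true with h𝓑₂
  set 𝓢 := E.powerset \ (𝓑₁ ∪ 𝓑₂) with h𝓢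
  set 𝓒 := 𝓢.filter fun E' => IsCycleSet E' with h𝓒
  set 𝓡 := 𝓢.filter fun E' => ¬ IsCycleSet E' with h𝓡
  have hdisj : Disjoint 𝓑₁ 𝓑₂ := by
    rw [disjoint_left]
    intro E' h1 h2
    obtain ⟨A, hA, B, hB, hB2, rfl⟩ := mem_bicFamily.mp h1
    obtain ⟨A', hA', B', hB', hB2', h⟩ := mem_bicFamily.mp h2
    have e1 := classVerts_bic (p𝓐₁ A hA).2 (side_of_subset_comNbr hB) (p𝓐₁ A hA).1
    have e2 := classVerts_bic' (p𝓐₂ A' hA').2 (side_of_subset_comNbr hB') (card_pos.mp (by omega))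
    rw [h, Bool.not_true, e1] at e2
    have := (mem_filter.mp hA').2.1
    rw [← e2] at this
    omega
  have hsub : 𝓑₁ ∪ 𝓑₂ ⊆ E.powerset := union_subset (bicFamily_subset _ _) (bicFamily_subset _ _)
  set P₁ := ∑ A ∈ 𝓐₁, bicSum side U E A false with hP₁
  set P₂ := ∑ A ∈ 𝓐₂, bicSum side U E A true with hP₂
  set P₃ := ∑ E' ∈ 𝓒, dens side U E' with hP₃
  have n₁ : ∀ A ∈ 𝓐₁, 0 ≤ bicSum side U E A false := fun A hA => bicSum_nonneg hU (p𝓐₁ A hA).2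
  have n₂ : ∀ A ∈ 𝓐₂, 0 ≤ bicSum side U E A true := fun A hA => bicSum_nonneg hU (p𝓐₂ A hA).2
  have hbipS : ∀ E' ∈ 𝓢, Bip side E' := fun E' h =>
    hE.mono (mem_powerset.mp (mem_sdiff.mp h).1)
  have n₃ : ∀ E' ∈ 𝓒, 0 ≤ dens side U E' := fun E' h =>
    dens_cycleSet_nonneg hU (hbipS E' (mem_filter.mp h).1) (mem_filter.mp h).2
  have hP₁0 : 0 ≤ P₁ := sum_nonneg n₁
  have hP₂0 : 0 ≤ P₂ := sum_nonneg n₂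
  have hP₃0 : 0 ≤ P₃ := sum_nonneg n₃
  set P := P₁ + P₂ + P₃ with hP
  have le₁ : ∀ A ∈ 𝓐₁, bicSum side U E A false ≤ P := fun A hA => by
    have := single_le_sum n₁ hA
    linarith
  have le₂ : ∀ A ∈ 𝓐₂, bicSum side U E A true ≤ P := fun A hA => by
    have := single_le_sum n₂ hA
    linarith
  have le₃ : ∀ E' ∈ 𝓒, dens side U E' ≤ P := fun E' h => by
    have := single_le_sum n₃ h
    linarith
  have hsum : ∑ E' ∈ E.powerset, dens side U E' = P + ∑ E' ∈ 𝓡, dens side U E' := by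
    rw [← sum_sdiff hsub, sum_union hdisj, sum_bicFamily p𝓐₁, sum_bicFamily p𝓐₂, ← h𝓢,
      ← sum_filter_add_sum_filter_not 𝓢 fun E' => IsCycleSet E']
    ring
  have hcherry : ∀ x y y', s(x, y) ∈ E → s(x, y') ∈ E → y ≠ y' →
      nrm (kdeg U (side x)) ^ 2 ≤ P := by
    intro x y y' h1 h2 hne
    refine (nrm_kdeg_sq_le hU hE h1 h2 hne).trans ?_
    cases hs : side x
    · exact le₂ {x} (by simp [h𝓐₂, hs])
    · exact le₁ {x} (by simp [h𝓐₁, hs])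
  -- The factor 2 appears because `evenCycle` is twice the density. A four-cycle is already counted
  -- as a biclique, hence the case distinction.
  have hcycle : ∀ p r, 2 ≤ r → IsCyc E p (2 * r) → evenCycle U r ≤ 2 * P := by
    intro p r hr hp
    set C := (range (2 * r)).image fun i => s(p i, p (i + 1)) with hC
    have hCE : C ⊆ E := by
      intro e he
      obtain ⟨i, _, rfl⟩ := mem_image.mp he
      exact hp.adj i
    have hCp : IsCyc C p (2 * r) := ⟨hp.three, hp.per, hp.inj, fun i => by
      obtain ⟨j, hj, hij⟩ := hp.exists_lt_edge i
      rw [hij]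
      exact mem_image.mpr ⟨j, by simpa using hj, rfl⟩⟩
    have hCall : ∀ e ∈ C, ∃ i, e = s(p i, p (i + 1)) := by
      intro e he
      obtain ⟨i, _, rfl⟩ := mem_image.mp he
      exact ⟨i, rfl⟩
    have hd := dens_cycleSet hU (hE.mono hCE) hr hCp hCall
    have hle : dens side U C ≤ P := by
      by_cases hb : C ∈ 𝓑₁ ∪ 𝓑₂
      · rcases mem_union.mp hb with h | h
        · obtain ⟨A, hA, B, hB, hB2, hAB⟩ := mem_bicFamily.mp h
          rw [← hAB]
          exact (dens_bic_le hU (p𝓐₁ A hA).2 hB hB2).trans (le₁ A hA)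
        · obtain ⟨A, hA, B, hB, hB2, hAB⟩ := mem_bicFamily.mp h
          rw [← hAB]
          exact (dens_bic_le hU (p𝓐₂ A hA).2 hB hB2).trans (le₂ A hA)
      · exact le₃ C (mem_filter.mpr ⟨mem_sdiff.mpr ⟨mem_powerset.mpr hCE, hb⟩, p, _, hCp, hCall⟩)
    linarith
  have hbound : ∀ E' ∈ 𝓡.erase ∅, -(c * (2 * P)) ≤ dens side U E' := by
    intro E' hE'
    obtain ⟨hne, hE'⟩ := mem_erase.mp hE'
    obtain ⟨hS, hncyc⟩ := mem_filter.mp hE'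
    obtain ⟨hpow, hnb⟩ := mem_sdiff.mp hS
    have hsubE := mem_powerset.mp hpow
    have hM : MainBound side U E' c (2 * P) :=
      { c_nonneg := hc
        M_nonneg := by positivity
        op := hop
        le_one := hU
        mean := h0
        bip := hE.mono hsubE
        cherry := fun x y y' h1 h2 h => by
          have := hcherry x y y' (hsubE h1) (hsubE h2) h
          linarith
        cycle := fun p r hr hp =>
          hcycle p r hr ⟨hp.three, hp.per, hp.inj, fun i => hsubE (hp.adj i)⟩ }
    -- A nonempty biclique outside both families is a single edge, of density zero.
    by_cases hbic : ∃ A B, E' = bic A B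
    · obtain ⟨A, B, rfl⟩ := hbic
      have hz : dens side U (bic A B) = 0 := by
        rcases bic_cases hE hsubE (nonempty_iff_ne_empty.mpr hne) with
          ⟨u, v, h⟩ | ⟨C, D, h1, h2, h3, h4, h5⟩ | ⟨C, D, h1, h2, h3, h4, h5⟩
        · rw [h] at hsubE ⊢
          exact dens_eq_zero_of_isolated_edge h0 (hE.mono hsubE) (u := u) (v := v) (by simp)
            (fun e he _ => by simpa using he) (fun e he _ => by simpa using he)
        · refine absurd (mem_union_left _ ?_) hnb
          exact mem_bicFamily.mpr ⟨C, mem_filter.mpr ⟨mem_univ _, h1, h2⟩, D, h3, h4, h5⟩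
        · refine absurd (mem_union_right _ ?_) hnb
          exact mem_bicFamily.mpr ⟨C, mem_filter.mpr ⟨mem_univ _, h1, h2⟩, D, h3, h4, h5⟩
      rw [hz]
      have : 0 ≤ c * (2 * P) := by positivity
      linarith
    · refine (abs_le.mp (hM.abs_dens_le (fun A B h => hbic ⟨A, B, h⟩) ?_)).1
      intro p n hp
      by_contra! hall
      exact hncyc ⟨p, n, hp, hall⟩
  have hempty : (∅ : Finset (Sym2 V)) ∈ 𝓡 := by
    refine mem_filter.mpr ⟨mem_sdiff.mpr ⟨by simp, ?_⟩, ?_⟩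
    · intro h
      rcases mem_union.mp h with h | h
      · obtain ⟨A, hA, B, hB, hB2, hAB⟩ := mem_bicFamily.mp h
        have := classVerts_bic (p𝓐₁ A hA).2 (side_of_subset_comNbr hB) (p𝓐₁ A hA).1
        rw [hAB] at this
        simp [classVerts] at this
        rw [← this] at hB2
        simp at hB2
      · obtain ⟨A, hA, B, hB, hB2, hAB⟩ := mem_bicFamily.mp h
        have := classVerts_bic (p𝓐₂ A hA).2 (side_of_subset_comNbr hB) (p𝓐₂ A hA).1
        rw [hAB] at this
        simp [classVerts] at this
        rw [← this] at hB2
        simp at hB2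
    · rintro ⟨p, n, hp, -⟩
      exact absurd (hp.adj 0) (by simp)
  have hcard : ((𝓡.erase ∅).card : ℝ) ≤ 2 ^ E.card := by
    have : (𝓡.erase ∅).card ≤ E.powerset.card := card_le_card fun E' h =>
      (mem_sdiff.mp (mem_filter.mp (mem_erase.mp h).2).1).1
    rw [card_powerset] at this
    exact_mod_cast this
  have hrest : -P ≤ ∑ E' ∈ 𝓡.erase ∅, dens side U E' := by
    have h1 := card_nsmul_le_sum _ _ _ hbound
    rw [nsmul_eq_mul] at h1
    refine le_trans ?_ h1
    have h2 : ((𝓡.erase ∅).card : ℝ) * (c * (2 * P)) ≤ 2 ^ E.card * (c * (2 * P)) :=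
      mul_le_mul_of_nonneg_right hcard (by positivity)
    have h3 : 2 ^ E.card * (c * (2 * P)) = (2 ^ (E.card + 1) * c) * P := by
      rw [pow_succ]; ring
    have h4 : (2 ^ (E.card + 1) * c) * P ≤ 1 * P :=
      mul_le_mul_of_nonneg_right hcE (by positivity)
    linarith
  have hdempty : dens side U (∅ : Finset (Sym2 V)) = 1 := by simp [dens, wprod]
  rw [hsum, ← add_sum_erase _ _ hempty, hdempty]
  linarith

/-- The finite case with the cut norm. -/
theorem one_le_expect_prod_of_cut (hU : ∀ s t, |U s t| ≤ 1) (h0 : 𝔼 s, 𝔼 t, U s t = 0)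
    (hE : Bip side E) (hcut : ∀ S T : Finset ι, |𝔼 s, 𝔼 t, U s t *
      ((if s ∈ S then 1 else 0) * (if t ∈ T then 1 else 0))| ≤ ((2 : ℝ) ^ (8 * E.card))⁻¹) :
    1 ≤ 𝔼 z : V → ι, ∏ e ∈ E, (1 + wt side U z e) := by
  -- With at most one edge the average is exactly 1; the choice of `c` below needs two edges.
  rcases Nat.lt_or_ge E.card 2 with hlt | hge
  · have h01 : E.card = 0 ∨ E.card = 1 := by omega
    rcases h01 with h | h
    · simp [card_eq_zero.mp h]
    · obtain ⟨e, rfl⟩ := card_eq_one.mp h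
      induction e using Sym2.inductionOn with
      | hf u v =>
        have hz : dens side U {s(u, v)} = 0 :=
          dens_eq_zero_of_isolated_edge h0 hE (u := u) (v := v) (by simp)
            (fun e he _ => by simpa using he) (fun e he _ => by simpa using he)
        simp only [dens, wprod, prod_singleton] at hz
        simp [expect_add_distrib, hz]
  -- With m edges, c⁴ = 16 · 2^(-8m) covers 4 · 2^(-8m), and 2^(m+1) c = 4 / 2^m is at most 1 for m
  -- ≥ 2.
  · set c : ℝ := 2 * ((2 : ℝ) ^ (2 * E.card))⁻¹ with hc
    refine one_le_expect_prod (c := c) (by positivity) (opBound_of_cut hU hcut (by positivity) ?_)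
      hU h0 hE ?_
    · rw [hc, mul_pow, inv_pow, ← pow_mul, show 2 * E.card * 4 = 8 * E.card by ring]
      gcongr
      norm_num
    · rw [hc, two_mul E.card, pow_add _ E.card E.card, pow_succ _ E.card]
      have h4 : (4 : ℝ) ≤ 2 ^ E.card := by
        calc (4 : ℝ) = 2 ^ 2 := by norm_num
          _ ≤ 2 ^ E.card := pow_le_pow_right₀ (by norm_num) hge
      generalize (2 : ℝ) ^ E.card = y at h4
      rw [show y * 2 * (2 * (y * y)⁻¹) = 4 / y by field_simp; norm_num]
      exact (div_le_one (by linarith)).mpr h4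

end FiniteCase

/-! ### Grid cells of the unit square and approximation by cell averages. -/

section Cells

/-- `φ` divides the unit interval into `N` short cells of equal measure. -/
structure IsCellMap {N : ℕ} (φ : I → Fin N) : Prop where
  measurable : Measurable φ
  fiber : ∀ i, (volume : Measure I).real (φ ⁻¹' {i}) = 1 / N
  dist_le : ∀ x y, φ x = φ y → dist x y ≤ 1 / N

lemma exists_isCellMap (n : ℕ) : ∃ φ : I → Fin (n + 1), IsCellMap φ := by
  have hN : (0 : ℝ) < n + 1 := by positivity
  -- The minimum puts the endpoint 1 into the last cell.
  set φ : I → Fin (n + 1) := fun x => ⟨min ⌊((n : ℝ) + 1) * x⌋₊ n, by omega⟩ with hφ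
  have hlow : ∀ (x : I) (i : Fin (n + 1)), φ x = i → (i : ℝ) ≤ (n + 1) * x := by
    rintro x i rfl
    have h0 : 0 ≤ ((n : ℝ) + 1) * x := mul_nonneg hN.le x.2.1
    refine le_trans ?_ (Nat.floor_le h0)
    exact Nat.cast_le.mpr (min_le_left _ _)
  have hup : ∀ (x : I) (i : Fin (n + 1)), φ x = i → ((n : ℝ) + 1) * x ≤ i + 1 := by
    rintro x i rfl
    simp only [hφ]
    rcases le_total ⌊((n : ℝ) + 1) * x⌋₊ n with h | h
    · rw [min_eq_left h]
      exact (Nat.lt_floor_add_one _).le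
    · rw [min_eq_right h]
      exact mul_le_of_le_one_right hN.le x.2.2
  have hfib : ∀ i : Fin (n + 1), φ ⁻¹' {i} =
      if (i : ℕ) < n then {x : I | (i : ℝ) ≤ (n + 1) * x ∧ ((n : ℝ) + 1) * x < i + 1}
      else {x : I | (n : ℝ) ≤ (n + 1) * x} := by
    intro i
    ext x
    have h0 : 0 ≤ ((n : ℝ) + 1) * x := mul_nonneg hN.le x.2.1
    have : φ x = i ↔ min ⌊((n : ℝ) + 1) * x⌋₊ n = (i : ℕ) := by
      simp only [hφ, Fin.ext_iff]
    rw [Set.mem_preimage, Set.mem_singleton_iff, this]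
    split_ifs with h
    · rw [Set.mem_ofPred_eq, ← Nat.floor_eq_iff h0]
      omega
    · rw [Set.mem_ofPred_eq, ← Nat.le_floor_iff h0]
      have := i.2
      omega
  have hIco : ∀ i : Fin (n + 1), (h : (i : ℕ) < n) → φ ⁻¹' {i} =
      Set.Ico (⟨i / (n + 1), by positivity, by
        rw [div_le_one hN]; exact_mod_cast (by omega : (i : ℕ) ≤ n + 1)⟩ : I)
        ⟨(i + 1) / (n + 1), by positivity, by
        rw [div_le_one hN]; exact_mod_cast (by omega : (i : ℕ) + 1 ≤ n + 1)⟩ := by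
    intro i h
    rw [hfib, if_pos h]
    ext x
    rw [Set.mem_ofPred_eq, Set.mem_Ico, ← Subtype.coe_le_coe, ← Subtype.coe_lt_coe]
    simp only
    rw [div_le_iff₀ hN, lt_div_iff₀ hN, mul_comm]
  have hIci : ∀ i : Fin (n + 1), (h : ¬ (i : ℕ) < n) → φ ⁻¹' {i} =
      Set.Ici (⟨n / (n + 1), by positivity, by
        rw [div_le_one hN]; linarith⟩ : I) := by
    intro i h
    rw [hfib, if_neg h]
    ext x
    rw [Set.mem_ofPred_eq, Set.mem_Ici, ← Subtype.coe_le_coe]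
    simp only
    rw [div_le_iff₀ hN, mul_comm]
  refine ⟨φ, measurable_to_countable' fun i => ?_, fun i => ?_, fun x y hxy => ?_⟩
  · by_cases h : (i : ℕ) < n
    · rw [hIco i h]; exact measurableSet_Ico
    · rw [hIci i h]; exact measurableSet_Ici
  · push_cast
    by_cases h : (i : ℕ) < n
    · rw [hIco i h, measureReal_def, unitInterval.volume_Ico, ENNReal.toReal_ofReal]
      · simp only; field_simp; ring
      · simp only; rw [← sub_div]; simp; positivity
    · rw [hIci i h, measureReal_def, unitInterval.volume_Ici, ENNReal.toReal_ofReal]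
      · simp only; field_simp; ring
      · simp only; rw [sub_nonneg, div_le_one hN]; linarith
  · have a := hlow x _ rfl
    have b := hup x _ rfl
    have a' := hlow y _ hxy.symm
    have b' := hup y _ hxy.symm
    push_cast
    rw [Subtype.dist_eq, Real.dist_eq, abs_le, neg_le, le_div_iff₀ hN,
      le_div_iff₀ hN]
    constructor <;> nlinarith

variable {N : ℕ} [NeZero N] {φ : I → Fin N}

lemma IsCellMap.integral_pi (hφ : IsCellMap φ) {V : Type*} [Fintype V] [DecidableEq V]
    (G : (V → Fin N) → ℝ) :
    ∫ x : V → I, G (fun v => φ (x v)) = 𝔼 z, G z := by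
  have hm : Measurable fun (x : V → I) (v : V) => φ (x v) :=
    measurable_pi_lambda _ fun v => hφ.measurable.comp (measurable_pi_apply v)
  have h1 : ∫ x : V → I, G (fun v => φ (x v))
      = ∫ y, G y ∂((volume : Measure (V → I)).map fun x v => φ (x v)) :=
    (integral_map hm.aemeasurable (measurable_of_countable G).aestronglyMeasurable).symm
  have : IsProbabilityMeasure ((volume : Measure (V → I)).map fun x v => φ (x v)) :=
    Measure.isProbabilityMeasure_map hm.aemeasurable
  rw [h1, integral_fintype .of_finite, Fintype.expect_eq_sum_div_card, sum_div]
  refine sum_congr rfl fun z _ => ?_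
  have hpre : (fun (x : V → I) (v : V) => φ (x v)) ⁻¹' {z}
      = Set.univ.pi fun v => φ ⁻¹' {z v} := by
    ext x
    simp [funext_iff]
  rw [map_measureReal_apply hm (measurableSet_singleton z), hpre, measureReal_def, volume_pi,
    Measure.pi_pi, ENNReal.toReal_prod]
  have : ∀ v, ((volume : Measure I) (φ ⁻¹' {z v})).toReal = 1 / N := fun v => hφ.fiber _
  simp_rw [this]
  simp [div_eq_inv_mul]

/-- The pair of cells containing a point of the square. -/
def sqCell (φ : I → Fin N) (p : I × I) : Fin N × Fin N := (φ p.1, φ p.2)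

lemma IsCellMap.measurable_sqCell (hφ : IsCellMap φ) : Measurable (sqCell φ) :=
  (hφ.measurable.comp measurable_fst).prodMk (hφ.measurable.comp measurable_snd)

lemma IsCellMap.measureReal_sqCell (hφ : IsCellMap φ) (q : Fin N × Fin N) :
    (volume : Measure (I × I)).real (sqCell φ ⁻¹' {q}) = 1 / (N : ℝ) ^ 2 := by
  have : sqCell φ ⁻¹' {q} = (φ ⁻¹' {q.1}) ×ˢ (φ ⁻¹' {q.2}) := by
    ext p
    simp [sqCell, Prod.ext_iff]
  rw [this, measureReal_def, Measure.volume_eq_prod, Measure.prod_prod, ENNReal.toReal_mul]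
  change (volume : Measure I).real _ * (volume : Measure I).real _ = _
  rw [hφ.fiber, hφ.fiber]
  ring

lemma IsCellMap.integral_sq (hφ : IsCellMap φ) (G : Fin N × Fin N → ℝ) :
    ∫ p : I × I, G (sqCell φ p) = ∑ q, G q / (N : ℝ) ^ 2 := by
  have hm := hφ.measurable_sqCell
  have h1 : ∫ p : I × I, G (sqCell φ p)
      = ∫ y, G y ∂((volume : Measure (I × I)).map (sqCell φ)) :=
    (integral_map hm.aemeasurable (measurable_of_countable G).aestronglyMeasurable).symm
  have : IsProbabilityMeasure ((volume : Measure (I × I)).map (sqCell φ)) :=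
    Measure.isProbabilityMeasure_map hm.aemeasurable
  rw [h1, integral_fintype .of_finite]
  refine sum_congr rfl fun q _ => ?_
  rw [map_measureReal_apply hm (measurableSet_singleton q), hφ.measureReal_sqCell, smul_eq_mul]
  ring

lemma IsCellMap.sum_integral (hφ : IsCellMap φ) {f : I × I → ℝ} (hf : Integrable f)
    (P : Finset (Fin N × Fin N)) :
    ∑ q ∈ P, ∫ p in sqCell φ ⁻¹' {q}, f p = ∫ p in sqCell φ ⁻¹' P, f p := by
  rw [← integral_biUnion_finset]
  · congr 2
    ext p
    simp
  · exact fun q _ => hφ.measurable_sqCell (measurableSet_singleton q)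
  · intro q _ q' _ hne
    refine Set.disjoint_left.mpr fun p hp hp' => hne ?_
    rw [← Set.mem_singleton_iff.mp hp, ← Set.mem_singleton_iff.mp hp']
  · exact fun q _ => hf.integrableOn

/-- The average of `f` over a cell of the square. -/
noncomputable def cellAvg (φ : I → Fin N) (f : I × I → ℝ) (q : Fin N × Fin N) : ℝ :=
  (N : ℝ) ^ 2 * ∫ p in sqCell φ ⁻¹' {q}, f p

lemma cast_pos_of_neZero : (0 : ℝ) < N := by exact_mod_cast Nat.pos_of_ne_zero (NeZero.ne N)

lemma IsCellMap.abs_cellAvg_le (hφ : IsCellMap φ) {f : I × I → ℝ} {c : ℝ} (q : Fin N × Fin N)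
    (hc : ∀ p, sqCell φ p = q → |f p| ≤ c) : |cellAvg φ f q| ≤ c := by
  have hN := cast_pos_of_neZero (N := N)
  have h := norm_setIntegral_le_of_norm_le_const (μ := (volume : Measure (I × I)))
    (s := sqCell φ ⁻¹' {q}) (f := f) (C := c) (measure_lt_top _ _) (fun p hp => hc p hp)
  rw [hφ.measureReal_sqCell, Real.norm_eq_abs] at h
  rw [cellAvg, abs_mul, abs_of_pos (by positivity)]
  calc (N : ℝ) ^ 2 * |∫ p in sqCell φ ⁻¹' {q}, f p| ≤ (N : ℝ) ^ 2 * (c * (1 / (N : ℝ) ^ 2)) := by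
        gcongr
    _ = c := by field_simp

/-- Cut values of the averaged kernel are cut values of `f` on unions of cells. Thus averaging
preserves the mean and cannot increase the cut norm. -/
lemma IsCellMap.expect_cellAvg (hφ : IsCellMap φ) {f : I × I → ℝ} (hf : Integrable f)
    (S T : Finset (Fin N)) :
    𝔼 s, 𝔼 t, cellAvg φ f (s, t) * ((if s ∈ S then 1 else 0) * (if t ∈ T then 1 else 0))
      = ∫ p in (φ ⁻¹' S) ×ˢ (φ ⁻¹' T), f p := by
  have hN := cast_pos_of_neZero (N := N)
  have hset : (φ ⁻¹' S) ×ˢ (φ ⁻¹' T) = sqCell φ ⁻¹' ((S ×ˢ T : Finset (Fin N × Fin N)) : Set _) := by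
    ext p
    simp [sqCell]
  rw [hset, ← hφ.sum_integral hf, sum_product]
  simp_rw [Fintype.expect_eq_sum_div_card, Fintype.card_fin, ← sum_div]
  have h1 : ∀ s, ∑ t, cellAvg φ f (s, t) * ((if s ∈ S then 1 else 0) * (if t ∈ T then 1 else 0))
      = if s ∈ S then ∑ t ∈ T, cellAvg φ f (s, t) else 0 := by
    intro s
    by_cases hs : s ∈ S
    · simp [hs]
    · simp [hs]
  simp_rw [h1]
  rw [sum_ite_mem, univ_inter, div_div, eq_comm, eq_div_iff (by positivity), sum_mul]
  refine sum_congr rfl fun s _ => ?_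
  rw [sum_mul]
  refine sum_congr rfl fun t _ => ?_
  rw [cellAvg]
  ring

lemma IsCellMap.integral_abs_cellAvg_le (hφ : IsCellMap φ) {f : I × I → ℝ} (hf : Integrable f) :
    ∫ p, |cellAvg φ f (sqCell φ p)| ≤ ∫ p, |f p| := by
  have hN := cast_pos_of_neZero (N := N)
  rw [hφ.integral_sq fun q => |cellAvg φ f q|]
  have h := hφ.sum_integral hf.abs univ
  rw [coe_univ, Set.preimage_univ, setIntegral_univ] at h
  rw [← h]
  refine sum_le_sum fun q _ => ?_
  rw [cellAvg, abs_mul, abs_of_pos (by positivity), mul_div_cancel_left₀ _ (by positivity)]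
  exact abs_integral_le_integral_abs

lemma IsCellMap.integrable_comp (hφ : IsCellMap φ) (G : Fin N × Fin N → ℝ) :
    Integrable fun p => G (sqCell φ p) := by
  obtain ⟨C, hC⟩ := (Set.finite_range fun q => ‖G q‖).bddAbove
  refine Integrable.of_bound ((measurable_of_countable G).comp
    hφ.measurable_sqCell).aestronglyMeasurable C ?_
  exact Filter.Eventually.of_forall fun p => hC ⟨_, rfl⟩

/-- Integrable functions on the square are approximated by their cell averages. -/
lemma exists_cellAvg_approx {f : I × I → ℝ} (hf : Integrable f) {η : ℝ} (hη : 0 < η) :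
    ∃ (n : ℕ) (φ : I → Fin (n + 1)), IsCellMap φ ∧
      ∫ p, |f p - cellAvg φ f (sqCell φ p)| ≤ η := by
  -- A continuous `g` near `f` in L¹ is uniformly near its cell averages on a fine grid, and
  -- averaging contracts L¹: three errors of η / 3.
  obtain ⟨g, -, hfg, hgc, hgi⟩ := hf.exists_hasCompactSupport_integral_sub_le
    (show 0 < η / 3 by positivity)
  simp only [Real.norm_eq_abs] at hfg
  obtain ⟨δ, hδ, hg⟩ := Metric.uniformContinuous_iff.mp
    (CompactSpace.uniformContinuous_of_continuous hgc) (η / 3) (by positivity)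
  obtain ⟨n, hn⟩ := exists_nat_one_div_lt hδ
  obtain ⟨φ, hφ⟩ := exists_isCellMap n
  refine ⟨n, φ, hφ, ?_⟩
  have hd : Integrable fun p => f p - g p := hf.sub hgi
  have hlin : ∀ q, cellAvg φ f q = cellAvg φ g q + cellAvg φ (fun p => f p - g p) q := by
    intro q
    rw [cellAvg, cellAvg, cellAvg, integral_sub hf.integrableOn hgi.integrableOn]
    ring
  have hgA : ∀ p, |g p - cellAvg φ g (sqCell φ p)| ≤ η / 3 := by
    intro p
    have h1 : g p - cellAvg φ g (sqCell φ p)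
        = cellAvg φ (fun p' => g p - g p') (sqCell φ p) := by
      have hN : (0 : ℝ) < ((n + 1 : ℕ) : ℝ) := by positivity
      rw [cellAvg, cellAvg, integral_sub (integrable_const _).integrableOn hgi.integrableOn,
        setIntegral_const, hφ.measureReal_sqCell, smul_eq_mul]
      field_simp
    rw [h1]
    refine hφ.abs_cellAvg_le _ fun p' hp' => ?_
    have h2 : dist p p' < δ := by
      rw [Prod.dist_eq, max_lt_iff]
      simp only [sqCell, Prod.mk.injEq] at hp'
      have a := hφ.dist_le p.1 p'.1 hp'.1.symm
      have b := hφ.dist_le p.2 p'.2 hp'.2.symm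
      push_cast at a b
      exact ⟨a.trans_lt hn, b.trans_lt hn⟩
    have := hg h2
    rw [Real.dist_eq] at this
    exact this.le
  have hAi := hφ.integrable_comp (cellAvg φ fun p => f p - g p)
  calc ∫ p, |f p - cellAvg φ f (sqCell φ p)|
      ≤ ∫ p, (|f p - g p| + η / 3 + |cellAvg φ (fun p => f p - g p) (sqCell φ p)|) := by
        refine integral_mono (hf.sub (hφ.integrable_comp _)).abs
          ((hd.abs.add (integrable_const _)).add hAi.abs) fun p => ?_
        simp only
        rw [hlin]
        have h1 := hgA p
        have h2 := abs_add_three (f p - g p) (g p - cellAvg φ g (sqCell φ p))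
          (-cellAvg φ (fun p => f p - g p) (sqCell φ p))
        rw [abs_neg] at h2
        refine le_trans (le_of_eq ?_) (h2.trans (by linarith))
        congr 1
        ring
    _ = (∫ p, |f p - g p|) + η / 3 + ∫ p, |cellAvg φ (fun p => f p - g p) (sqCell φ p)| := by
        have h1 : ∫ p, (|f p - g p| + η / 3) = (∫ p, |f p - g p|) + η / 3 := by
          rw [integral_add hd.abs (integrable_const _)]
          simp
        rw [← h1]
        exact integral_add (hd.abs.add (integrable_const _)) hAi.abs
    _ ≤ η / 3 + η / 3 + η / 3 := by
        have := hφ.integral_abs_cellAvg_le hd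
        linarith
    _ = η := by ring

end Cells

end LocalSidorenko

namespace LocalSidorenko

open Finset Function
open scoped BigOperators

/-! ### Continuity of densities in the L¹ distance of kernels. -/

section Transfer

/-- A product of factors bounded by `2` is Lipschitz in its factors. -/
lemma abs_prod_sub_prod_le {κ : Type*} (s : Finset κ) {f g : κ → ℝ}
    (hf : ∀ e ∈ s, |f e| ≤ 2) (hg : ∀ e ∈ s, |g e| ≤ 2) :
    |∏ e ∈ s, f e - ∏ e ∈ s, g e| ≤ 2 ^ #s * ∑ e ∈ s, |f e - g e| := by
  classical
  induction s using Finset.induction_on with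
  | empty => simp
  | insert a s ha ih =>
    have ih := ih (fun e he => hf e (mem_insert_of_mem he)) fun e he =>
      hg e (mem_insert_of_mem he)
    have hfs : |∏ e ∈ s, f e| ≤ 2 ^ #s := by
      rw [abs_prod, ← prod_const]
      exact prod_le_prod (fun _ _ => abs_nonneg _) fun e he => hf e (mem_insert_of_mem he)
    rw [prod_insert ha, prod_insert ha, sum_insert ha, card_insert_of_notMem ha, pow_succ]
    have hsplit : f a * ∏ e ∈ s, f e - g a * ∏ e ∈ s, g e
        = (f a - g a) * ∏ e ∈ s, f e + g a * (∏ e ∈ s, f e - ∏ e ∈ s, g e) := by ring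
    rw [hsplit]
    refine (abs_add_le _ _).trans ?_
    rw [abs_mul, abs_mul]
    have h1 : |f a - g a| * |∏ e ∈ s, f e| ≤ |f a - g a| * 2 ^ #s := by gcongr
    have h2 : |g a| * |∏ e ∈ s, f e - ∏ e ∈ s, g e| ≤ 2 * (2 ^ #s * ∑ e ∈ s, |f e - g e|) := by
      gcongr
      exact hg a (mem_insert_self _ _)
    have h3 : 0 ≤ (2 : ℝ) ^ #s * |f a - g a| := by positivity
    linarith

/-- Distinct coordinates are independent and uniform, so an edge factor can be integrated over the
square. -/
lemma measurePreserving_pair {V : Type*} [Fintype V] {a b : V} (hab : a ≠ b) :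
    MeasurePreserving (fun x : V → I => (x a, x b)) := by
  have hind := (ProbabilityTheory.iIndepFun_pi (μ := fun _ : V => (volume : Measure I))
    (X := fun _ => id) fun _ => aemeasurable_id).indepFun hab
  have ha := measurePreserving_eval (fun _ : V => (volume : Measure I)) a
  have hb := measurePreserving_eval (fun _ : V => (volume : Measure I)) b
  refine ⟨(measurable_pi_apply a).prodMk (measurable_pi_apply b), ?_⟩
  have h := (ProbabilityTheory.indepFun_iff_map_prod_eq_prod_map_map ha.aemeasurable
    hb.aemeasurable).mp hind
  rw [ha.map_eq, hb.map_eq] at h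
  exact h

/-- Replacing the kernel in a product over pairs of distinct coordinates changes the integral by at
most a multiple of the `L¹`-distance. -/
lemma abs_integral_prod_sub_le {V : Type*} [Fintype V] (s : Finset (V × V))
    (hs : ∀ e ∈ s, e.1 ≠ e.2) {f g : I × I → ℝ} (hfm : AEStronglyMeasurable f)
    (hgm : AEStronglyMeasurable g) (hf : ∀ p, |f p| ≤ 2) (hg : ∀ p, |g p| ≤ 2) :
    |(∫ x : V → I, ∏ e ∈ s, f (x e.1, x e.2)) - ∫ x : V → I, ∏ e ∈ s, g (x e.1, x e.2)|
      ≤ 2 ^ #s * (#s * ∫ p, |f p - g p|) := by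
  have hprod : ∀ h : I × I → ℝ, AEStronglyMeasurable h → (∀ p, |h p| ≤ 2) →
      Integrable fun x : V → I => ∏ e ∈ s, h (x e.1, x e.2) := by
    intro h hm hb
    refine Integrable.of_bound (C := 2 ^ #s) ?_ (.of_forall fun x => ?_)
    · exact Finset.aestronglyMeasurable_fun_prod _ fun e he =>
        hm.comp_measurePreserving (measurePreserving_pair (hs e he))
    · rw [Real.norm_eq_abs, abs_prod, ← prod_const]
      exact prod_le_prod (fun _ _ => abs_nonneg _) fun e _ => hb _
  have hd : Integrable fun p => |f p - g p| :=
    ((Integrable.of_bound hfm 2 (.of_forall hf)).sub (.of_bound hgm 2 (.of_forall hg))).abs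
  have hde : ∀ e ∈ s, Integrable fun x : V → I => |f (x e.1, x e.2) - g (x e.1, x e.2)| :=
    fun e he => (measurePreserving_pair (hs e he)).integrable_comp_of_integrable hd
  have hie : ∀ e ∈ s, ∫ x : V → I, |f (x e.1, x e.2) - g (x e.1, x e.2)|
      = ∫ p, |f p - g p| := by
    intro e he
    have hmp := measurePreserving_pair (hs e he)
    rw [← hmp.map_eq, integral_map hmp.aemeasurable (hmp.map_eq ▸ hd.aestronglyMeasurable)]
  rw [← integral_sub (hprod f hfm hf) (hprod g hgm hg)]
  refine abs_integral_le_integral_abs.trans ?_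
  calc ∫ x : V → I, |∏ e ∈ s, f (x e.1, x e.2) - ∏ e ∈ s, g (x e.1, x e.2)|
      ≤ ∫ x : V → I, 2 ^ #s * ∑ e ∈ s, |f (x e.1, x e.2) - g (x e.1, x e.2)| :=
        integral_mono ((hprod f hfm hf).sub (hprod g hgm hg)).abs
          ((integrable_finsetSum _ hde).const_mul _) fun x =>
          abs_prod_sub_prod_le s (fun e _ => hf _) fun e _ => hg _
    _ = 2 ^ #s * (#s * ∫ p, |f p - g p|) := by
        rw [integral_const_mul, integral_finsetSum _ hde, sum_congr rfl hie, sum_const,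
          nsmul_eq_mul]

end Transfer

/-! ### The density of `F` as a product over unordered edges. -/

section Bipartite

variable {V : Type*} [Fintype V] [DecidableEq V] {F : SimpleGraph V} [DecidableRel F.Adj]
  {A B : Finset V}

lemma bip_edgeFinset (hF : F.IsBipartiteWith (A : Set V) (B : Set V)) :
    Bip (fun v => decide (v ∈ A)) F.edgeFinset := by
  intro u v huv
  rw [SimpleGraph.mem_edgeFinset, SimpleGraph.mem_edgeSet] at huv
  have hd := Set.disjoint_left.mp hF.disjoint
  rcases hF.mem_of_adj huv with ⟨hu, hv⟩ | ⟨hu, hv⟩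
  · have hv' : v ∉ A := fun h => hd h hv
    simp [mem_coe.mp hu, hv']
  · have hu' : u ∉ A := fun h => hd h hu
    simp [mem_coe.mp hv, hu']

lemma prod_adj_eq_prod_edgeFinset {ι : Type*} [Fintype ι] [Nonempty ι] [DecidableEq ι]
    (hF : F.IsBipartiteWith (A : Set V) (B : Set V))
    (U : ι → ι → ℝ) (z : V → ι) :
    ∏ e ∈ (A ×ˢ B).filter (fun e => F.Adj e.1 e.2), (1 + U (z e.1) (z e.2))
      = ∏ e ∈ F.edgeFinset, (1 + wt (fun v => decide (v ∈ A)) U z e) := by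
  have hd := Set.disjoint_left.mp hF.disjoint
  refine prod_nbij (fun e => s(e.1, e.2)) ?_ ?_ ?_ ?_
  · intro e he
    simpa using (mem_filter.mp he).2
  · rintro ⟨a, b⟩ he ⟨a', b'⟩ he' h
    simp only [coe_filter, mem_product, Set.mem_ofPred_eq] at he he'
    rcases Sym2.eq_iff.mp h with ⟨h1, h2⟩ | ⟨h1, h2⟩
    · exact Prod.ext h1 h2
    · simp only at h1 h2
      exact absurd (mem_coe.mpr (h1 ▸ he'.1.2)) (hd (mem_coe.mpr he.1.1))
  · intro e he
    induction e using Sym2.ind with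
    | _ u v =>
      have huv : F.Adj u v := by simpa using he
      rcases hF.mem_of_adj huv with ⟨hu, hv⟩ | ⟨hu, hv⟩
      · exact ⟨(u, v), by simpa using ⟨⟨hu, hv⟩, huv⟩, rfl⟩
      · exact ⟨(v, u), by simpa using ⟨⟨hv, hu⟩, huv.symm⟩, Sym2.eq_swap⟩
  · rintro ⟨a, b⟩ he
    simp only [mem_filter, mem_product] at he
    have hb : b ∉ A := fun h => hd (mem_coe.mpr h) (mem_coe.mpr he.1.2)
    simp [wt_mk, symK_apply, he.1.1, hb]

end Bipartite

lemma abs_setIntegral_le_cutNorm {U : I → I → ℝ} (hU : ∀ x y, |U x y| ≤ 1) {S T : Set I}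
    (hS : MeasurableSet S) (hT : MeasurableSet T) :
    |∫ p in S ×ˢ T, U p.1 p.2| ≤ cutNorm U := by
  refine le_csSup ⟨1, ?_⟩ ⟨S, T, hS, hT, rfl⟩
  rintro _ ⟨S, T, -, -, rfl⟩
  have h := norm_setIntegral_le_of_norm_le_const (μ := (volume : Measure (I × I)))
    (s := S ×ˢ T) (f := fun p => U p.1 p.2) (C := 1) (measure_lt_top _ _) fun p _ => hU _ _
  rw [one_mul] at h
  exact h.trans measureReal_le_one

end LocalSidorenko

open LocalSidorenko in
theorem mainTheorem1 {V : Type*} [Fintype V] [DecidableEq V]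
    (F : SimpleGraph V) [DecidableRel F.Adj] (A B : Finset V)
    (hF : F.IsBipartiteWith (A : Set V) (B : Set V))
    (W : I → I → ℝ)
    (hW_meas : AEMeasurable (fun p : I × I => W p.1 p.2) volume)
    (hW_int : ∫ p : I × I, W p.1 p.2 = 1)
    (hW_bdd : ∀ x y, 0 ≤ W x y ∧ W x y ≤ 2)
    (hW_cut : cutNorm (fun x y => W x y - 1) ≤ ((2 : ℝ) ^ (8 * F.edgeFinset.card))⁻¹) :
    bigraphDensity F A B (fun _ _ => 1) = 1 ∧ 1 ≤ bigraphDensity F A B W := by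
  refine ⟨by simp [bigraphDensity], ?_⟩
  set s := (A ×ˢ B).filter fun e => F.Adj e.1 e.2 with hs
  have hne : ∀ e ∈ s, e.1 ≠ e.2 := fun e he => (Finset.mem_filter.mp he).2.ne
  set f : I × I → ℝ := fun p => W p.1 p.2 - 1 with hf
  have hf1 : ∀ p, |f p| ≤ 1 := fun p => by
    have := hW_bdd p.1 p.2
    rw [hf, abs_le]
    constructor <;> linarith
  have hWi : Integrable fun p : I × I => W p.1 p.2 :=
    .of_bound hW_meas.aestronglyMeasurable 2 (.of_forall fun p => by
      rw [Real.norm_of_nonneg (hW_bdd _ _).1]; exact (hW_bdd _ _).2)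
  have hfi : Integrable f := hWi.sub (integrable_const 1)
  have hf0 : ∫ p, f p = 0 := by
    rw [hf, integral_sub hWi (integrable_const 1), hW_int]
    simp
  -- The finite theorem applied to the cell averages of W - 1, with the L¹ approximation error
  -- carried along.
  have key : ∀ η : ℝ, 0 < η →
      1 ≤ bigraphDensity F A B W + 2 ^ s.card * (s.card * η) := by
    intro η hη
    obtain ⟨n, φ, hφ, hfη⟩ := exists_cellAvg_approx hfi hη
    have hU : ∀ q, |cellAvg φ f q| ≤ 1 := fun q => hφ.abs_cellAvg_le q fun p _ => hf1 p
    have hcell := one_le_expect_prod_of_cut (side := fun v => decide (v ∈ A))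
      (U := fun i j => cellAvg φ f (i, j)) (E := F.edgeFinset) (fun i j => hU _)
      (by simpa [hf0] using hφ.expect_cellAvg hfi Finset.univ Finset.univ) (bip_edgeFinset hF)
      (fun S T => by
        rw [hφ.expect_cellAvg hfi]
        exact (abs_setIntegral_le_cutNorm (U := fun x y => W x y - 1) (fun x y => hf1 (x, y))
          (hφ.measurable S.measurableSet) (hφ.measurable T.measurableSet)).trans hW_cut)
    simp_rw [← prod_adj_eq_prod_edgeFinset hF (fun i j => cellAvg φ f (i, j))] at hcell
    rw [← hφ.integral_pi] at hcell
    have hdiff := abs_integral_prod_sub_le s hne (f := fun p => 1 + f p)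
      (g := fun p => 1 + cellAvg φ f (sqCell φ p))
      (aestronglyMeasurable_const.add hfi.aestronglyMeasurable)
      (aestronglyMeasurable_const.add (hφ.integrable_comp _).aestronglyMeasurable)
      (fun p => (abs_add_le _ _).trans (by rw [abs_one]; linarith [hf1 p]))
      (fun p => (abs_add_le _ _).trans (by rw [abs_one]; linarith [hU (sqCell φ p)]))
    have hW : bigraphDensity F A B W = ∫ x : V → I, ∏ e ∈ s, (1 + f (x e.1, x e.2)) := by
      simp only [bigraphDensity, hf, add_sub_cancel, hs]
    rw [← hW] at hdiff
    simp only [add_sub_add_left_eq_sub] at hdiff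
    have hle : (2 : ℝ) ^ s.card * (s.card * ∫ p, |f p - cellAvg φ f (sqCell φ p)|)
        ≤ 2 ^ s.card * (s.card * η) := by gcongr
    have := (abs_le.mp (hdiff.trans hle)).1
    simp only [sqCell] at this
    linarith
  refine le_of_forall_pos_le_add fun ε hε => ?_
  -- This η makes the error at most ε; the added 1 keeps the denominator positive when there are no
  -- edges.
  refine (key (ε / (2 ^ s.card * (s.card + 1))) (by positivity)).trans ?_
  gcongr
  rw [mul_div_assoc', mul_div_assoc', div_le_iff₀ (by positivity)]
  have : (0 : ℝ) ≤ ε * 2 ^ s.card := by positivity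
  nlinarith
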